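/- Let $\Sigma$ be a closed (compact, without boundary), connected, orientable smooth surface, let $x_0\in\Sigma$ and $\pi=\pi_1(\Sigma,x_0)$. Let $E=\Sigma\times\mathbb C$ be the trivial complex line bundle with its standard section $\tau_0=1$. A connection on $E$ is an additive operator $D$ from smooth sections of $E$ to smooth $E$-valued one-forms with $D(fs)=f\,D(s)+df\otimes s$; it is flat if its curvature $D\circ D$ vanishes. A smooth map $g:\Sigma\to\mathbb C^*$ (a gauge transformation) acts on connections by $(g\cdot D)(s)=g^{-1}D(gs)$, that is, $D\mapsto D+g^{-1}dg$. For each of the structure groups $G=\mathbb C^*,\ U(1),\ \mathbb R^+,\ \mathbb R^*$ let $\mathcal F_G$ be the following set of flat connections on $E$ and $\mathcal G_G$ the following group of gauge transformations, which acts on $\mathcal F_G$: * $G=\mathbb C^*$: all flat connections, and all smooth maps $\Sigma\to\mathbb C^*$; * $G=U(1)$: the flat connections that are unitary for the standard Hermitian metric, and the smooth maps $\Sigma\to U(1)$; * $G=\mathbb R^+$: the flat connections that preserve the trivial real line bundle $\Sigma\times\mathbb R\subset E$, and the smooth maps $\Sigma\to\mathbb R^+$; * $G=\mathbb R^*$: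 the flat connections that preserve some real line subbundle $L\subset E$ (not necessarily trivial) with $L\otimes_{\mathbb R}\mathbb C=E$ and $L_{x_0}=\mathbb R\,\tau_0(x_0)$, and the smooth maps $g:\Sigma\to\mathbb C^*$ with $g(x_0)\in\mathbb R^*$. For a group $\Gamma$ acting on a set $S$, let $(S,\Gamma)$ denote the transformation groupoid, with objects the elements of $S$ and morphisms $x\to y$ the $g\in\Gamma$ with $g\cdot x=y$. The de Rham groupoid is $(\mathcal F_G,\mathcal G_G)$ and the Betti groupoid is $(\mathrm{Hom}(\pi,G),G)$, where $G$ acts by conjugation (hence trivially). Then for each of these $G$: 1. Every $D\in\mathcal F_G$ has a unique holonomy representation $\mathsf{hol}(D)\in\mathrm{Hom}(\pi,G)$, that is, a unique homomorphism such that the $D$-parallel transport along each smooth loop $\gamma$ at $x_0$ is multiplication by $\mathsf{hol}(D)([\gamma])$. (With $D\tau_0=\eta\,\tau_0$, a section $f(t)\,\tau_0(\gamma(t))$ along $\gamma$ is parallel if $f'+\eta(\gamma')f=0$.) 2. The holonomy functor $$\mathsf{hol}:(\mathcal F_G,\mathcal G_G)\longrightarrow(\mathrm{Hom}(\pi,G),G),\qquad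 D\mapsto\mathsf{hol}(D),\quad g\mapsto g(x_0),$$ is an equivalence of categories. -/

import Mathlib

open scoped Manifold ContDiff Bundle Topology
open CategoryTheory

/-- Multiplication of complex numbers is smooth over `ℝ`. -/
instance complexContMDiffRing : ContMDiffRing 𝓘(ℝ, ℂ) ∞ ℂ where
  contMDiff_mul := by
    rw [← modelWithCornersSelf_prod]
    have : ContDiff ℝ ∞ (fun p : ℂ × ℂ ↦ p.1 * p.2) := contDiff_mul
    rw [← contMDiff_iff_contDiff] at this
    convert! this
    exact chartedSpaceSelf_prod

set_option linter.unusedSectionVars false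

noncomputable section
namespace FlatLine

/-! ### Functions, one-forms, exterior derivative -/

/-- The model space of smooth surfaces. -/
abbrev Plane : Type := EuclideanSpace ℝ (Fin 2)

section
variable (M : Type*) [TopologicalSpace M] [ChartedSpace Plane M] [IsManifold (𝓡 2) ∞ M]
/-- Smooth complex-valued functions on `M`. They are also the smooth sections of the trivial
complex line bundle `E = M × ℂ`: the function `f` is the section `f τ₀`, where `τ₀ = 1` is the
standard trivialization. -/
abbrev SmoothFun := C^∞⟮𝓡 2, M; 𝓘(ℝ, ℂ), ℂ⟯
/-- Smooth complex-valued one-forms on `M`: smooth sections of `Hom_ℝ(TM, ℂ)`. Via `τ₀` they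
are also the one-forms with values in `E`. -/
abbrev OneForm :=
  Cₛ^∞⟮𝓡 2; Plane →L[ℝ] ℂ, fun x : M ↦ TangentSpace (𝓡 2) x →L[ℝ] Bundle.Trivial M ℂ x⟯
/-- The group of linear gauge transformations of `E`: smooth maps `M → ℂˣ`. -/
abbrev Gauge := C^∞⟮𝓡 2, M; 𝓘(ℝ, ℂ), ℂˣ⟯
end

variable {M : Type*} [TopologicalSpace M] [ChartedSpace Plane M] [IsManifold (𝓡 2) ∞ M]

/-- The value of a one-form at a point, as a real-linear map into `ℂ`. -/
def OneForm.val (α : OneForm M) (x : M) : TangentSpace (𝓡 2) x →L[ℝ] ℂ := α x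

/-- Smoothness of a one-form in the coordinates given by the tangent bundle. -/
theorem contMDiffAt_form_iff (w : ∀ x : M, TangentSpace (𝓡 2) x →L[ℝ] ℂ) (x₀ : M) :
    ContMDiffAt (𝓡 2) ((𝓡 2).prod 𝓘(ℝ, Plane →L[ℝ] ℂ)) ∞
      (fun x ↦ Bundle.TotalSpace.mk' (Plane →L[ℝ] ℂ)
        (E := fun x : M ↦ TangentSpace (𝓡 2) x →L[ℝ] Bundle.Trivial M ℂ x) x (w x)) x₀ ↔
    ContMDiffAt (𝓡 2) 𝓘(ℝ, Plane →L[ℝ] ℂ) ∞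
      (fun x ↦ w x ∘L (trivializationAt Plane (TangentSpace (𝓡 2)) x₀).symmL ℝ x) x₀ := by
  have key : (fun x ↦ ContinuousLinearMap.inCoordinates Plane (TangentSpace (𝓡 2) (M := M)) ℂ
      (Bundle.Trivial M ℂ) x₀ x x₀ x (w x)) =
      fun x ↦ w x ∘L (trivializationAt Plane (TangentSpace (𝓡 2)) x₀).symmL ℝ x := by
    funext x
    ext v
    simp [ContinuousLinearMap.inCoordinates]
  rw [contMDiffAt_hom_bundle, ← key]
  exact ⟨fun h ↦ h.2, fun h ↦ ⟨contMDiffAt_id, h⟩⟩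

/-- The product `f α` of a smooth function and a one-form. -/
def OneForm.mul (f : SmoothFun M) (α : OneForm M) : OneForm M where
  toFun x := f x • α.val x
  contMDiff_toFun x₀ := by
    have hα := (contMDiffAt_form_iff α.val x₀).1 (α.contMDiff x₀)
    refine (contMDiffAt_form_iff (fun x ↦ f x • α.val x) x₀).2 ?_
    have hf : ContMDiffAt (𝓡 2) 𝓘(ℝ, ℂ) ∞ f x₀ := f.contMDiff x₀
    have hc : ContDiff ℝ ∞ (fun p : ℂ × (Plane →L[ℝ] ℂ) ↦ p.1 • p.2) := contDiff_smul
    exact hc.contMDiff.contMDiffAt.comp x₀ (hf.prodMk_space hα)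

@[simp] theorem OneForm.mul_val (f : SmoothFun M) (α : OneForm M) (x : M) :
    (α.mul f).val x = f x • α.val x := rfl

theorem OneForm.ext_val {α β : OneForm M} (h : ∀ x v, α.val x v = β.val x v) : α = β :=
  ContMDiffSection.ext fun x ↦ ContinuousLinearMap.ext (h x)

/-- The pullback of `α` to `ℝ²` along the inverse of the chart at `x₀`. -/
def OneForm.inChart (α : OneForm M) (x₀ : M) (y : Plane) : Plane →L[ℝ] ℂ :=
  α.val ((extChartAt (𝓡 2) x₀).symm y) ∘L
    mfderiv 𝓘(ℝ, Plane) (𝓡 2) (extChartAt (𝓡 2) x₀).symm y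

/-- The exterior derivative of a one-form at `x`, computed in the chart at `x`: if `A` is the
coordinate expression of `α`, then `dα(u, v) = (∂_u A) v - (∂_v A) u`. -/
def OneForm.extDer (α : OneForm M) (x : M) (u v : TangentSpace (𝓡 2) x) : ℂ :=
  let φ := extChartAt (𝓡 2) x
  let dφ : TangentSpace (𝓡 2) x →L[ℝ] Plane := mfderiv (𝓡 2) 𝓘(ℝ, Plane) φ x
  fderiv ℝ (α.inChart x) (φ x) (dφ u) (dφ v) - fderiv ℝ (α.inChart x) (φ x) (dφ v) (dφ u)

/-- The differential `df` of a smooth function. -/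
def diff (f : SmoothFun M) (x : M) : TangentSpace (𝓡 2) x →L[ℝ] ℂ :=
  mfderiv (𝓡 2) 𝓘(ℝ, ℂ) f x

theorem OneForm.inChart_differentiableAt (α : OneForm M) (x₀ : M) :
    DifferentiableAt ℝ (α.inChart x₀) (extChartAt (𝓡 2) x₀ x₀) := by
  have hα := (contMDiffAt_form_iff α.val x₀).1 (α.contMDiff x₀)
  have hs : ContMDiffAt 𝓘(ℝ, Plane) (𝓡 2) ∞ (extChartAt (𝓡 2) x₀).symm
      (extChartAt (𝓡 2) x₀ x₀) :=
    (contMDiffOn_extChartAt_symm x₀).contMDiffAt (extChartAt_target_mem_nhds x₀)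
  have h1 := ContMDiffAt.comp (extChartAt (𝓡 2) x₀ x₀)
    (by rw [extChartAt_to_inv]; exact hα) hs
  have h2 : ContDiffAt ℝ ∞ (α.inChart x₀) (extChartAt (𝓡 2) x₀ x₀) := by
    rw [← contMDiffAt_iff_contDiffAt]
    refine h1.congr_of_eventuallyEq ?_
    filter_upwards [extChartAt_target_mem_nhds (I := 𝓡 2) x₀] with y hy
    have hmem : (extChartAt (𝓡 2) x₀).symm y ∈ (chartAt Plane x₀).source := by
      rw [← extChartAt_source (𝓡 2)]
      exact (extChartAt (𝓡 2) x₀).map_target hy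
    simp only [Function.comp, OneForm.inChart]
    rw [TangentBundle.symmL_trivializationAt hmem, (extChartAt (𝓡 2) x₀).right_inv hy]
    simp
  exact h2.differentiableAt (by simp)

/-- `d(f α) = f dα + df ∧ α`. -/
theorem OneForm.extDer_mul (f : SmoothFun M) (α : OneForm M) (x : M)
    (u v : TangentSpace (𝓡 2) x) :
    (α.mul f).extDer x u v =
      f x * α.extDer x u v + (diff f x u * α.val x v - diff f x v * α.val x u) := by
  set φ := extChartAt (𝓡 2) x with hφ
  set dφ : TangentSpace (𝓡 2) x →L[ℝ] Plane := mfderiv (𝓡 2) 𝓘(ℝ, Plane) φ x with hdφ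
  have hs : MDifferentiableAt 𝓘(ℝ, Plane) (𝓡 2) φ.symm (φ x) :=
    ((contMDiffOn_extChartAt_symm (n := ∞) x).contMDiffAt
      (extChartAt_target_mem_nhds x)).mdifferentiableAt (by simp)
  have hx : φ.symm (φ x) = x := extChartAt_to_inv x
  have hinv : ∀ w : TangentSpace (𝓡 2) x, mfderiv 𝓘(ℝ, Plane) (𝓡 2) φ.symm (φ x) (dφ w) = w := by
    intro w
    have := mfderivWithin_extChartAt_symm_comp_mfderiv_extChartAt' (I := 𝓡 2)
      (mem_extChartAt_source (I := 𝓡 2) x)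
    rw [ModelWithCorners.range_eq_univ, mfderivWithin_univ] at this
    exact congrArg (fun L : Plane →L[ℝ] Plane ↦ L w) this
  have hf : MDifferentiableAt (𝓡 2) 𝓘(ℝ, ℂ) f x := (f.contMDiff x).mdifferentiableAt (by simp)
  have hc : MDifferentiableAt 𝓘(ℝ, Plane) 𝓘(ℝ, ℂ) (f ∘ φ.symm) (φ x) :=
    MDifferentiableAt.comp (φ x) (by rw [hx]; exact hf) hs
  have hc' := hc.differentiableAt
  have hprod : (α.mul f).inChart x = fun y ↦ (f ∘ φ.symm) y • α.inChart x y := by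
    funext y
    rfl
  have hd : ∀ w : TangentSpace (𝓡 2) x, fderiv ℝ (f ∘ φ.symm) (φ x) (dφ w) = diff f x w := by
    intro w
    have h1 : HasMFDerivAt (𝓡 2) 𝓘(ℝ, ℂ) f (φ.symm (φ x)) (diff f x : Plane →L[ℝ] ℂ) := by
      rw [hx]
      exact hf.hasMFDerivAt
    have h2 := HasMFDerivAt.comp (φ x) h1 hs.hasMFDerivAt
    have h3 : HasFDerivAt (𝕜 := ℝ) (f ∘ φ.symm) (((diff f x : Plane →L[ℝ] ℂ) ∘L
        (mfderiv 𝓘(ℝ, Plane) (𝓡 2) φ.symm (φ x) : Plane →L[ℝ] Plane) : Plane →L[ℝ] ℂ))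
        (φ x) := hasMFDerivAt_iff_hasFDerivAt.1 h2
    exact (congrArg (fun L : Plane →L[ℝ] ℂ ↦ L (dφ w)) h3.fderiv).trans
      (congrArg (diff f x : Plane →L[ℝ] ℂ) (hinv w))
  have hv : ∀ w : TangentSpace (𝓡 2) x, α.inChart x (φ x) (dφ w) = α.val x w := by
    intro w
    have h1 : ∀ z, z = x → (α.val z : Plane →L[ℝ] ℂ) w = (α.val x : Plane →L[ℝ] ℂ) w := by
      rintro _ rfl
      rfl
    have h2 : α.inChart x (φ x) (dφ w) = (α.val (φ.symm (φ x)) : Plane →L[ℝ] ℂ) w :=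
      congrArg (α.val (φ.symm (φ x)) : Plane →L[ℝ] ℂ) (hinv w)
    rw [h2, h1 _ hx]
  have hF : fderiv ℝ ((α.mul f).inChart x) (φ x) =
      (f ∘ φ.symm) (φ x) • fderiv ℝ (α.inChart x) (φ x) +
      (fderiv ℝ (f ∘ φ.symm) (φ x)).smulRight (α.inChart x (φ x)) := by
    rw [hprod]
    exact fderiv_fun_smul hc' (α.inChart_differentiableAt x)
  simp only [OneForm.extDer]
  rw [← hφ, ← hdφ, hF]
  have hfx : (f ∘ φ.symm) (φ x) = f x := congrArg f hx
  have hcomp : ∀ a b : TangentSpace (𝓡 2) x,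
      ((f ∘ φ.symm) (φ x) • fderiv ℝ (α.inChart x) (φ x) +
        (fderiv ℝ (f ∘ φ.symm) (φ x)).smulRight (α.inChart x (φ x)) :
          Plane →L[ℝ] Plane →L[ℝ] ℂ) (dφ a) (dφ b) =
      f x * fderiv ℝ (α.inChart x) (φ x) (dφ a) (dφ b) + diff f x a * α.val x b := by
    intro a b
    rw [← hd a, ← hv b, ← hfx]
    rfl
  erw [hcomp u v, hcomp v u]
  ring


theorem OneForm.add_val (α β : OneForm M) (x : M) : (α + β).val x = α.val x + β.val x := rfl

/-! ### Connections, flatness, gauge action -/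

section
variable (M)

/-- A connection on the trivial complex line bundle `E = M × ℂ`: an additive operator from
sections of `E` to `E`-valued one-forms with `D(f s) = f D(s) + df ⊗ s`. -/
@[ext]
structure Connection where
  toFun : SmoothFun M → OneForm M
  map_add : ∀ s t, toFun (s + t) = toFun s + toFun t
  leibniz : ∀ (f s : SmoothFun M) (x : M) (v : TangentSpace (𝓡 2) x),
    (toFun (f * s)).val x v = f x * (toFun s).val x v + diff f x v * s x

end

namespace Connection

/-- The connection form `η` of `D`, that is, `D τ₀ = η τ₀`, so `D = d + η`. -/
def form (D : Connection M) : OneForm M := D.toFun 1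

/-- The extension of `D` to `E`-valued one-forms determined by the Leibniz rule
`D(α ⊗ τ₀) = dα ⊗ τ₀ - α ∧ D τ₀`, that is, `D α = dα + η ∧ α`. -/
def covDer (D : Connection M) (α : OneForm M) (x : M) (u v : TangentSpace (𝓡 2) x) : ℂ :=
  α.extDer x u v + (D.form.val x u * α.val x v - D.form.val x v * α.val x u)

/-- `D` is flat: its curvature `D ∘ D` vanishes. -/
def IsFlat (D : Connection M) : Prop :=
  ∀ (s : SmoothFun M) (x : M) (u v : TangentSpace (𝓡 2) x), D.covDer (D.toFun s) x u v = 0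

end Connection

/-- A gauge transformation as a complex-valued function. -/
def Gauge.toSmooth (g : Gauge M) : SmoothFun M :=
  ⟨fun x ↦ (g x : ℂ), Units.contMDiff_val.comp g.contMDiff⟩

@[simp] theorem Gauge.toSmooth_apply (g : Gauge M) (x : M) : g.toSmooth x = (g x : ℂ) := rfl

theorem Gauge.toSmooth_one : (1 : Gauge M).toSmooth = 1 := by
  ext x; rfl

theorem Gauge.toSmooth_mul (g h : Gauge M) : (g * h).toSmooth = g.toSmooth * h.toSmooth := by
  ext x; rfl

theorem Gauge.inv_apply (g : Gauge M) (x : M) : ((g⁻¹ : Gauge M) x : ℂ) = (g x : ℂ)⁻¹ := by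
  rw [← Units.val_inv_eq_inv_val]; rfl

/-- The action of gauge transformations on connections, `(g • D)(s) = g⁻¹ D(g s)`. In terms of
connection forms this is `η ↦ η + g⁻¹ dg`, see `Connection.smul_form`. -/
instance : MulAction (Gauge M) (Connection M) where
  smul g D :=
    { toFun := fun s ↦ (D.toFun (g.toSmooth * s)).mul (g⁻¹ : Gauge M).toSmooth
      map_add := fun s t ↦ by
        apply OneForm.ext_val
        intro x v
        simp [mul_add, D.map_add, OneForm.add_val]
      leibniz := fun f s x v ↦ by
        have h : g.toSmooth * (f * s) = f * (g.toSmooth * s) := by ring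
        have hg : (g x : ℂ) ≠ 0 := (g x).ne_zero
        simp only [h, OneForm.mul_val, _root_.smul_apply, D.leibniz,
          Gauge.toSmooth_apply, Gauge.inv_apply, smul_eq_mul, ContMDiffMap.coe_mul, Pi.mul_apply]
        field_simp }
  one_smul D := by
    apply Connection.ext
    funext s
    apply OneForm.ext_val
    intro x v
    change ((1 : Gauge M)⁻¹.toSmooth x) * (D.toFun ((1 : Gauge M).toSmooth * s)).val x v = _
    rw [inv_one, Gauge.toSmooth_one, one_mul]
    exact one_mul _
  mul_smul g h D := by
    apply Connection.ext
    funext s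
    apply OneForm.ext_val
    intro x v
    change (((g * h)⁻¹ : Gauge M).toSmooth x) * (D.toFun ((g * h).toSmooth * s)).val x v =
      (g⁻¹ : Gauge M).toSmooth x * ((h⁻¹ : Gauge M).toSmooth x *
        (D.toFun (h.toSmooth * (g.toSmooth * s))).val x v)
    rw [Gauge.toSmooth_mul, mul_comm g.toSmooth, mul_assoc, mul_inv, Gauge.toSmooth_mul]
    exact mul_assoc _ _ _

namespace Connection

theorem smul_apply (g : Gauge M) (D : Connection M) (s : SmoothFun M) (x : M)
    (v : TangentSpace (𝓡 2) x) :
    ((g • D).toFun s).val x v = (g x : ℂ)⁻¹ * (D.toFun (g.toSmooth * s)).val x v := by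
  rw [← Gauge.inv_apply]; rfl

theorem smul_form (g : Gauge M) (D : Connection M) (x : M) (v : TangentSpace (𝓡 2) x) :
    (g • D).form.val x v = D.form.val x v + (g x : ℂ)⁻¹ * diff g.toSmooth x v := by
  have hg : (g x : ℂ) ≠ 0 := (g x).ne_zero
  rw [form, smul_apply, D.leibniz]
  simp only [Gauge.toSmooth_apply, form]
  have : (1 : SmoothFun M) x = 1 := rfl
  rw [this]
  field_simp

theorem IsFlat.smul {D : Connection M} (hD : D.IsFlat) (g : Gauge M) : (g • D).IsFlat := by
  intro s x u v
  have hg : (g x : ℂ) ≠ 0 := (g x).ne_zero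
  set β := D.toFun (g.toSmooth * s)
  set α := (g • D).toFun s
  have hβ : β = α.mul g.toSmooth := by
    apply OneForm.ext_val
    intro x v
    have hg : (g x : ℂ) ≠ 0 := (g x).ne_zero
    change _ = (g x : ℂ) * α.val x v
    rw [smul_apply]
    field_simp
    rfl
  have h := hD (g.toSmooth * s) x u v
  change D.covDer β x u v = 0 at h
  rw [hβ, covDer, OneForm.extDer_mul] at h
  have hv : ∀ w, (α.mul g.toSmooth).val x w = (g x : ℂ) * α.val x w := fun w ↦ rfl
  rw [hv, hv, Gauge.toSmooth_apply] at h
  rw [covDer, smul_form, smul_form]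
  have h' : (g x : ℂ) * (α.extDer x u v +
      ((D.form.val x u + (g x : ℂ)⁻¹ * diff g.toSmooth x u) * α.val x v -
      (D.form.val x v + (g x : ℂ)⁻¹ * diff g.toSmooth x v) * α.val x u)) = 0 := by
    rw [← h]
    field_simp
    ring
  exact (mul_eq_zero.1 h').resolve_left hg

end Connection

/-! ### Parallel transport and holonomy -/

/-- The velocity vector of a path at time `t`. -/
def velocity {a b : M} (γ : Path a b) (t : ℝ) : TangentSpace (𝓡 2) (γ.extend t) :=
  mfderivWithin 𝓘(ℝ, ℝ) (𝓡 2) γ.extend (Set.Icc 0 1) t (1 : ℝ)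

/-- The path `γ : [0, 1] → M` is smooth. -/
def IsSmoothPath {a b : M} (γ : Path a b) : Prop :=
  ContMDiffOn 𝓘(ℝ, ℝ) (𝓡 2) ∞ γ.extend (Set.Icc 0 1)

namespace Connection

/-- The section `f(t) τ₀(γ(t))` of `E` along `γ` is parallel: `f' + η(γ') f = 0` on `[0, 1]`. -/
def IsParallel (D : Connection M) {a b : M} (γ : Path a b) (f : ℝ → ℂ) : Prop :=
  ∀ t ∈ Set.Icc (0 : ℝ) 1,
    HasDerivWithinAt f (-(D.form.val (γ.extend t) (velocity γ t) * f t)) (Set.Icc 0 1) t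

/-- `ρ` is the holonomy representation of `D` based at `x₀`: parallel transport along every smooth
loop `γ` at `x₀` is multiplication by `ρ([γ])`. -/
def IsHolonomy (D : Connection M) {x₀ : M} {G : Subgroup ℂˣ} (ρ : FundamentalGroup M x₀ →* G) :
    Prop :=
  ∀ γ : Path x₀ x₀, IsSmoothPath γ → ∀ f : ℝ → ℂ, D.IsParallel γ f →
    f 1 = ((ρ (FundamentalGroup.fromPath (Path.Homotopic.Quotient.mk γ)) : ℂˣ) : ℂ) * f 0

theorem IsHolonomy.smul {D : Connection M} {x₀ : M} {G : Subgroup ℂˣ}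
    {ρ : FundamentalGroup M x₀ →* G} (h : D.IsHolonomy ρ) (g : Gauge M) :
    (g • D).IsHolonomy ρ := by
  intro γ hγ f hf
  have key := h γ hγ (fun t ↦ g.toSmooth (γ.extend t) * f t) (fun t ht ↦ by
    have h1 : MDifferentiableWithinAt 𝓘(ℝ, ℝ) (𝓡 2) γ.extend (Set.Icc 0 1) t :=
      (hγ t ht).mdifferentiableWithinAt (by simp)
    have h2 : MDifferentiableAt (𝓡 2) 𝓘(ℝ, ℂ) g.toSmooth (γ.extend t) :=
      (g.toSmooth.contMDiff _).mdifferentiableAt (by simp)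
    have h3 := h2.hasMFDerivAt.comp_hasMFDerivWithinAt t h1.hasMFDerivWithinAt
    have h4 : HasFDerivWithinAt (𝕜 := ℝ) (g.toSmooth ∘ γ.extend)
        ((diff g.toSmooth (γ.extend t) : Plane →L[ℝ] ℂ) ∘L
          (mfderivWithin 𝓘(ℝ, ℝ) (𝓡 2) γ.extend (Set.Icc 0 1) t : ℝ →L[ℝ] Plane))
        (Set.Icc 0 1) t := hasMFDerivWithinAt_iff_hasFDerivWithinAt.1 h3
    have h5 : HasDerivWithinAt (g.toSmooth ∘ γ.extend)
        (diff g.toSmooth (γ.extend t) (velocity γ t)) (Set.Icc 0 1) t := h4.hasDerivWithinAt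
    have h6 := h5.mul (hf t ht)
    refine h6.congr_deriv ?_
    have hg : (g (γ.extend t) : ℂ) ≠ 0 := (g _).ne_zero
    rw [smul_form]
    simp only [Function.comp, Gauge.toSmooth_apply]
    field_simp
    ring)
  have hg : (g x₀ : ℂ) ≠ 0 := (g x₀).ne_zero
  have key' : g.toSmooth (γ.extend 1) * f 1 = ((ρ (FundamentalGroup.fromPath
      (Path.Homotopic.Quotient.mk γ)) : ℂˣ) : ℂ) * (g.toSmooth (γ.extend 0) * f 0) := key
  rw [Path.extend_one, Path.extend_zero, Gauge.toSmooth_apply] at key'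
  apply mul_left_cancel₀ hg
  rw [key']
  ring

theorem isHolonomy_smul_iff {D : Connection M} {x₀ : M} {G : Subgroup ℂˣ}
    {ρ : FundamentalGroup M x₀ →* G} (g : Gauge M) :
    (g • D).IsHolonomy ρ ↔ D.IsHolonomy ρ :=
  ⟨fun h ↦ by simpa using h.smul g⁻¹, fun h ↦ h.smul g⟩

open Classical in
/-- The holonomy representation of `D` with values in `G` (with the value `1` if there is no
homomorphism to `G` describing the parallel transport of `D`). -/
def holonomy (D : Connection M) (x₀ : M) (G : Subgroup ℂˣ) : FundamentalGroup M x₀ →* G :=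
  if h : ∃ ρ : FundamentalGroup M x₀ →* G, D.IsHolonomy ρ then h.choose else 1

theorem holonomy_smul (D : Connection M) (x₀ : M) (G : Subgroup ℂˣ) (g : Gauge M) :
    (g • D).holonomy x₀ G = D.holonomy x₀ G := by
  have h : (fun ρ : FundamentalGroup M x₀ →* G ↦ (g • D).IsHolonomy ρ) =
      fun ρ ↦ D.IsHolonomy ρ := funext fun ρ ↦ propext (isHolonomy_smul_iff g)
  classical
  have key : ∀ P Q : (FundamentalGroup M x₀ →* G) → Prop, P = Q →
      (if h : ∃ ρ, P ρ then h.choose else 1) = (if h : ∃ ρ, Q ρ then h.choose else 1) := by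
    rintro P _ rfl
    rfl
  exact key _ _ h

end Connection


/-! ### Structure groups -/

/-- The complex conjugate of a smooth function. -/
def conjFun (s : SmoothFun M) : SmoothFun M :=
  ⟨fun x ↦ (starRingEnd ℂ) (s x), Complex.conjCLE.contDiff.contMDiff.comp s.contMDiff⟩

@[simp] theorem conjFun_apply (s : SmoothFun M) (x : M) :
    conjFun s x = (starRingEnd ℂ) (s x) := rfl

namespace Connection

/-- `D` is unitary for the standard Hermitian metric `⟨s, t⟩ = s t̄` on `E`:
`d⟨s, t⟩ = ⟨D s, t⟩ + ⟨s, D t⟩`. -/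
def IsUnitary (D : Connection M) : Prop :=
  ∀ (s t : SmoothFun M) (x : M) (v : TangentSpace (𝓡 2) x),
    diff (s * conjFun t) x v =
      (D.toFun s).val x v * (starRingEnd ℂ) (t x) + s x * (starRingEnd ℂ) ((D.toFun t).val x v)

/-- `D` commutes with the fibrewise antilinear map `σ(s) = u s̄` of `E`. If `|u| = 1` then `σ` is
an involution and its fixed set is a real line subbundle `L` of `E` with `E = L ⊗ ℂ`; every such
`L` arises in this way from a unique `u`. -/
def PreservesRealStructure (D : Connection M) (u : SmoothFun M) : Prop :=
  ∀ (s : SmoothFun M) (x : M) (v : TangentSpace (𝓡 2) x),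
    (D.toFun (u * conjFun s)).val x v = u x * (starRingEnd ℂ) ((D.toFun s).val x v)

end Connection

/-- The structure groups `ℂ^*`, `U(1)`, `ℝ^+` and `ℝ^*`. -/
inductive StructureGroup
  | complex
  | unitary
  | positive
  | real

namespace StructureGroup

/-- The structure group as a subgroup of `ℂˣ`. -/
def toSubgroup : StructureGroup → Subgroup ℂˣ
  | complex => ⊤
  | unitary =>
    { carrier := {z | ‖(z : ℂ)‖ = 1}
      mul_mem' := fun {a b} ha hb ↦ by
        simp only [Set.mem_ofPred_eq] at *
        simp [ha, hb]
      one_mem' := by simp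
      inv_mem' := fun {a} ha ↦ by
        simp only [Set.mem_ofPred_eq] at *
        simp [ha] }
  | positive =>
    { carrier := {z | ∃ r : ℝ, 0 < r ∧ (z : ℂ) = r}
      mul_mem' := by
        rintro a b ⟨r, hr, ha⟩ ⟨t, ht, hb⟩
        exact ⟨r * t, mul_pos hr ht, by simp [ha, hb]⟩
      one_mem' := ⟨1, one_pos, by simp⟩
      inv_mem' := by
        rintro a ⟨r, hr, ha⟩
        exact ⟨r⁻¹, inv_pos.2 hr, by simp [ha]⟩ }
  | real =>
    { carrier := {z | ∃ r : ℝ, (z : ℂ) = r}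
      mul_mem' := by
        rintro a b ⟨r, ha⟩ ⟨t, hb⟩
        exact ⟨r * t, by simp [ha, hb]⟩
      one_mem' := ⟨1, by simp⟩
      inv_mem' := by
        rintro a ⟨r, ha⟩
        exact ⟨r⁻¹, by simp [ha]⟩ }

/-- Evaluation of gauge transformations at a point. -/
def evalHom (x : M) : Gauge M →* ℂˣ where
  toFun g := g x
  map_one' := rfl
  map_mul' _ _ := rfl

/-- The gauge group: smooth maps `M → G` for `G = ℂ^*, U(1), ℝ^+`. For `G = ℝ^*` it consists of the
gauge transformations `g : M → ℂ^*` of `E` that preserve the real line `ℝ τ₀(x₀)` in the fibre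
over `x₀`, that is, `g x₀ ∈ ℝ^*`. -/
def gauge (𝔾 : StructureGroup) (x₀ : M) : Subgroup (Gauge M) :=
  match 𝔾 with
  | real => real.toSubgroup.comap (evalHom x₀)
  | 𝔾 => ⨅ x : M, 𝔾.toSubgroup.comap (evalHom x)

theorem eval_mem {𝔾 : StructureGroup} {x₀ : M} {g : Gauge M} (hg : g ∈ 𝔾.gauge x₀) :
    g x₀ ∈ 𝔾.toSubgroup := by
  cases 𝔾
  case real => exact hg
  all_goals exact (Subgroup.mem_iInf.1 hg x₀)

/-- Connections with structure group `G`: all connections for `ℂ^*`; the unitary ones for `U(1)`;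
those preserving the trivial real line subbundle `M × ℝ` for `ℝ^+`; those preserving some, possibly
nontrivial, real line subbundle `L` of `E` with `L_{x₀} = ℝ τ₀(x₀)` for `ℝ^*`. -/
def IsCompatible (𝔾 : StructureGroup) (x₀ : M) (D : Connection M) : Prop :=
  match 𝔾 with
  | complex => True
  | unitary => D.IsUnitary
  | positive => D.PreservesRealStructure 1
  | real => ∃ u : SmoothFun M, (∀ x, ‖u x‖ = 1) ∧ u x₀ = 1 ∧ D.PreservesRealStructure u

theorem IsCompatible.smul {𝔾 : StructureGroup} {x₀ : M} {D : Connection M}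
    (hD : 𝔾.IsCompatible x₀ D) {g : Gauge M} (hg : g ∈ 𝔾.gauge x₀) :
    𝔾.IsCompatible x₀ (g • D) := by
  have h0 : ∀ x, (g x : ℂ) ≠ 0 := fun x ↦ (g x).ne_zero
  have h0' : ∀ x, (starRingEnd ℂ) (g x : ℂ) ≠ 0 := fun x ↦ by simp
  cases 𝔾 with
  | complex => trivial
  | unitary =>
    intro s t x v
    have hn : ∀ x, (g x : ℂ) * (starRingEnd ℂ) (g x : ℂ) = 1 := fun x ↦ by
      have : ‖(g x : ℂ)‖ = 1 := Subgroup.mem_iInf.1 hg x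
      rw [Complex.mul_conj, Complex.normSq_eq_norm_sq, this]
      simp
    have h := hD (g.toSmooth * s) (g.toSmooth * t) x v
    have hst : g.toSmooth * s * conjFun (g.toSmooth * t) = s * conjFun t := by
      ext y
      change (g y : ℂ) * s y * (starRingEnd ℂ) ((g y : ℂ) * t y) = s y * (starRingEnd ℂ) (t y)
      rw [map_mul]
      linear_combination (s y * (starRingEnd ℂ) (t y)) * hn y
    rw [hst] at h
    rw [h, Connection.smul_apply, Connection.smul_apply]
    change _ * (starRingEnd ℂ) ((g x : ℂ) * t x) + (g x : ℂ) * s x * _ = _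
    have hi : (starRingEnd ℂ) (g x : ℂ) = (g x : ℂ)⁻¹ := by
      exact eq_inv_of_mul_eq_one_right (hn x)
    rw [map_mul, map_mul, map_inv₀, hi, inv_inv]
    ring
  | positive =>
    intro s x v
    have hr : ∀ x, (starRingEnd ℂ) (g x : ℂ) = g x := fun x ↦ by
      obtain ⟨r, -, h⟩ : ∃ r : ℝ, 0 < r ∧ (g x : ℂ) = r := Subgroup.mem_iInf.1 hg x
      rw [h, Complex.conj_ofReal]
    have h := hD (g.toSmooth * s) x v
    have hst : 1 * conjFun (g.toSmooth * s) = g.toSmooth * (1 * conjFun s) := by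
      rw [one_mul, one_mul]
      ext y
      change (starRingEnd ℂ) ((g y : ℂ) * s y) = (g y : ℂ) * (starRingEnd ℂ) (s y)
      rw [map_mul, hr]
    rw [hst] at h
    rw [Connection.smul_apply, Connection.smul_apply, h, map_mul, map_inv₀, hr]
    ring
  | real =>
    obtain ⟨u, hu, hu₀, h⟩ := hD
    refine ⟨(g⁻¹ : Gauge M).toSmooth * conjFun g.toSmooth * u, fun x ↦ ?_, ?_, ?_⟩
    · change ‖((g⁻¹ : Gauge M) x : ℂ) * (starRingEnd ℂ) (g x : ℂ) * u x‖ = 1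
      rw [Gauge.inv_apply, norm_mul, norm_mul, hu, norm_inv, RCLike.norm_conj, mul_one]
      exact inv_mul_cancel₀ (norm_ne_zero_iff.2 (h0 x))
    · change ((g⁻¹ : Gauge M) x₀ : ℂ) * (starRingEnd ℂ) (g x₀ : ℂ) * u x₀ = 1
      obtain ⟨r, hr⟩ : ∃ r : ℝ, (g x₀ : ℂ) = r := hg
      rw [Gauge.inv_apply, hu₀, mul_one]
      have := h0 x₀
      rw [hr] at this ⊢
      rw [Complex.conj_ofReal]
      exact inv_mul_cancel₀ this
    · intro s x v
      have h' := h (g.toSmooth * s) x v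
      have hst : u * conjFun (g.toSmooth * s) =
          g.toSmooth * ((g⁻¹ : Gauge M).toSmooth * conjFun g.toSmooth * u * conjFun s) := by
        ext y
        change u y * (starRingEnd ℂ) ((g y : ℂ) * s y) = (g y : ℂ) *
          (((g⁻¹ : Gauge M) y : ℂ) * (starRingEnd ℂ) (g y : ℂ) * u y * (starRingEnd ℂ) (s y))
        have := h0 y
        rw [Gauge.inv_apply, map_mul]
        field_simp
      rw [hst] at h'
      rw [Connection.smul_apply, Connection.smul_apply, h']
      change _ = ((g⁻¹ : Gauge M) x : ℂ) * (starRingEnd ℂ) (g x : ℂ) * u x * _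
      have := h0' x
      rw [Gauge.inv_apply, map_mul, map_inv₀]
      field_simp

end StructureGroup

section
variable (M)

/-! ### The groupoids and the holonomy functor -/

/-- Flat connections on `E` with structure group `𝔾`. -/
def FlatConnection (x₀ : M) (𝔾 : StructureGroup) : Type _ :=
  {D : Connection M // D.IsFlat ∧ 𝔾.IsCompatible x₀ D}

end

instance (x₀ : M) (𝔾 : StructureGroup) : MulAction (𝔾.gauge x₀) (FlatConnection M x₀ 𝔾) where
  smul g D := ⟨(g : Gauge M) • D.1, D.2.1.smul g, D.2.2.smul g.2⟩
  one_smul D := Subtype.ext (one_smul (Gauge M) D.1)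
  mul_smul g h D := Subtype.ext (mul_smul (g : Gauge M) (h : Gauge M) D.1)

/-- The set `Hom(P, G)`, on which `G` acts by conjugation. -/
def BettiObj (P G : Type*) [Group P] [Group G] : Type _ := P →* G

instance (P G : Type*) [Group P] [Group G] : MulAction G (BettiObj P G) where
  smul g ρ := (MulAut.conj g).toMonoidHom.comp ρ
  one_smul ρ := MonoidHom.ext fun c ↦ by
    let σ : P →* G := ρ
    change (1 : G) * σ c * 1⁻¹ = σ c
    simp
  mul_smul g h ρ := MonoidHom.ext fun c ↦ by
    let σ : P →* G := ρ
    change (g * h) * σ c * (g * h)⁻¹ = g * (h * σ c * h⁻¹) * g⁻¹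
    group

section
variable (M)

/-- The de Rham groupoid: the transformation groupoid of the gauge group acting on the flat
connections. A morphism `D₁ ⟶ D₂` is a gauge transformation `g` with `g • D₁ = D₂`. -/
abbrev DeRhamGroupoid (x₀ : M) (𝔾 : StructureGroup) :=
  ActionCategory (𝔾.gauge x₀) (FlatConnection M x₀ 𝔾)

/-- The Betti groupoid `(Hom(P, G), G)`: the transformation groupoid of the conjugation action. -/
abbrev BettiGroupoid (P G : Type*) [Group P] [Group G] := ActionCategory G (BettiObj P G)

/-- The holonomy functor: a flat connection goes to its holonomy representation, a gauge
transformation to its value at the base point. -/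
def holonomyFunctor (x₀ : M) (𝔾 : StructureGroup) :
    DeRhamGroupoid M x₀ 𝔾 ⥤ BettiGroupoid (FundamentalGroup M x₀) 𝔾.toSubgroup where
  obj D := ActionCategory.objEquiv 𝔾.toSubgroup (BettiObj (FundamentalGroup M x₀) 𝔾.toSubgroup)
    (D.back.1.holonomy x₀ 𝔾.toSubgroup)
  map {D₁ D₂} ξ := ⟨⟨ξ.val.1 x₀, StructureGroup.eval_mem ξ.val.2⟩, by
    have h : (ξ.val.1 : Gauge M) • D₁.back.1 = D₂.back.1 := congrArg Subtype.val ξ.2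
    change MonoidHom.comp _ _ = Connection.holonomy D₂.back.1 x₀ 𝔾.toSubgroup
    rw [← h, Connection.holonomy_smul]
    refine MonoidHom.ext fun c ↦ ?_
    exact mul_inv_cancel_comm _ _⟩
  map_id D := rfl
  map_comp ξ ζ := rfl

/-- The smooth surface `M` is orientable: it has a smooth atlas all of whose coordinate changes have
positive Jacobian determinant. -/
def IsOrientable : Prop :=
  ∃ A ⊆ IsManifold.maximalAtlas (𝓡 2) ∞ M, (∀ x, ∃ e ∈ A, x ∈ e.source) ∧
    ∀ e ∈ A, ∀ e' ∈ A, ∀ y ∈ (e.symm.trans e').source,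
      0 < (fderiv ℝ (e.symm.trans e') y).det
end
end FlatLine
end

set_option linter.unusedSectionVars false

/-! Write `D = d + η`. Since `η ∧ η = 0` for a line bundle, `D` is flat exactly when `η` is closed
(`Connection.isFlat_iff`). A closed form has local primitives, and their exponentials are local
frames with locally constant ratios. Giving the fibre `ℂ` the discrete topology turns such a system
of frames into a covering space, whose monodromy is a multiplicative function of homotopy classes of
paths (`IsFlatFrame.monodromy`). Along a smooth path it is the end value of a solution of `Φ' =
η(γ') Φ`, and every class has a smooth representative (`exists_isFlatEnded`), so the inverse of the
monodromy around loops is the one and only holonomy (`Connection.isHolonomy_iff`). Its values lie in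
`G` because the condition on `D` restricts `η`: it is imaginary for `U(1)`, real for `ℝ^+`, and
satisfies `du + u η = u η̄` for `ℝ^*`.

The functor is faithful because a gauge transformation that fixes `D` has `g⁻¹ dg = 0`, so is
determined by its value at `x₀`. It is full because, for connections with equal holonomy, `η₂ - η₁`
has trivial transport around loops; transport from `x₀` to `x` is then a well-defined function `f`
with `df = f (η₂ - η₁)`, and a constant multiple of `f` is the gauge transformation sought
(`Connection.exists_gauge`).

Essential surjectivity is where closedness and orientability of the surface enter. A representation
gives a flat line bundle with transition functions in `G`. A nowhere vanishing smooth section `s` of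
it identifies it with the trivial bundle and gives the connection `d - d log s` with the prescribed
holonomy; dividing `s` by `|s|`, replacing it by `|s|`, or rescaling it makes the connection
compatible with `G` (`exists_compatible_section`).

The section comes from a direct proof that a flat bundle has degree zero (`exists_isSectionAt`). By
Sard and Baire a generic combination of cut-off local flat sections has only nondegenerate zeros.
Functions with divisor `[p] ± [q]` exist for neighbouring `p`, `q`; chaining them collects all zeros
at a single point `q`, near which the section becomes `ζ ^ N`. Its logarithmic derivative is closed
away from `q` because the bundle is flat, and equals `N dζ / ζ` near `q`, so Stokes' theorem on the
oriented surface forces `N = 0`, and the last zero can be removed. -/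

noncomputable section
namespace FlatLine

/-! ### Flat frames and their monodromy -/

/-- A flat line bundle over `X` given by local frames: each fibre is identified with `ℂ` (without any
continuity), and `e b` is a flat frame near `b`, so that `e b / e x` is constant near `x` for each
`x` near `b`. -/
structure IsFlatFrame {X : Type*} [TopologicalSpace X] (e : X → X → ℂ) : Prop where
  ne_zero : ∀ b x, e b x ≠ 0
  locally_const : ∀ b, ∀ᶠ x in 𝓝 b, ∀ᶠ y in 𝓝 x, e b y * e x x = e b x * e x y

/-- The complex numbers with the discrete topology. -/
def DiscreteComplex : Type := ℂ

instance : TopologicalSpace DiscreteComplex := ⊥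

instance : DiscreteTopology DiscreteComplex := ⟨rfl⟩

namespace IsFlatFrame

section
variable {X : Type*} [TopologicalSpace X] {e : X → X → ℂ}

/-- The points near which `e b` is a flat frame. -/
def domain (e : X → X → ℂ) (b : X) : Set X :=
  {x | ∀ᶠ x' in 𝓝 x, ∀ᶠ y in 𝓝 x', e b y * e x' x' = e b x' * e x' y}

theorem isOpen_domain (e : X → X → ℂ) (b : X) : IsOpen (domain e b) :=
  isOpen_setOfPred_eventually_nhds

theorem mem_domain (he : IsFlatFrame e) (b : X) : b ∈ domain e b := he.locally_const b

theorem domain_mem_nhds (he : IsFlatFrame e) (b : X) : domain e b ∈ 𝓝 b :=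
  (isOpen_domain e b).mem_nhds (he.mem_domain b)

theorem eventually_of_mem_domain {b x : X} (hx : x ∈ domain e b) :
    ∀ᶠ y in 𝓝 x, e b y * e x x = e b x * e x y := Filter.Eventually.self_of_nhds (p := fun x' ↦ ∀ᶠ y in 𝓝 x', e b y * e x' x' = e b x' * e x' y) hx

/-- Both frames are locally proportional to `e x`. This local constancy of the transition functions
is what permits a discrete fibre. -/
theorem div_eventually_const (he : IsFlatFrame e) {i j x : X} (hi : x ∈ domain e i)
    (hj : x ∈ domain e j) : ∀ᶠ y in 𝓝 x, e i y / e j y = e i x / e j x := by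
  filter_upwards [eventually_of_mem_domain hi, eventually_of_mem_domain hj] with y h1 h2
  have := he.ne_zero
  rw [div_eq_div_iff (this _ _) (this _ _)]
  have h3 := this x x
  apply mul_right_cancel₀ h3
  apply mul_right_cancel₀ (this x y)
  linear_combination e j x * e x y * h1 - e i x * e x y * h2

/-- The covering of `X` by the flat sections of the bundle. -/
def core (he : IsFlatFrame e) : FiberBundleCore X X DiscreteComplex where
  baseSet b := domain e b
  isOpen_baseSet b := isOpen_domain e b
  indexAt b := b
  mem_baseSet_at b := he.mem_domain b
  coordChange i j x v := show ℂ from (show ℂ from v) * (e i x / e j x)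
  coordChange_self i x hx v := by
    change (show ℂ from v) * (e i x / e i x) = v
    rw [div_self (he.ne_zero _ _), mul_one]
  continuousOn_coordChange i j := by
    rintro ⟨x, v⟩ ⟨⟨hi, hj⟩, -⟩
    refine ContinuousAt.continuousWithinAt ?_
    -- Near `(x, v)` the second component is frozen at `v`, the fibre being discrete, so only the
    -- base point varies and the coordinate change is locally constant.
    refine (continuousAt_const (y := (show DiscreteComplex from
      (show ℂ from (show ℂ from v) * (e i x / e j x))))).congr ?_
    rw [nhds_prod_eq, nhds_discrete DiscreteComplex]
    rw [Filter.prod_pure]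
    refine Filter.eventually_map.2 ?_
    filter_upwards [he.div_eventually_const hi hj] with y hy
    change (show ℂ from v) * (e i x / e j x) = (show ℂ from v) * (e i y / e j y)
    rw [hy]
  coordChange_comp i j k x hx v := by
    change (show ℂ from v) * (e i x / e j x) * (e j x / e k x) = (show ℂ from v) * (e i x / e k x)
    have := he.ne_zero
    have h1 := this j x
    have h2 := this k x
    field_simp

theorem isCoveringMap (he : IsFlatFrame e) : IsCoveringMap he.core.proj :=
  IsCoveringMap.mk _ (fun _ ↦ DiscreteComplex) (fun b ↦ he.core.localTriv b)
    fun b ↦ he.mem_domain b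

/-- `Φ` is the coefficient function of a flat section along `γ` (with respect to the inverse
frames). -/
def IsTransport (e : X → X → ℂ) {x y : X} (γ : Path x y) (Φ : ℝ → ℂ) : Prop :=
  ∀ t ∈ Set.Icc (0 : ℝ) 1, ∀ᶠ t' in 𝓝[Set.Icc 0 1] t,
    Φ t' * e (γ.extend t) (γ.extend t) = Φ t * e (γ.extend t) (γ.extend t')

theorem _root_.FlatLine.eq_of_locally_const_Icc {Y : Type*} {f : ℝ → Y}
    (h : ∀ t ∈ Set.Icc (0 : ℝ) 1, ∀ᶠ t' in 𝓝[Set.Icc 0 1] t, f t' = f t) {t : ℝ}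
    (ht : t ∈ Set.Icc (0 : ℝ) 1) : f t = f 0 := by
  let : TopologicalSpace Y := ⊥
  have : DiscreteTopology Y := ⟨rfl⟩
  have hc : ContinuousOn f (Set.Icc 0 1) := fun t ht ↦
    (continuousWithinAt_const (b := f t)).congr_of_eventuallyEq (h t ht) rfl
  have := isPreconnected_Icc.constant_of_mapsTo (T := Set.univ) ⟨inferInstance⟩ hc
    (Set.mapsTo_univ _ _) ht ⟨le_rfl, zero_le_one⟩
  exact this

/-- Uniqueness of transport up to a scalar: both functions are locally proportional to the same
frame, so their quotient is locally constant on the connected interval. -/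
theorem IsTransport.div_const (he : IsFlatFrame e) {x y : X} {γ : Path x y} {Φ Ψ : ℝ → ℂ}
    (hΦ : IsTransport e γ Φ) (hΨ : IsTransport e γ Ψ) (h0 : Ψ 0 ≠ 0) {t : ℝ}
    (ht : t ∈ Set.Icc (0 : ℝ) 1) : Ψ t ≠ 0 ∧ Φ t / Ψ t = Φ 0 / Ψ 0 := by
  have hne : ∀ t ∈ Set.Icc (0 : ℝ) 1, Ψ t ≠ 0 := by
    intro t ht
    -- The truth value of `Ψ t = 0` is itself locally constant, so it keeps its value at `0`.
    have := eq_of_locally_const_Icc (f := fun t ↦ (Ψ t = 0 : Prop)) (fun t ht ↦ ?_) ht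
    · intro h
      exact h0 (cast this h)
    · filter_upwards [hΨ t ht] with t' h'
      have h1 := he.ne_zero (γ.extend t) (γ.extend t)
      have h2 := he.ne_zero (γ.extend t) (γ.extend t')
      apply propext
      constructor
      · intro h
        rw [h, zero_mul] at h'
        exact (mul_eq_zero.1 h'.symm).resolve_right h2
      · intro h
        rw [h, zero_mul] at h'
        exact (mul_eq_zero.1 h').resolve_right h1
  refine ⟨hne t ht, ?_⟩
  refine eq_of_locally_const_Icc (f := fun t ↦ Φ t / Ψ t) (fun t ht ↦ ?_) ht
  filter_upwards [hΦ t ht, hΨ t ht, self_mem_nhdsWithin] with t' h1 h2 h3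
  rw [div_eq_div_iff (hne _ h3) (hne _ ht)]
  have h4 := he.ne_zero (γ.extend t) (γ.extend t)
  have h5 := he.ne_zero (γ.extend t) (γ.extend t')
  apply mul_right_cancel₀ h4
  apply mul_right_cancel₀ h5
  linear_combination Ψ t * (e (γ.extend t) (γ.extend t')) * h1 - Φ t * (e (γ.extend t) (γ.extend t')) * h2

/-- The vector in the fibre over `x` of the covering with coordinate `v`. -/
def point (he : IsFlatFrame e) (x : X) (v : ℂ) : he.core.proj ⁻¹' {x} :=
  ⟨⟨x, (show DiscreteComplex from v)⟩, rfl⟩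

/-- The coordinate of a point of the covering. -/
def coordinate (he : IsFlatFrame e) (z : he.core.TotalSpace) : ℂ := show ℂ from z.2

/-- The fibre coordinate of a lift is taken in the frame of the moving base point; the factor `e (γ
t) (γ t)` undoes this, and division by `e x x` makes the start value the coordinate of the initial
point. -/
theorem isTransport_of_lift (he : IsFlatFrame e) {x y : X} (γ : Path x y)
    (Γ : C(unitInterval, he.core.TotalSpace)) (hΓ : he.core.proj ∘ Γ = γ) :
    IsTransport e γ (fun t ↦ he.coordinate (Γ (Set.projIcc 0 1 zero_le_one t)) *
      e (γ.extend t) (γ.extend t) / e x x) := by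
  intro t ht
  have hproj : ∀ s : ℝ, (Γ (Set.projIcc 0 1 zero_le_one s)).1 = γ.extend s := fun s ↦
    congrFun hΓ (Set.projIcc 0 1 zero_le_one s)
  set b := γ.extend t with hb
  have hsrc : Γ (Set.projIcc 0 1 zero_le_one t) ∈ (he.core.localTriv b).source := by
    rw [he.core.mem_localTriv_source]
    change (Γ (Set.projIcc 0 1 zero_le_one t)).1 ∈ domain e b
    rw [hproj]
    exact he.mem_domain b
  have hc : ContinuousAt (fun s : ℝ ↦ he.core.localTriv b (Γ (Set.projIcc 0 1 zero_le_one s))) t :=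
    ((he.core.localTriv b).continuousAt hsrc).comp
      (f := fun s : ℝ ↦ Γ (Set.projIcc 0 1 zero_le_one s))
      (Γ.continuous.comp continuous_projIcc).continuousAt
  -- A continuous function with discrete values is locally constant: the lift has constant
  -- coordinate in the flat trivialization at `b`.
  have hc2 : ∀ᶠ s in 𝓝 t, (he.core.localTriv b (Γ (Set.projIcc 0 1 zero_le_one s))).2 =
      (he.core.localTriv b (Γ (Set.projIcc 0 1 zero_le_one t))).2 := by
    have := hc.snd
    rw [ContinuousAt, nhds_discrete DiscreteComplex, Filter.tendsto_pure] at this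
    exact this
  have hval : ∀ s, (he.core.localTriv b (Γ (Set.projIcc 0 1 zero_le_one s))).2 =
      he.coordinate (Γ (Set.projIcc 0 1 zero_le_one s)) * (e (γ.extend s) (γ.extend s) /
        e b (γ.extend s)) := by
    intro s
    rw [← hproj s]
    rfl
  filter_upwards [nhdsWithin_le_nhds hc2] with s hs
  rw [hval, hval] at hs
  have h1 := he.ne_zero b b
  have h2 := he.ne_zero b (γ.extend s)
  have h3 := he.ne_zero x x
  have h4 : he.coordinate (Γ (Set.projIcc 0 1 zero_le_one s)) * (e (γ.extend s) (γ.extend s) /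
        e b (γ.extend s)) = he.coordinate (Γ (Set.projIcc 0 1 zero_le_one t)) := by
    refine hs.trans ?_
    rw [← hb, div_self h1, mul_one]
  rw [← h4]
  simp only [← hb]
  field_simp

/-- The monodromy of the flat line bundle. -/
def monodromy (he : IsFlatFrame e) {x y : X} (κ : Path.Homotopic.Quotient x y) : ℂ :=
  he.coordinate (he.isCoveringMap.monodromy κ (he.point x 1)) * e y y / e x x

/-- The covering monodromy is linear on fibres, because the transports starting at `z` and at `1`
are proportional. The second half reads the monodromy off a transport function along any
representative. -/
theorem coordinate_monodromy (he : IsFlatFrame e) {x y : X} (κ : Path.Homotopic.Quotient x y)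
    (z : he.core.proj ⁻¹' {x}) :
    he.coordinate (he.isCoveringMap.monodromy κ z) * e y y / e x x =
      he.coordinate z * he.monodromy κ ∧
    ∀ γ : Path x y, Path.Homotopic.Quotient.mk γ = κ → ∃ Φ : ℝ → ℂ, IsTransport e γ Φ ∧ Φ 0 = 1 ∧
      Φ 1 = he.monodromy κ := by
  have key : ∀ (γ : Path x y) (w : he.core.proj ⁻¹' {x}), ∃ Φ : ℝ → ℂ, IsTransport e γ Φ ∧
      Φ 0 = he.coordinate w ∧ Φ 1 = he.coordinate
        (he.isCoveringMap.monodromy (Path.Homotopic.Quotient.mk γ) w) * e y y / e x x := by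
    intro γ w
    have h0 : γ 0 = he.core.proj w.1 := γ.source.trans w.2.symm
    refine ⟨_, he.isTransport_of_lift γ (he.isCoveringMap.liftPath γ w h0)
      (he.isCoveringMap.liftPath_lifts γ w h0), ?_, ?_⟩
    · rw [Path.extend_zero, mul_div_assoc, div_self (he.ne_zero x x), mul_one]
      congr 1
      simp only [Set.projIcc_left]
      exact he.isCoveringMap.liftPath_zero γ w h0
    · rw [Path.extend_one, Set.projIcc_right]
      rfl
  have hne := he.ne_zero
  constructor
  · induction κ using Path.Homotopic.Quotient.ind with | mk γ =>
    obtain ⟨Φ, h1, h2, h3⟩ := key γ z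
    obtain ⟨Ψ, h4, h5, h6⟩ := key γ (he.point x 1)
    have h5' : Ψ 0 = 1 := h5
    have := h1.div_const he h4 (by rw [h5']; exact one_ne_zero) (t := 1) ⟨zero_le_one, le_rfl⟩
    have hm : he.monodromy (Path.Homotopic.Quotient.mk γ) = Ψ 1 := h6.symm
    rw [hm, ← h3, ← h2]
    rw [h5', div_one, div_eq_iff this.1] at this
    exact this.2
  · rintro γ rfl
    obtain ⟨Ψ, h4, h5, h6⟩ := key γ (he.point x 1)
    exact ⟨Ψ, h4, h5, h6⟩

theorem exists_isTransport (he : IsFlatFrame e) {x y : X} (γ : Path x y) :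
    ∃ Φ : ℝ → ℂ, IsTransport e γ Φ ∧ Φ 0 = 1 ∧
      Φ 1 = he.monodromy (Path.Homotopic.Quotient.mk γ) :=
  (he.coordinate_monodromy _ (he.point x 1)).2 γ rfl

theorem monodromy_trans (he : IsFlatFrame e) {x y z : X} (κ : Path.Homotopic.Quotient x y)
    (μ : Path.Homotopic.Quotient y z) :
    he.monodromy (κ.trans μ) = he.monodromy κ * he.monodromy μ := by
  have h1 := (he.coordinate_monodromy μ (he.isCoveringMap.monodromy κ (he.point x 1))).1
  rw [← he.isCoveringMap.monodromy_trans_apply] at h1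
  have h2 := he.ne_zero y y
  have h3 := he.ne_zero x x
  rw [div_eq_iff h2] at h1
  have h4 : he.monodromy κ =
      he.coordinate (he.isCoveringMap.monodromy κ (he.point x 1)) * e y y / e x x := rfl
  rw [h4, monodromy, h1]
  field_simp

/-- Inside its domain `e b` is itself a transport function along `γ`. -/
theorem monodromy_eq_of_range_subset (he : IsFlatFrame e) {b x y : X} (γ : Path x y)
    (hγ : Set.range γ ⊆ domain e b) :
    he.monodromy (Path.Homotopic.Quotient.mk γ) = e b y / e b x := by
  obtain ⟨Φ, h1, h2, h3⟩ := he.exists_isTransport γ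
  have hne := he.ne_zero
  have hmem : ∀ t, γ.extend t ∈ domain e b := fun t ↦ hγ (by
    exact ⟨_, rfl⟩)
  have h4 : IsTransport e γ (fun t ↦ e b (γ.extend t)) := by
    intro t ht
    have hc : Filter.Tendsto γ.extend (𝓝[Set.Icc 0 1] t) (𝓝 (γ.extend t)) :=
      γ.continuous_extend.continuousAt.tendsto.mono_left nhdsWithin_le_nhds
    exact hc.eventually (eventually_of_mem_domain (hmem t))
  have h5 := (h1.div_const he h4 (hne _ _) (t := 1) ⟨zero_le_one, le_rfl⟩).2
  rw [h2, h3, Path.extend_one, Path.extend_zero, div_eq_div_iff (hne _ _) (hne _ _)] at h5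
  rw [eq_div_iff (hne _ _), h5, one_mul]

theorem monodromy_ne_zero (he : IsFlatFrame e) {x y : X} (κ : Path.Homotopic.Quotient x y) :
    he.monodromy κ ≠ 0 := by
  induction κ using Path.Homotopic.Quotient.ind with | mk γ =>
  obtain ⟨Φ, h1, h2, h3⟩ := he.exists_isTransport γ
  rw [← h3]
  exact (h1.div_const he h1 (by rw [h2]; exact one_ne_zero) (t := 1) ⟨zero_le_one, le_rfl⟩).1

end
end IsFlatFrame

/-! ### Induction on homotopy classes of paths -/

/-- A property of homotopy classes of paths that holds for small paths and is preserved by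
composition holds for all classes. -/
theorem pathClass_induction {X : Type*} [TopologicalSpace X]
    {P : ∀ {x y : X}, Path.Homotopic.Quotient x y → Prop}
    (htrans : ∀ {x y z : X} (κ : Path.Homotopic.Quotient x y) (μ : Path.Homotopic.Quotient y z),
      P κ → P μ → P (κ.trans μ))
    (hsmall : ∀ b : X, ∃ U ∈ 𝓝 b, ∀ (x y : X) (γ : Path x y), Set.range γ ⊆ U →
      P (Path.Homotopic.Quotient.mk γ)) {x y : X} (κ : Path.Homotopic.Quotient x y) : P κ := by
  induction κ using Path.Homotopic.Quotient.ind with | mk γ =>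
  choose U hU hP using hsmall
  obtain ⟨t, t_0, t_mono, ⟨n, hn⟩, t_sub⟩ := exists_monotone_Icc_subset_open_cover_unitInterval
    (c := fun b : X ↦ γ ⁻¹' (interior (U b))) (fun b ↦ isOpen_interior.preimage γ.continuous)
    (fun s _ ↦ Set.mem_iUnion.2 ⟨γ s, mem_interior_iff_mem_nhds.2 (hU _)⟩)
  have step : ∀ m, P (Path.Homotopic.Quotient.mk (γ.subpath 0 (t m))) := by
    intro m
    induction m with
    | zero =>
      rw [t_0]
      refine hP (γ 0) _ _ _ ?_
      rw [Path.subpath_self]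
      rintro _ ⟨s, rfl⟩
      exact mem_of_mem_nhds (hU _)
    | succ m ih =>
      -- The path up to `t (m + 1)` is homotopic to the path up to `t m` followed by one piece of
      -- the Lebesgue subdivision, which lies in a single small set.
      rw [← Path.Homotopic.Quotient.eq.2 ⟨Path.Homotopy.subpathTransSubpath γ 0 (t m) (t (m+1))⟩,
        Path.Homotopic.Quotient.mk_trans]
      refine htrans _ _ ih ?_
      obtain ⟨b, hb⟩ := t_sub m
      refine hP b _ _ _ ?_
      rw [Path.range_subpath_of_le _ _ _ (t_mono m.le_succ)]
      rintro _ ⟨s, hs, rfl⟩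
      exact interior_subset (hb hs)
  have h1 := step n
  rw [hn n le_rfl] at h1
  have : ∀ {x' y' : X} (hx : x' = x) (hy : y' = y),
      P (Path.Homotopic.Quotient.mk (γ.cast hx hy)) → P (Path.Homotopic.Quotient.mk γ) := by
    rintro _ _ rfl rfl h
    exact h
  refine this γ.source γ.target ?_
  rwa [← Path.subpath_zero_one]

/-! ### Differential forms in charts -/

section
variable {M : Type*} [TopologicalSpace M] [ChartedSpace Plane M] [IsManifold (𝓡 2) ∞ M]

/-- The differential of a complex function, as a map on the model space. -/
def dfun (f : M → ℂ) (x : M) : Plane →L[ℝ] ℂ := mfderiv (𝓡 2) 𝓘(ℝ, ℂ) f x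

/-- The derivative of the inverse of a chart. -/
def dsymm (c : OpenPartialHomeomorph M Plane) (y : Plane) : Plane →L[ℝ] Plane :=
  mfderiv (𝓡 2) (𝓡 2) c.symm y

/-- The derivative of a chart. -/
def dchart (c : OpenPartialHomeomorph M Plane) (x : M) : Plane →L[ℝ] Plane :=
  mfderiv (𝓡 2) (𝓡 2) c x

/-- The coordinate expression of a one-form in a chart. -/
def coordForm (w : M → Plane →L[ℝ] ℂ) (c : OpenPartialHomeomorph M Plane) (y : Plane) :
    Plane →L[ℝ] ℂ :=
  w (c.symm y) ∘L dsymm c y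

variable {c c' : OpenPartialHomeomorph M Plane}

theorem hasMFDerivAt_symm (hc : c ∈ IsManifold.maximalAtlas (𝓡 2) ∞ M) {y : Plane}
    (hy : y ∈ c.target) : HasMFDerivAt (𝓡 2) (𝓡 2) c.symm y (dsymm c y) :=
  ((contMDiffAt_symm_of_mem_maximalAtlas hc hy).mdifferentiableAt (by simp)).hasMFDerivAt

theorem hasMFDerivAt_chart (hc : c ∈ IsManifold.maximalAtlas (𝓡 2) ∞ M) {x : M}
    (hx : x ∈ c.source) : HasMFDerivAt (𝓡 2) (𝓡 2) c x (dchart c x) :=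
  ((contMDiffAt_of_mem_maximalAtlas hc hx).mdifferentiableAt (by simp)).hasMFDerivAt

theorem dsymm_dchart (hc : c ∈ IsManifold.maximalAtlas (𝓡 2) ∞ M) {x : M} (hx : x ∈ c.source) :
    dsymm c (c x) ∘L dchart c x = ContinuousLinearMap.id ℝ Plane := by
  have h1 := (hasMFDerivAt_symm hc (c.map_source hx)).comp x (hasMFDerivAt_chart hc hx)
  have h2 : HasMFDerivAt (𝓡 2) (𝓡 2) (c.symm ∘ c) x (ContinuousLinearMap.id ℝ Plane) := by
    refine (hasMFDerivAt_id x).congr_of_eventuallyEq ?_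
    filter_upwards [c.open_source.mem_nhds hx] with z hz
    exact c.left_inv hz
  exact hasMFDerivAt_unique h1 h2

theorem dchart_dsymm (hc : c ∈ IsManifold.maximalAtlas (𝓡 2) ∞ M) {x : M} (hx : x ∈ c.source) :
    dchart c x ∘L dsymm c (c x) = ContinuousLinearMap.id ℝ Plane := by
  have h0 := hasMFDerivAt_chart hc (x := c.symm (c x)) (by rwa [c.left_inv hx])
  have h1 := HasMFDerivAt.comp (c x) h0 (hasMFDerivAt_symm hc (c.map_source hx))
  have h2 : HasMFDerivAt (𝓡 2) (𝓡 2) (c ∘ c.symm) (c x) (ContinuousLinearMap.id ℝ Plane) := by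
    refine (hasMFDerivAt_id (c x)).congr_of_eventuallyEq ?_
    filter_upwards [c.open_target.mem_nhds (c.map_source hx)] with z hz
    exact c.right_inv hz
  have h3 := hasMFDerivAt_unique h1 h2
  rw [c.left_inv hx] at h3
  exact h3

theorem coordForm_apply (w : M → Plane →L[ℝ] ℂ) {x : M} (hx : x ∈ c.source) (v : Plane) :
    coordForm w c (c x) v = w x (dsymm c (c x) v) := by
  rw [coordForm, c.left_inv hx]
  rfl

theorem coordForm_dchart (hc : c ∈ IsManifold.maximalAtlas (𝓡 2) ∞ M) (w : M → Plane →L[ℝ] ℂ)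
    {x : M} (hx : x ∈ c.source) : coordForm w c (c x) ∘L dchart c x = w x := by
  rw [coordForm, c.left_inv hx, ContinuousLinearMap.comp_assoc, dsymm_dchart hc hx]
  rfl

theorem eq_of_coordForm_eq (hc : c ∈ IsManifold.maximalAtlas (𝓡 2) ∞ M)
    {w w' : M → Plane →L[ℝ] ℂ} {x : M} (hx : x ∈ c.source)
    (h : coordForm w c (c x) = coordForm w' c (c x)) : w x = w' x := by
  rw [← coordForm_dchart hc w hx, h, coordForm_dchart hc w' hx]

theorem hasMFDerivAt_dfun {f : M → ℂ} {x : M} (hf : MDifferentiableAt (𝓡 2) 𝓘(ℝ, ℂ) f x) :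
    HasMFDerivAt (𝓡 2) 𝓘(ℝ, ℂ) f x (dfun f x) := hf.hasMFDerivAt

theorem dfun_eq_of_hasMFDerivAt {f : M → ℂ} {x : M} {L : Plane →L[ℝ] ℂ}
    (h : HasMFDerivAt (𝓡 2) 𝓘(ℝ, ℂ) f x L) : dfun f x = L := h.mfderiv

theorem coordForm_dfun (hc : c ∈ IsManifold.maximalAtlas (𝓡 2) ∞ M) {f : M → ℂ} {y : Plane}
    (hy : y ∈ c.target) (hf : MDifferentiableAt (𝓡 2) 𝓘(ℝ, ℂ) f (c.symm y)) :
    HasFDerivAt (f ∘ c.symm) (coordForm (dfun f) c y) y :=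
  hasMFDerivAt_iff_hasFDerivAt.1
    (HasMFDerivAt.comp y (hasMFDerivAt_dfun hf) (hasMFDerivAt_symm hc hy))

theorem contDiffAt_comp_symm (hc : c ∈ IsManifold.maximalAtlas (𝓡 2) ∞ M) {f : M → ℂ} {y : Plane}
    (hy : y ∈ c.target) (hf : ContMDiffAt (𝓡 2) 𝓘(ℝ, ℂ) ∞ f (c.symm y)) :
    ContDiffAt ℝ ∞ (f ∘ c.symm) y :=
  contMDiffAt_iff_contDiffAt.1
    (ContMDiffAt.comp y hf (contMDiffAt_symm_of_mem_maximalAtlas hc hy))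

theorem contMDiffAt_of_comp_symm (hc : c ∈ IsManifold.maximalAtlas (𝓡 2) ∞ M) {f : M → ℂ} {x : M}
    (hx : x ∈ c.source) (hf : ContDiffAt ℝ ∞ (f ∘ c.symm) (c x)) :
    ContMDiffAt (𝓡 2) 𝓘(ℝ, ℂ) ∞ f x := by
  have h1 := ContMDiffAt.comp x (contMDiffAt_iff_contDiffAt.2 hf)
    (contMDiffAt_of_mem_maximalAtlas hc hx)
  refine h1.congr_of_eventuallyEq ?_
  filter_upwards [c.open_source.mem_nhds hx] with z hz
  simp only [Function.comp, c.left_inv hz]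

theorem contDiffAt_transition (hc : c ∈ IsManifold.maximalAtlas (𝓡 2) ∞ M)
    (hc' : c' ∈ IsManifold.maximalAtlas (𝓡 2) ∞ M) {y : Plane} (hy : y ∈ c.target)
    (hy' : c.symm y ∈ c'.source) : ContDiffAt ℝ ∞ (c' ∘ c.symm) y :=
  contMDiffAt_iff_contDiffAt.1 (ContMDiffAt.comp y (contMDiffAt_of_mem_maximalAtlas hc' hy')
    (contMDiffAt_symm_of_mem_maximalAtlas hc hy))

/-- The transformation rule for one-forms. -/
theorem coordForm_transition (hc : c ∈ IsManifold.maximalAtlas (𝓡 2) ∞ M)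
    (hc' : c' ∈ IsManifold.maximalAtlas (𝓡 2) ∞ M) (w : M → Plane →L[ℝ] ℂ) {y : Plane}
    (hy : y ∈ c.target) (hy' : c.symm y ∈ c'.source) :
    coordForm w c y = coordForm w c' ((c' ∘ c.symm) y) ∘L fderiv ℝ (c' ∘ c.symm) y := by
  have h1 : HasFDerivAt (𝕜 := ℝ) (c' ∘ c.symm) (dchart c' (c.symm y) ∘L dsymm c y) y :=
    hasMFDerivAt_iff_hasFDerivAt.1
      (HasMFDerivAt.comp y (hasMFDerivAt_chart hc' hy') (hasMFDerivAt_symm hc hy))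
  rw [h1.fderiv, ← ContinuousLinearMap.comp_assoc, Function.comp_apply,
    coordForm_dchart hc' w hy', coordForm]

theorem eventually_mem_overlap {y : Plane} (hy : y ∈ c.target) (hy' : c.symm y ∈ c'.source) :
    ∀ᶠ z in 𝓝 y, z ∈ c.target ∧ c.symm z ∈ c'.source :=
  Filter.Eventually.and (c.open_target.mem_nhds hy)
    ((c.continuousAt_symm hy).eventually (c'.open_source.mem_nhds hy'))

theorem contDiffAt_coordForm_transition (hc : c ∈ IsManifold.maximalAtlas (𝓡 2) ∞ M)
    (hc' : c' ∈ IsManifold.maximalAtlas (𝓡 2) ∞ M) {w : M → Plane →L[ℝ] ℂ} {x : M}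
    (hx : x ∈ c.source) (hx' : x ∈ c'.source) (h : ContDiffAt ℝ ∞ (coordForm w c') (c' x)) :
    ContDiffAt ℝ ∞ (coordForm w c) (c x) := by
  have hy := c.map_source hx
  have hy' : c.symm (c x) ∈ c'.source := by rwa [c.left_inv hx]
  have h1 := contDiffAt_transition hc hc' hy hy'
  have h2 : ContDiffAt ℝ ∞ (fun z ↦ coordForm w c' ((c' ∘ c.symm) z)) (c x) :=
    ContDiffAt.comp (c x) (g := coordForm w c') (by rw [Function.comp_apply, c.left_inv hx]; exact h) h1
  refine (h2.clm_comp (h1.fderiv_right (m := ∞) (by simp))).congr_of_eventuallyEq ?_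
  filter_upwards [eventually_mem_overlap hy hy'] with z hz
  exact coordForm_transition hc hc' w hz.1 hz.2

/-- Smoothness of a one-form at a point. -/
def IsSmoothFormAt (w : M → Plane →L[ℝ] ℂ) (x : M) : Prop :=
  ContDiffAt ℝ ∞ (coordForm w (chartAt Plane x)) (chartAt Plane x x)

/-- The preferred chart at `x` can be traded for any compatible chart, in particular for one from an
oriented atlas. -/
theorem isSmoothFormAt_iff (hc : c ∈ IsManifold.maximalAtlas (𝓡 2) ∞ M) {w : M → Plane →L[ℝ] ℂ}
    {x : M} (hx : x ∈ c.source) : IsSmoothFormAt w x ↔ ContDiffAt ℝ ∞ (coordForm w c) (c x) :=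
  ⟨contDiffAt_coordForm_transition hc (IsManifold.chart_mem_maximalAtlas x) hx
    (mem_chart_source Plane x),
  contDiffAt_coordForm_transition (IsManifold.chart_mem_maximalAtlas x) hc
    (mem_chart_source Plane x) hx⟩

theorem coordForm_congr {w w' : M → Plane →L[ℝ] ℂ} {x : M} (hx : x ∈ c.source)
    (h : w =ᶠ[𝓝 x] w') : coordForm w c =ᶠ[𝓝 (c x)] coordForm w' c := by
  have := (c.continuousAt_symm (c.map_source hx))
  rw [ContinuousAt, c.left_inv hx] at this
  filter_upwards [this.eventually h] with z hz
  rw [coordForm, coordForm, hz]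

theorem IsSmoothFormAt.congr {w w' : M → Plane →L[ℝ] ℂ} {x : M} (hw : IsSmoothFormAt w x)
    (h : w' =ᶠ[𝓝 x] w) : IsSmoothFormAt w' x :=
  ContDiffAt.congr_of_eventuallyEq hw (coordForm_congr (mem_chart_source Plane x) h)

theorem eventually_mdifferentiableAt {f : M → ℂ} {x : M}
    (hf : ContMDiffAt (𝓡 2) 𝓘(ℝ, ℂ) ∞ f x) :
    ∀ᶠ y in 𝓝 x, MDifferentiableAt (𝓡 2) 𝓘(ℝ, ℂ) f y := by
  have : IsManifold (𝓡 2) 1 M := IsManifold.of_le (n := ∞) (by simp)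
  have h1 : ContMDiffAt (𝓡 2) 𝓘(ℝ, ℂ) 1 f x := hf.of_le (by simp)
  filter_upwards [(contMDiffAt_iff_contMDiffAt_nhds (by simp)).1 h1] with y hy
  exact hy.mdifferentiableAt (by simp)

theorem isSmoothFormAt_dfun {f : M → ℂ} {x : M} (hf : ContMDiffAt (𝓡 2) 𝓘(ℝ, ℂ) ∞ f x) :
    IsSmoothFormAt (dfun f) x := by
  have hc := IsManifold.chart_mem_maximalAtlas (I := 𝓡 2) (n := ∞) x
  set c := chartAt Plane x
  have hx : x ∈ c.source := mem_chart_source Plane x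
  have h1 := contDiffAt_comp_symm hc (c.map_source hx) (f := f) (by rwa [c.left_inv hx])
  refine (h1.fderiv_right (m := ∞) (by simp)).congr_of_eventuallyEq ?_
  have h2 := (c.continuousAt_symm (c.map_source hx))
  rw [ContinuousAt, c.left_inv hx] at h2
  filter_upwards [c.open_target.mem_nhds (c.map_source hx),
    h2.eventually (eventually_mdifferentiableAt hf)] with z hz hz'
  exact (coordForm_dfun hc hz hz').fderiv.symm

theorem IsSmoothFormAt.smul {f : M → ℂ} {w : M → Plane →L[ℝ] ℂ} {x : M}
    (hf : ContMDiffAt (𝓡 2) 𝓘(ℝ, ℂ) ∞ f x) (hw : IsSmoothFormAt w x) :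
    IsSmoothFormAt (fun x ↦ f x • w x) x := by
  have hc := IsManifold.chart_mem_maximalAtlas (I := 𝓡 2) (n := ∞) x
  set c := chartAt Plane x
  have hx : x ∈ c.source := mem_chart_source Plane x
  exact (contDiffAt_comp_symm hc (c.map_source hx) (f := f) (by rwa [c.left_inv hx])).smul hw

/-- The tangent bundle is trivialized by the derivative of the inverse chart, so smoothness as a
bundle section is smoothness of the coordinate expression. -/
theorem contMDiffAt_comp_symmL_iff (w : M → Plane →L[ℝ] ℂ) (x₀ : M) :
    ContMDiffAt (𝓡 2) 𝓘(ℝ, Plane →L[ℝ] ℂ) ∞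
      (fun x ↦ w x ∘L (trivializationAt Plane (TangentSpace (𝓡 2)) x₀).symmL ℝ x) x₀ ↔
    IsSmoothFormAt w x₀ := by
  set c := chartAt Plane x₀ with hc0
  have hc : c ∈ IsManifold.maximalAtlas (𝓡 2) ∞ M := IsManifold.chart_mem_maximalAtlas x₀
  have hx : x₀ ∈ c.source := mem_chart_source Plane x₀
  have key : (fun x ↦ w x ∘L (trivializationAt Plane (TangentSpace (𝓡 2)) x₀).symmL ℝ x) =ᶠ[𝓝 x₀]
      coordForm w c ∘ c := by
    filter_upwards [c.open_source.mem_nhds hx] with x hx'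
    rw [Function.comp_apply, coordForm, c.left_inv hx',
      TangentBundle.symmL_trivializationAt (I := 𝓡 2) hx', ModelWithCorners.range_eq_univ,
      mfderivWithin_univ]
    rfl
  constructor
  · intro h
    have h1 := ContMDiffAt.comp (c x₀) (g := fun x ↦ w x ∘L
        (trivializationAt Plane (TangentSpace (𝓡 2)) x₀).symmL ℝ x)
      (by rw [c.left_inv hx]; exact h) (contMDiffAt_symm_of_mem_maximalAtlas hc (c.map_source hx))
    refine (contMDiffAt_iff_contDiffAt.1 h1).congr_of_eventuallyEq ?_
    have h2 := (c.continuousAt_symm (c.map_source hx))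
    rw [ContinuousAt, c.left_inv hx] at h2
    filter_upwards [c.open_target.mem_nhds (c.map_source hx), h2.eventually key] with z hz hz'
    rw [Function.comp_apply, hz', Function.comp_apply, c.right_inv hz]
  · intro h
    exact (ContMDiffAt.comp x₀ (contMDiffAt_iff_contDiffAt.2 h)
      (contMDiffAt_of_mem_maximalAtlas hc hx)).congr_of_eventuallyEq key

/-- The one-form with given values. -/
def mkForm (w : M → Plane →L[ℝ] ℂ) (hw : ∀ x, IsSmoothFormAt w x) : OneForm M where
  toFun x := w x
  contMDiff_toFun x₀ := (contMDiffAt_form_iff w x₀).2 ((contMDiffAt_comp_symmL_iff w x₀).2 (hw x₀))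

/-- The values of a one-form, as maps on the model space. -/
def OneForm.field (α : OneForm M) (x : M) : Plane →L[ℝ] ℂ := α.val x

theorem mkForm_field (w : M → Plane →L[ℝ] ℂ) (hw : ∀ x, IsSmoothFormAt w x) :
    (mkForm w hw).field = w := rfl

theorem OneForm.isSmoothFormAt (α : OneForm M) (x : M) : IsSmoothFormAt α.field x :=
  (contMDiffAt_comp_symmL_iff _ x).1 ((contMDiffAt_form_iff α.val x).1 (α.contMDiff x))

end

/-! ### Closed one-forms -/

/-- The exterior derivative of a one-form on the plane. -/
def planeDer (A : Plane → Plane →L[ℝ] ℂ) (y u v : Plane) : ℂ :=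
  fderiv ℝ A y u v - fderiv ℝ A y v u

theorem planeDer_congr {A B : Plane → Plane →L[ℝ] ℂ} {y : Plane} (h : A =ᶠ[𝓝 y] B) (u v : Plane) :
    planeDer A y u v = planeDer B y u v := by
  rw [planeDer, planeDer, h.fderiv_eq]

/-- Naturality of `d` under pullback; it makes closedness independent of the chart. -/
theorem planeDer_pullback {A : Plane → Plane →L[ℝ] ℂ} {τ : Plane → Plane} {y : Plane}
    (hA : DifferentiableAt ℝ A (τ y)) (hτ : ContDiffAt ℝ ∞ τ y) (u v : Plane) :
    planeDer (fun z ↦ A (τ z) ∘L fderiv ℝ τ z) y u v =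
      planeDer A (τ y) (fderiv ℝ τ y u) (fderiv ℝ τ y v) := by
  have h1 : DifferentiableAt ℝ τ y := hτ.differentiableAt (by simp)
  have h2 : DifferentiableAt ℝ (fderiv ℝ τ) y :=
    (hτ.fderiv_right (m := ∞) (by simp)).differentiableAt (by simp)
  have h3 : HasFDerivAt (fun z ↦ A (τ z)) (fderiv ℝ A (τ y) ∘L fderiv ℝ τ y) y :=
    hA.hasFDerivAt.comp y h1.hasFDerivAt
  have h4 := h3.clm_comp h2.hasFDerivAt
  -- The terms with second derivatives of `τ` cancel in the antisymmetrization.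
  have h5 : fderiv ℝ (fderiv ℝ τ) y u v = fderiv ℝ (fderiv ℝ τ) y v u :=
    (hτ.isSymmSndFDerivAt (by simpa using ENat.LEInfty.out (m := 2))) u v
  rw [planeDer, planeDer, h4.fderiv]
  simp [h5]

theorem planeDer_fderiv {f : Plane → ℂ} {y : Plane} (hf : ContDiffAt ℝ ∞ f y) (u v : Plane) :
    planeDer (fderiv ℝ f) y u v = 0 := by
  rw [planeDer, (hf.isSymmSndFDerivAt (by simpa using ENat.LEInfty.out (m := 2))) u v, sub_self]

section
variable {M : Type*} [TopologicalSpace M] [ChartedSpace Plane M] [IsManifold (𝓡 2) ∞ M]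
variable {c c' : OpenPartialHomeomorph M Plane}

theorem planeDer_transition (hc : c ∈ IsManifold.maximalAtlas (𝓡 2) ∞ M)
    (hc' : c' ∈ IsManifold.maximalAtlas (𝓡 2) ∞ M) {w : M → Plane →L[ℝ] ℂ} {y : Plane}
    (hy : y ∈ c.target) (hy' : c.symm y ∈ c'.source) (hw : IsSmoothFormAt w (c.symm y))
    (u v : Plane) :
    planeDer (coordForm w c) y u v = planeDer (coordForm w c') ((c' ∘ c.symm) y)
      (fderiv ℝ (c' ∘ c.symm) y u) (fderiv ℝ (c' ∘ c.symm) y v) := by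
  rw [← planeDer_pullback
    (((isSmoothFormAt_iff hc' hy').1 hw).differentiableAt (by simp))
    (contDiffAt_transition hc hc' hy hy')]
  apply planeDer_congr
  filter_upwards [eventually_mem_overlap hy hy'] with z hz
  exact coordForm_transition hc hc' w hz.1 hz.2

/-- A one-form is closed at a point. -/
def IsClosedFormAt (w : M → Plane →L[ℝ] ℂ) (x : M) : Prop :=
  ∀ u v, planeDer (coordForm w (chartAt Plane x)) (chartAt Plane x x) u v = 0

theorem isClosedFormAt_iff_of (hc : c ∈ IsManifold.maximalAtlas (𝓡 2) ∞ M)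
    {w : M → Plane →L[ℝ] ℂ} {x : M} (hx : x ∈ c.source) (hw : IsSmoothFormAt w x)
    (h : IsClosedFormAt w x) (u v : Plane) : planeDer (coordForm w c) (c x) u v = 0 := by
  have hx' : c.symm (c x) ∈ (chartAt Plane x).source := by
    rw [c.left_inv hx]; exact mem_chart_source Plane x
  rw [planeDer_transition hc (IsManifold.chart_mem_maximalAtlas x) (c.map_source hx) hx'
    (by rwa [c.left_inv hx]), Function.comp_apply, c.left_inv hx]
  exact h _ _

theorem isClosedFormAt_of_dfun {f : M → ℂ} {w : M → Plane →L[ℝ] ℂ} {x : M}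
    (hf : ContMDiffAt (𝓡 2) 𝓘(ℝ, ℂ) ∞ f x) (h : w =ᶠ[𝓝 x] dfun f) : IsClosedFormAt w x := by
  intro u v
  have hc := IsManifold.chart_mem_maximalAtlas (I := 𝓡 2) (n := ∞) x
  have hx : x ∈ (chartAt Plane x).source := mem_chart_source Plane x
  rw [planeDer_congr (coordForm_congr hx h)]
  set c := chartAt Plane x
  have h1 := contDiffAt_comp_symm hc (c.map_source hx) (f := f) (by rwa [c.left_inv hx])
  rw [← planeDer_fderiv h1 u v]
  apply planeDer_congr
  have h2 := (c.continuousAt_symm (c.map_source hx))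
  rw [ContinuousAt, c.left_inv hx] at h2
  filter_upwards [c.open_target.mem_nhds (c.map_source hx),
    h2.eventually (eventually_mdifferentiableAt hf)] with z hz hz'
  exact (coordForm_dfun hc hz hz').fderiv.symm

/-- The Poincaré lemma. -/
theorem exists_primitive {w : M → Plane →L[ℝ] ℂ} (hw : ∀ x, IsSmoothFormAt w x)
    (hcl : ∀ x, IsClosedFormAt w x) (b : M) :
    ∃ f : M → ℂ, ∀ᶠ x in 𝓝 b, ContMDiffAt (𝓡 2) 𝓘(ℝ, ℂ) ∞ f x ∧ dfun f x = w x := by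
  have hc := IsManifold.chart_mem_maximalAtlas (I := 𝓡 2) (n := ∞) b
  have hb : b ∈ (chartAt Plane b).source := mem_chart_source Plane b
  set c := chartAt Plane b
  obtain ⟨r, hr, hB⟩ := Metric.isOpen_iff.1 c.open_target (c b) (c.map_source hb)
  have hsm : ∀ y ∈ Metric.ball (c b) r, ContDiffAt ℝ ∞ (coordForm w c) y := by
    intro y hy
    have := (isSmoothFormAt_iff hc (c.map_target (hB hy))).1 (hw (c.symm y))
    rwa [c.right_inv (hB hy)] at this
  -- On a ball in the chart, closedness is symmetry of the derivative of the coefficient map, so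
  -- convexity yields a primitive.
  obtain ⟨g, hg⟩ := (convex_ball (c b) r).exists_forall_hasFDerivAt_of_fderiv_symmetric
    Metric.isOpen_ball
    (fun y hy ↦ ((hsm y hy).differentiableAt (by simp)).differentiableWithinAt)
    (fun y hy u v ↦ by
      have := isClosedFormAt_iff_of hc (c.map_target (hB hy)) (hw _) (hcl (c.symm y)) u v
      rw [c.right_inv (hB hy)] at this
      exact sub_eq_zero.1 this)
  -- The derivative of `g` is the smooth coefficient map, hence `g` is smooth.
  have hgs : ContDiffOn ℝ ∞ g (Metric.ball (c b) r) := by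
    rw [contDiffOn_infty_iff_fderiv_of_isOpen Metric.isOpen_ball]
    refine ⟨fun y hy ↦ (hg y hy).differentiableAt.differentiableWithinAt, fun y hy ↦ ?_⟩
    refine ((hsm y hy).contDiffWithinAt).congr (fun z hz ↦ (hg z hz).fderiv) (hg y hy).fderiv
  refine ⟨g ∘ c, ?_⟩
  have hU : c ⁻¹' Metric.ball (c b) r ∈ 𝓝 b :=
    (c.continuousAt hb).preimage_mem_nhds (Metric.ball_mem_nhds _ hr)
  filter_upwards [hU, c.open_source.mem_nhds hb] with x hx hxs
  have hx' : c x ∈ Metric.ball (c b) r := hx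
  have hloc : (g ∘ c) ∘ c.symm =ᶠ[𝓝 (c x)] g := by
    filter_upwards [c.open_target.mem_nhds (c.map_source hxs)] with z hz
    simp only [Function.comp, c.right_inv hz]
  have hsx : ContMDiffAt (𝓡 2) 𝓘(ℝ, ℂ) ∞ (g ∘ c) x :=
    contMDiffAt_of_comp_symm hc hxs
      ((hgs.contDiffAt (Metric.isOpen_ball.mem_nhds hx')).congr_of_eventuallyEq hloc)
  refine ⟨hsx, eq_of_coordForm_eq hc hxs ?_⟩
  have h1 := coordForm_dfun hc (c.map_source hxs) (f := g ∘ c)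
    (by rw [c.left_inv hxs]; exact hsx.mdifferentiableAt (by simp))
  exact (h1.congr_of_eventuallyEq hloc.symm).unique (hg _ hx')

/-! ### Flat connections and closed one-forms -/

theorem OneForm.extDer_eq (α : OneForm M) (x : M) (u v : Plane) :
    α.extDer x u v = planeDer (coordForm α.field (chartAt Plane x)) (chartAt Plane x x)
      (dchart (chartAt Plane x) x u) (dchart (chartAt Plane x) x v) := rfl

theorem OneForm.extDer_eq_zero_iff (α : OneForm M) (x : M) :
    (∀ u v, α.extDer x u v = 0) ↔ IsClosedFormAt α.field x := by
  have hc := IsManifold.chart_mem_maximalAtlas (I := 𝓡 2) (n := ∞) x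
  have hx : x ∈ (chartAt Plane x).source := mem_chart_source Plane x
  constructor
  · intro h u v
    have h1 := h (dsymm (chartAt Plane x) (chartAt Plane x x) u)
      (dsymm (chartAt Plane x) (chartAt Plane x x) v)
    have h2 : ∀ a, dchart (chartAt Plane x) x (dsymm (chartAt Plane x) (chartAt Plane x x) a) = a :=
      fun a ↦ congrArg (fun L : Plane →L[ℝ] Plane ↦ L a) (dchart_dsymm hc hx)
    rw [OneForm.extDer_eq, h2, h2] at h1
    exact h1
  · exact fun h u v ↦ (α.extDer_eq x u v).trans (h _ _)

theorem OneForm.extDer_add (α β : OneForm M) (x : M) (u v : Plane) :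
    (α + β).extDer x u v = α.extDer x u v + β.extDer x u v := by
  have h1 : coordForm (α + β).field (chartAt Plane x) =
      coordForm α.field (chartAt Plane x) + coordForm β.field (chartAt Plane x) := by
    funext y
    exact ContinuousLinearMap.add_comp _ _ _
  rw [OneForm.extDer_eq, OneForm.extDer_eq, OneForm.extDer_eq, h1, planeDer, planeDer, planeDer,
    fderiv_add ((α.isSmoothFormAt x).differentiableAt (by simp))
      ((β.isSmoothFormAt x).differentiableAt (by simp))]
  simp only [_root_.add_apply]
  ring

/-- The exact one-form `df`. -/
def exactForm (f : SmoothFun M) : OneForm M :=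
  mkForm (dfun f) fun x ↦ isSmoothFormAt_dfun (f.contMDiff x)

theorem extDer_exactForm (f : SmoothFun M) (x : M) (u v : Plane) :
    (exactForm f).extDer x u v = 0 :=
  ((exactForm f).extDer_eq_zero_iff x).2 (isClosedFormAt_of_dfun (f.contMDiff x) .rfl) u v

theorem hasMFDerivAt_mul {f g : M → ℂ} {x : M} (hf : MDifferentiableAt (𝓡 2) 𝓘(ℝ, ℂ) f x)
    (hg : MDifferentiableAt (𝓡 2) 𝓘(ℝ, ℂ) g x) :
    HasMFDerivAt (𝓡 2) 𝓘(ℝ, ℂ) (f * g) x (f x • dfun g x + g x • dfun f x) :=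
  (hasMFDerivAt_dfun hf).mul (hasMFDerivAt_dfun hg)

theorem dfun_mul {f g : M → ℂ} {x : M} (hf : MDifferentiableAt (𝓡 2) 𝓘(ℝ, ℂ) f x)
    (hg : MDifferentiableAt (𝓡 2) 𝓘(ℝ, ℂ) g x) :
    dfun (f * g) x = f x • dfun g x + g x • dfun f x :=
  dfun_eq_of_hasMFDerivAt (hasMFDerivAt_mul hf hg)

theorem hasMFDerivAt_comp_of_hasFDerivAt {f : M → ℂ} {F : ℂ → ℂ} {L : ℂ →L[ℝ] ℂ} {x : M}
    (hF : HasFDerivAt F L (f x)) (hf : MDifferentiableAt (𝓡 2) 𝓘(ℝ, ℂ) f x) :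
    HasMFDerivAt (𝓡 2) 𝓘(ℝ, ℂ) (F ∘ f) x (L ∘L dfun f x) :=
  HasMFDerivAt.comp x (hasMFDerivAt_iff_hasFDerivAt.2 hF) (hasMFDerivAt_dfun hf)

/-- The chain rule with a holomorphic function. -/
theorem dfun_comp_of_hasDerivAt {f : M → ℂ} {F : ℂ → ℂ} {a : ℂ} {x : M}
    (hF : HasDerivAt F a (f x)) (hf : MDifferentiableAt (𝓡 2) 𝓘(ℝ, ℂ) f x) :
    dfun (F ∘ f) x = a • dfun f x := by
  rw [dfun_eq_of_hasMFDerivAt (hasMFDerivAt_comp_of_hasFDerivAt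
    (hF.hasFDerivAt.restrictScalars ℝ) hf)]
  refine ContinuousLinearMap.ext fun (v : Plane) ↦ ?_
  change dfun f x v * a = a * dfun f x v
  ring

theorem dfun_conj {f : M → ℂ} {x : M} (hf : MDifferentiableAt (𝓡 2) 𝓘(ℝ, ℂ) f x) (v : Plane) :
    dfun (fun y ↦ (starRingEnd ℂ) (f y)) x v = (starRingEnd ℂ) (dfun f x v) := by
  have h := hasMFDerivAt_comp_of_hasFDerivAt (F := Complex.conjCLE)
    (Complex.conjCLE.toContinuousLinearMap.hasFDerivAt (x := f x)) hf
  have h2 := dfun_eq_of_hasMFDerivAt h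
  exact congrArg (fun L : Plane →L[ℝ] ℂ ↦ L v) h2

theorem dfun_congr {f g : M → ℂ} {x : M} (h : f =ᶠ[𝓝 x] g) : dfun f x = dfun g x :=
  h.mfderiv_eq

theorem dfun_const (a : ℂ) (x : M) : dfun (fun _ : M ↦ a) x = 0 :=
  dfun_eq_of_hasMFDerivAt (hasMFDerivAt_const a x)

namespace Connection

theorem toFun_apply (D : Connection M) (s : SmoothFun M) (x : M) (v : Plane) :
    (D.toFun s).field x v = dfun s x v + s x * D.form.field x v := by
  have h := D.leibniz s 1 x v
  rw [mul_one] at h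
  have h1 : (1 : SmoothFun M) x = 1 := rfl
  rw [h1, mul_one, add_comm] at h
  exact h

theorem toFun_eq (D : Connection M) (s : SmoothFun M) :
    D.toFun s = exactForm s + D.form.mul s :=
  OneForm.ext_val fun x v ↦ D.toFun_apply s x v

/-- In `D (ds + s η)` the term `d(ds)` vanishes, `ds ∧ η` cancels against `η ∧ ds`, and `η ∧ η = 0`,
so the curvature is `s dη`. The section `s = 1` gives the forward direction. -/
theorem isFlat_iff (D : Connection M) : D.IsFlat ↔ ∀ x, IsClosedFormAt D.form.field x := by
  constructor
  · intro h x
    rw [← OneForm.extDer_eq_zero_iff]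
    intro u v
    have := h 1 x u v
    rw [covDer] at this
    change D.form.extDer x u v + (D.form.val x u * D.form.val x v -
      D.form.val x v * D.form.val x u) = 0 at this
    rw [mul_comm (D.form.val x u), sub_self, add_zero] at this
    exact this
  · intro h s x u v
    have h1 := (D.form.extDer_eq_zero_iff x).2 (h x) u v
    have h2 : ∀ w, (exactForm s + D.form.mul s).val x w = diff s x w + s x * D.form.val x w :=
      fun w ↦ rfl
    have h3 : (exactForm s + D.form.mul s).extDer x u v = _ :=
      OneForm.extDer_add (exactForm s) (D.form.mul s) x u v
    have h4 : (exactForm s).extDer x u v = 0 := extDer_exactForm s x u v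
    rw [covDer, D.toFun_eq, h3, h4, OneForm.extDer_mul, h1, h2, h2]
    ring

/-- The connection `d + η`. -/
def ofForm (η : OneForm M) : Connection M where
  toFun s := exactForm s + η.mul s
  map_add s t := by
    apply OneForm.ext_val
    intro x v
    have hs : MDifferentiableAt (𝓡 2) 𝓘(ℝ, ℂ) s x := (s.contMDiff x).mdifferentiableAt (by simp)
    have ht : MDifferentiableAt (𝓡 2) 𝓘(ℝ, ℂ) t x := (t.contMDiff x).mdifferentiableAt (by simp)
    have h : dfun (s + t) x = dfun s x + dfun t x :=
      dfun_eq_of_hasMFDerivAt ((hasMFDerivAt_dfun hs).add (hasMFDerivAt_dfun ht))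
    have key : ∀ v : Plane, dfun (s + t) x v + (s x + t x) * η.field x v =
        (dfun s x v + s x * η.field x v) + (dfun t x v + t x * η.field x v) := by
      intro v
      rw [h, _root_.add_apply]
      ring
    exact key v
  leibniz f s x v := by
    have hf : MDifferentiableAt (𝓡 2) 𝓘(ℝ, ℂ) f x := (f.contMDiff x).mdifferentiableAt (by simp)
    have hs : MDifferentiableAt (𝓡 2) 𝓘(ℝ, ℂ) s x := (s.contMDiff x).mdifferentiableAt (by simp)
    have key : ∀ v : Plane, dfun (⇑f * ⇑s) x v + (f x * s x) * η.field x v =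
        f x * (dfun s x v + s x * η.field x v) + dfun f x v * s x := by
      intro v
      rw [dfun_mul hf hs]
      simp only [_root_.add_apply, _root_.smul_apply, smul_eq_mul]
      ring
    exact key v

theorem ofForm_form_field (η : OneForm M) : (ofForm η).form.field = η.field := by
  funext x
  ext v
  change dfun (fun _ ↦ (1 : ℂ)) x v + 1 * η.field x v = _
  rw [dfun_const]
  simp

theorem ext_form {D D' : Connection M} (h : D.form.field = D'.form.field) : D = D' := by
  apply Connection.ext
  funext s
  apply OneForm.ext_val
  intro x v
  have h1 := D.toFun_apply s x v
  have h2 := D'.toFun_apply s x v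
  rw [h, ← h2] at h1
  exact h1

end Connection
end

/-! ### Smooth representatives of homotopy classes -/

section
variable {M : Type*} [TopologicalSpace M] [ChartedSpace Plane M] [IsManifold (𝓡 2) ∞ M]

/-- A smooth path that is constant near its ends. -/
structure IsFlatEnded {x y : M} (p : Path x y) : Prop where
  contMDiff : ContMDiff 𝓘(ℝ, ℝ) (𝓡 2) ∞ p.extend
  left : ∀ᶠ t in 𝓝 (0 : ℝ), p.extend t = x
  right : ∀ᶠ t in 𝓝 (1 : ℝ), p.extend t = y

theorem IsFlatEnded.isSmoothPath {x y : M} {p : Path x y} (hp : IsFlatEnded p) :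
    IsSmoothPath p := hp.contMDiff.contMDiffOn

/-- Constancy near the ends makes concatenation smooth; this is why the notion is stronger than
smoothness. -/
theorem IsFlatEnded.trans {x y z : M} {p : Path x y} {q : Path y z} (hp : IsFlatEnded p)
    (hq : IsFlatEnded q) : IsFlatEnded (p.trans q) := by
  have h1 : ∀ t : ℝ, t ≤ 1 / 2 → (p.trans q).extend t = p.extend (2 * t) := fun t ht ↦
    Path.extend_trans_of_le_half p q ht
  have h2 : ∀ t : ℝ, 1 / 2 ≤ t → (p.trans q).extend t = q.extend (2 * t - 1) := fun t ht ↦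
    Path.extend_trans_of_half_le p q ht
  have e1 : ∀ t : ℝ, t < 1 / 2 → (p.trans q).extend =ᶠ[𝓝 t] fun t ↦ p.extend (2 * t) := fun t ht ↦ by
    filter_upwards [Iio_mem_nhds ht] with s hs using h1 s (le_of_lt hs)
  have e2 : ∀ t : ℝ, 1 / 2 < t → (p.trans q).extend =ᶠ[𝓝 t] fun t ↦ q.extend (2 * t - 1) :=
    fun t ht ↦ by filter_upwards [Ioi_mem_nhds ht] with s hs using h2 s (le_of_lt hs)
  have s1 : ContMDiff 𝓘(ℝ, ℝ) (𝓡 2) ∞ fun t ↦ p.extend (2 * t) :=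
    hp.contMDiff.comp (contDiff_const.mul contDiff_id).contMDiff
  have s2 : ContMDiff 𝓘(ℝ, ℝ) (𝓡 2) ∞ fun t ↦ q.extend (2 * t - 1) :=
    hq.contMDiff.comp ((contDiff_const.mul contDiff_id).sub contDiff_const).contMDiff
  refine ⟨fun t ↦ ?_, ?_, ?_⟩
  · rcases lt_trichotomy t (1 / 2) with ht | ht | ht
    · exact (s1 t).congr_of_eventuallyEq (e1 t ht)
    -- At the junction both halves are constantly `y` nearby.
    · have c1 : ∀ᶠ s in 𝓝 t, p.extend (2 * s) = y := by
        have : Filter.Tendsto (fun s : ℝ ↦ 2 * s) (𝓝 t) (𝓝 1) :=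
          Continuous.tendsto' (by fun_prop) _ _ (by rw [ht]; norm_num)
        exact this.eventually hp.right
      have c2 : ∀ᶠ s in 𝓝 t, q.extend (2 * s - 1) = y := by
        have : Filter.Tendsto (fun s : ℝ ↦ 2 * s - 1) (𝓝 t) (𝓝 0) :=
          Continuous.tendsto' (by fun_prop) _ _ (by rw [ht]; norm_num)
        exact this.eventually hq.left
      refine (contMDiffAt_const (c := y)).congr_of_eventuallyEq ?_
      filter_upwards [c1, c2] with s hs hs'
      rcases le_total s (1 / 2) with h | h
      · rw [h1 s h, hs]
      · rw [h2 s h, hs']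
    · exact (s2 t).congr_of_eventuallyEq (e2 t ht)
  · have : Filter.Tendsto (fun s : ℝ ↦ 2 * s) (𝓝 0) (𝓝 0) :=
      Continuous.tendsto' (by fun_prop) _ _ (by norm_num)
    filter_upwards [e1 0 (by norm_num), this.eventually hp.left] with s hs hs'
    rw [hs, hs']
  · have : Filter.Tendsto (fun s : ℝ ↦ 2 * s - 1) (𝓝 1) (𝓝 1) :=
      Continuous.tendsto' (by fun_prop) _ _ (by norm_num)
    filter_upwards [e2 1 (by norm_num), this.eventually hq.right] with s hs hs'
    rw [hs, hs']

/-- Any neighbourhood of a point contains a neighbourhood in which any two points are joined by a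
smooth path and in which paths with the same endpoints are homotopic. -/
theorem exists_simple_nhds (b : M) {W : Set M} (hW : W ∈ 𝓝 b) :
    ∃ U : Set M, IsOpen U ∧ b ∈ U ∧ U ⊆ W ∧
      (∀ x ∈ U, ∀ y ∈ U, ∃ p : Path x y, Set.range p ⊆ U ∧ IsFlatEnded p) ∧
      ∀ (x y : M) (p q : Path x y), Set.range p ⊆ U → Set.range q ⊆ U → p.Homotopic q := by
  have hc := IsManifold.chart_mem_maximalAtlas (I := 𝓡 2) (n := ∞) b
  have hb : b ∈ (chartAt Plane b).source := mem_chart_source Plane b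
  set c := chartAt Plane b
  have hW' : c.target ∩ c.symm ⁻¹' W ∈ 𝓝 (c b) := by
    refine Filter.inter_mem (c.open_target.mem_nhds (c.map_source hb)) ?_
    apply (c.continuousAt_symm (c.map_source hb)).preimage_mem_nhds
    rwa [c.left_inv hb]
  obtain ⟨r, hr, hB⟩ := Metric.mem_nhds_iff.1 hW'
  set B := Metric.ball (c b) r
  have hconv : Convex ℝ B := convex_ball _ _
  refine ⟨c.source ∩ c ⁻¹' B, c.isOpen_inter_preimage Metric.isOpen_ball,
    ⟨hb, Metric.mem_ball_self hr⟩, ?_, ?_, ?_⟩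
  · rintro x ⟨hx, hx'⟩
    have := (hB hx').2
    rwa [Set.mem_preimage, c.left_inv hx] at this
  · rintro x ⟨hx, hx'⟩ y ⟨hy, hy'⟩
    -- A reparametrization that is `0` up to `1 / 3` and `1` from `2 / 3` on makes the coordinate
    -- segment stationary near its ends.
    set σ : ℝ → ℝ := fun t ↦ Real.smoothTransition (3 * t - 1) with hσ
    have hσ0 : ∀ t : ℝ, t ≤ 1 / 3 → σ t = 0 := fun t ht ↦
      Real.smoothTransition.zero_of_nonpos (by linarith)
    have hσ1 : ∀ t : ℝ, 2 / 3 ≤ t → σ t = 1 := fun t ht ↦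
      Real.smoothTransition.one_of_one_le (by linarith)
    have hσs : ContDiff ℝ ∞ σ :=
      Real.smoothTransition.contDiff.comp ((contDiff_const.mul contDiff_id).sub contDiff_const)
    set ℓ : ℝ → Plane := fun t ↦ c x + σ t • (c y - c x) with hℓ
    have hℓs : ContDiff ℝ ∞ ℓ := contDiff_const.add (hσs.smul contDiff_const)
    have hℓB : ∀ t, ℓ t ∈ B := fun t ↦ hconv.add_smul_sub_mem hx' hy'
      ⟨Real.smoothTransition.nonneg _, Real.smoothTransition.le_one _⟩
    have hF : ContMDiff 𝓘(ℝ, ℝ) (𝓡 2) ∞ (c.symm ∘ ℓ) := fun t ↦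
      ContMDiffAt.comp t (contMDiffAt_symm_of_mem_maximalAtlas hc (hB (hℓB t)).1)
        (hℓs.contMDiff t)
    have hF0 : ∀ t : ℝ, t ≤ 1 / 3 → (c.symm ∘ ℓ) t = x := fun t ht ↦ by
      simp only [Function.comp, hℓ, hσ0 t ht, zero_smul, add_zero, c.left_inv hx]
    have hF1 : ∀ t : ℝ, 2 / 3 ≤ t → (c.symm ∘ ℓ) t = y := fun t ht ↦ by
      simp only [Function.comp, hℓ, hσ1 t ht, one_smul, add_sub_cancel, c.left_inv hy]
    let p : Path x y :=
      { toFun := fun t ↦ (c.symm ∘ ℓ) t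
        continuous_toFun := hF.continuous.comp continuous_subtype_val
        source' := hF0 0 (by norm_num)
        target' := hF1 1 (by norm_num) }
    have hp : p.extend = c.symm ∘ ℓ := by
      funext t
      rcases le_total t 0 with h | h
      · rw [p.extend_of_le_zero h, hF0 t (by linarith)]
      · rcases le_total t 1 with h' | h'
        · exact p.extend_apply ⟨h, h'⟩
        · rw [p.extend_of_one_le h', hF1 t (by linarith)]
    refine ⟨p, ?_, ?_, ?_, ?_⟩
    · rintro _ ⟨t, rfl⟩
      refine ⟨c.map_target (hB (hℓB t)).1, ?_⟩
      change c (c.symm (ℓ t)) ∈ B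
      rw [c.right_inv (hB (hℓB t)).1]
      exact hℓB t
    · rw [hp]
      exact hF
    · rw [hp]
      filter_upwards [Iio_mem_nhds (show (0 : ℝ) < 1 / 3 by norm_num)] with t ht
        using hF0 t (le_of_lt ht)
    · rw [hp]
      filter_upwards [Ioi_mem_nhds (show (2 / 3 : ℝ) < 1 by norm_num)] with t ht
        using hF1 t (le_of_lt ht)
  · intro x y p q hp hq
    have hx : x ∈ c.source ∩ c ⁻¹' B := hp ⟨0, p.source⟩
    have hy : y ∈ c.source ∩ c ⁻¹' B := hp ⟨1, p.target⟩
    -- Both paths come from paths in the coordinate ball, where paths with common endpoints are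
    -- homotopic.
    have : ContractibleSpace B := hconv.contractibleSpace ⟨_, Metric.mem_ball_self hr⟩
    let g : C(B, M) := ⟨fun z ↦ c.symm z, by
      refine continuous_iff_continuousAt.2 fun z ↦ ?_
      exact (c.continuousAt_symm (hB z.2).1).comp continuous_subtype_val.continuousAt⟩
    have lift : ∀ p : Path x y, Set.range p ⊆ c.source ∩ c ⁻¹' B →
        ∃ p' : Path (⟨c x, hx.2⟩ : B) ⟨c y, hy.2⟩,
          (p'.map g.continuous).cast (c.left_inv hx.1).symm (c.left_inv hy.1).symm = p := by
      intro p hp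
      refine ⟨{ toFun := fun t ↦ ⟨c (p t), (hp ⟨t, rfl⟩).2⟩
                continuous_toFun := ?_
                source' := by simp
                target' := by simp }, ?_⟩
      · refine Continuous.subtype_mk (continuous_iff_continuousAt.2 fun t ↦ ?_) _
        exact (c.continuousAt (hp ⟨t, rfl⟩).1).comp p.continuous.continuousAt
      · ext t
        exact c.left_inv (hp ⟨t, rfl⟩).1
    obtain ⟨p', rfl⟩ := lift p hp
    obtain ⟨q', rfl⟩ := lift q hq
    exact ((SimplyConnectedSpace.paths_homotopic p' q').map g).pathCast _ _

/-- Small paths can be replaced by smooth ones, and flat ends survive composition. This lets the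
differential equation, available only on smooth paths, control all homotopy classes. -/
theorem exists_isFlatEnded {x y : M} (κ : Path.Homotopic.Quotient x y) :
    ∃ p : Path x y, IsFlatEnded p ∧ Path.Homotopic.Quotient.mk p = κ := by
  refine pathClass_induction
    (P := fun {x y} κ ↦ ∃ p : Path x y, IsFlatEnded p ∧ Path.Homotopic.Quotient.mk p = κ) ?_ ?_ κ
  · rintro x y z κ μ ⟨p, hp, rfl⟩ ⟨q, hq, rfl⟩
    exact ⟨p.trans q, hp.trans hq, Path.Homotopic.Quotient.mk_trans p q⟩
  · intro b
    obtain ⟨U, hU, hb, -, h1, h2⟩ := exists_simple_nhds b Filter.univ_mem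
    refine ⟨U, hU.mem_nhds hb, fun x y γ hγ ↦ ?_⟩
    obtain ⟨p, hp, hp'⟩ := h1 x (hγ ⟨0, γ.source⟩) y (hγ ⟨1, γ.target⟩)
    exact ⟨p, hp', Path.Homotopic.Quotient.eq.2 (h2 x y p γ hp hγ)⟩

end

/-! ### Parallel transport of closed one-forms -/

section
variable {M : Type*} [TopologicalSpace M] [ChartedSpace Plane M] [IsManifold (𝓡 2) ∞ M]

/-- In a chart ball the derivative of the coordinate expression vanishes, and a ball is connected.
-/
theorem eventually_const_of_dfun_eq_zero {f : M → ℂ} {x : M}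
    (h : ∀ᶠ y in 𝓝 x, MDifferentiableAt (𝓡 2) 𝓘(ℝ, ℂ) f y ∧ dfun f y = 0) :
    ∀ᶠ y in 𝓝 x, f y = f x := by
  have hc := IsManifold.chart_mem_maximalAtlas (I := 𝓡 2) (n := ∞) x
  have hx : x ∈ (chartAt Plane x).source := mem_chart_source Plane x
  set c := chartAt Plane x
  have h2 := (c.continuousAt_symm (c.map_source hx))
  rw [ContinuousAt, c.left_inv hx] at h2
  obtain ⟨r, hr, hB⟩ := Metric.mem_nhds_iff.1
    (Filter.inter_mem (c.open_target.mem_nhds (c.map_source hx)) (h2.eventually h))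
  have hd : ∀ y ∈ Metric.ball (c x) r, HasFDerivAt (f ∘ c.symm) (0 : Plane →L[ℝ] ℂ) y := by
    intro y hy
    have h3 := coordForm_dfun hc (hB hy).1 (hB hy).2.1
    rw [coordForm, (hB hy).2.2, ContinuousLinearMap.zero_comp] at h3
    exact h3
  filter_upwards [c.open_source.mem_nhds hx,
    (c.continuousAt hx).preimage_mem_nhds (Metric.ball_mem_nhds (c x) hr)] with y hy hy'
  have := Metric.isOpen_ball.is_const_of_fderiv_eq_zero (convex_ball (c x) r).isPreconnected
    (fun z hz ↦ (hd z hz).differentiableAt.differentiableWithinAt)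
    (fun z hz ↦ (hd z hz).fderiv) hy' (Metric.mem_ball_self hr)
  simpa only [Function.comp, c.left_inv hy, c.left_inv hx] using this

theorem const_of_dfun_eq_zero [ConnectedSpace M] {f : M → ℂ}
    (hf : ∀ x, MDifferentiableAt (𝓡 2) 𝓘(ℝ, ℂ) f x) (h : ∀ x, dfun f x = 0) (x y : M) :
    f x = f y :=
  IsLocallyConstant.apply_eq_of_preconnectedSpace
    ((IsLocallyConstant.iff_eventually_eq f).2 fun _ ↦
      eventually_const_of_dfun_eq_zero (.of_forall fun y ↦ ⟨hf y, h y⟩)) x y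

/-- The smooth closed one-forms. -/
structure IsSmoothClosed (w : M → Plane →L[ℝ] ℂ) : Prop where
  smooth : ∀ x, IsSmoothFormAt w x
  closed : ∀ x, IsClosedFormAt w x

namespace IsSmoothClosed

variable {w : M → Plane →L[ℝ] ℂ}

/-- A primitive of `w` near `b`. -/
def primitive (hw : IsSmoothClosed w) (b : M) : M → ℂ :=
  (exists_primitive hw.smooth hw.closed b).choose

theorem primitive_spec (hw : IsSmoothClosed w) (b : M) :
    ∀ᶠ x in 𝓝 b, ContMDiffAt (𝓡 2) 𝓘(ℝ, ℂ) ∞ (hw.primitive b) x ∧ dfun (hw.primitive b) x = w x :=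
  (exists_primitive hw.smooth hw.closed b).choose_spec

/-- The exponentials of the primitives. -/
def frame (hw : IsSmoothClosed w) (b x : M) : ℂ := Complex.exp (hw.primitive b x)

/-- Two primitives of the same form differ by a local constant, so their exponentials have locally
constant ratio. -/
theorem isFlatFrame (hw : IsSmoothClosed w) : IsFlatFrame hw.frame where
  ne_zero b x := Complex.exp_ne_zero _
  locally_const b := by
    filter_upwards [eventually_eventually_nhds.2 (hw.primitive_spec b)] with x hx
    have hd : ∀ᶠ y in 𝓝 x, MDifferentiableAt (𝓡 2) 𝓘(ℝ, ℂ)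
        (hw.primitive b - hw.primitive x) y ∧ dfun (hw.primitive b - hw.primitive x) y = 0 := by
      filter_upwards [hx, hw.primitive_spec x] with y h1 h2
      have h := (hasMFDerivAt_dfun (h1.1.mdifferentiableAt (by simp))).sub
        (hasMFDerivAt_dfun (h2.1.mdifferentiableAt (by simp)))
      refine ⟨h.mdifferentiableAt, ?_⟩
      rw [dfun_eq_of_hasMFDerivAt h, h1.2, h2.2]
      exact sub_self _
    filter_upwards [eventually_const_of_dfun_eq_zero hd] with y hy
    have : hw.primitive b y + hw.primitive x x = hw.primitive b x + hw.primitive x y := by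
      simp only [Pi.sub_apply] at hy
      linear_combination hy
    rw [frame, frame, ← Complex.exp_add, this, Complex.exp_add]
    rfl

/-- The transport of `w` along a homotopy class of paths, that is, the exponential of the integral
of `w`. -/
def transport (hw : IsSmoothClosed w) {x y : M} (κ : Path.Homotopic.Quotient x y) : ℂ :=
  hw.isFlatFrame.monodromy κ

theorem transport_trans (hw : IsSmoothClosed w) {x y z : M} (κ : Path.Homotopic.Quotient x y)
    (μ : Path.Homotopic.Quotient y z) :
    hw.transport (κ.trans μ) = hw.transport κ * hw.transport μ :=
  hw.isFlatFrame.monodromy_trans κ μ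

theorem transport_ne_zero (hw : IsSmoothClosed w) {x y : M} (κ : Path.Homotopic.Quotient x y) :
    hw.transport κ ≠ 0 := hw.isFlatFrame.monodromy_ne_zero κ

end IsSmoothClosed

theorem hasDerivWithinAt_comp_path {a b : M} {γ : Path a b} (hγ : IsSmoothPath γ) {f : M → ℂ}
    {t : ℝ} (ht : t ∈ Set.Icc (0 : ℝ) 1)
    (hf : MDifferentiableAt (𝓡 2) 𝓘(ℝ, ℂ) f (γ.extend t)) :
    HasDerivWithinAt (fun t ↦ f (γ.extend t)) (dfun f (γ.extend t) (velocity γ t))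
      (Set.Icc 0 1) t := by
  have h1 : MDifferentiableWithinAt 𝓘(ℝ, ℝ) (𝓡 2) γ.extend (Set.Icc 0 1) t :=
    (hγ t ht).mdifferentiableWithinAt (by simp)
  have h3 := hf.hasMFDerivAt.comp_hasMFDerivWithinAt t h1.hasMFDerivWithinAt
  have h4 : HasFDerivWithinAt (𝕜 := ℝ) (f ∘ γ.extend)
      ((dfun f (γ.extend t) : Plane →L[ℝ] ℂ) ∘L
        (mfderivWithin 𝓘(ℝ, ℝ) (𝓡 2) γ.extend (Set.Icc 0 1) t : ℝ →L[ℝ] Plane))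
      (Set.Icc 0 1) t := hasMFDerivWithinAt_iff_hasFDerivWithinAt.1 h3
  exact h4.hasDerivWithinAt

/-- `Φ` solves the transport equation `Φ' = w(γ') Φ` along `γ`. -/
def SolvesTransport (w : M → Plane →L[ℝ] ℂ) {a b : M} (γ : Path a b) (Φ : ℝ → ℂ) : Prop :=
  ∀ t ∈ Set.Icc (0 : ℝ) 1,
    HasDerivWithinAt Φ (w (γ.extend t) (velocity γ t) * Φ t) (Set.Icc 0 1) t

theorem SolvesTransport.mul {w w' : M → Plane →L[ℝ] ℂ} {a b : M} {γ : Path a b} {Φ Ψ : ℝ → ℂ}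
    (hΦ : SolvesTransport w γ Φ) (hΨ : SolvesTransport w' γ Ψ) :
    SolvesTransport (w + w') γ (fun t ↦ Φ t * Ψ t) := by
  intro t ht
  refine ((hΦ t ht).mul (hΨ t ht)).congr_deriv ?_
  have : (w + w') (γ.extend t) (velocity γ t) =
    w (γ.extend t) (velocity γ t) + w' (γ.extend t) (velocity γ t) := rfl
  rw [this]
  ring

theorem SolvesTransport.conj {w w' : M → Plane →L[ℝ] ℂ} {a b : M} {γ : Path a b} {Φ : ℝ → ℂ}
    (hΦ : SolvesTransport w γ Φ) (h : ∀ x v, w' x v = (starRingEnd ℂ) (w x v)) :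
    SolvesTransport w' γ (fun t ↦ (starRingEnd ℂ) (Φ t)) := by
  intro t ht
  have h1 := (Complex.conjCLE.toContinuousLinearMap.hasFDerivAt (x := Φ t)).comp_hasDerivWithinAt t
    (hΦ t ht)
  refine h1.congr_deriv ?_
  have h2 : (w' (γ.extend t)) (velocity γ t) = (starRingEnd ℂ) (w (γ.extend t) (velocity γ t)) :=
    h _ _
  rw [h2, ← map_mul]
  rfl

theorem SolvesTransport.inv {w : M → Plane →L[ℝ] ℂ} {a b : M} {γ : Path a b} {Φ : ℝ → ℂ}
    (hΦ : SolvesTransport w γ Φ) (h : ∀ t ∈ Set.Icc (0 : ℝ) 1, Φ t ≠ 0) :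
    SolvesTransport (-w) γ (fun t ↦ (Φ t)⁻¹) := by
  intro t ht
  refine ((hΦ t ht).inv (h t ht)).congr_deriv ?_
  have h1 := h t ht
  have : (-w) (γ.extend t) (velocity γ t) = -(w (γ.extend t) (velocity γ t)) := rfl
  rw [this]
  field_simp

theorem SolvesTransport.const {a b : M} {γ : Path a b} {Φ : ℝ → ℂ}
    (hΦ : SolvesTransport 0 γ Φ) {t : ℝ} (ht : t ∈ Set.Icc (0 : ℝ) 1) : Φ t = Φ 0 := by
  have h0 : ∀ t, ((0 : M → Plane →L[ℝ] ℂ) (γ.extend t)) (velocity γ t) = 0 := fun _ ↦ rfl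
  refine constant_of_has_deriv_right_zero (a := 0) (b := 1)
    (fun t ht ↦ (hΦ t ht).continuousWithinAt) (fun t ht ↦ ?_) t ht
  have := hΦ t ⟨ht.1, ht.2.le⟩
  rw [h0, zero_mul] at this
  exact this.mono_of_mem_nhdsWithin (Icc_mem_nhdsGE_of_mem ht)

/-- A conservation law used in place of uniqueness for the transport equation: forms with sum zero
give a constant product. -/
theorem SolvesTransport.mul_const {w w' : M → Plane →L[ℝ] ℂ} {a b : M} {γ : Path a b} {Φ Ψ : ℝ → ℂ}
    (hΦ : SolvesTransport w γ Φ) (hΨ : SolvesTransport w' γ Ψ) (h : w + w' = 0)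
    {t : ℝ} (ht : t ∈ Set.Icc (0 : ℝ) 1) : Φ t * Ψ t = Φ 0 * Ψ 0 := by
  have := hΦ.mul hΨ
  rw [h] at this
  exact this.const ht

/-! ### Transport of a closed form as the solution of a differential equation, and its reality
properties -/

namespace IsSmoothClosed
variable {w : M → Plane →L[ℝ] ℂ}

/-- Near each time the monodromy function is a constant times `exp f`, with `f` a primitive of `w`,
and the chain rule gives the equation. This links the topological and analytic sides. -/
theorem exists_solvesTransport (hw : IsSmoothClosed w) {x y : M} {γ : Path x y}
    (hγ : IsSmoothPath γ) : ∃ Φ : ℝ → ℂ, SolvesTransport w γ Φ ∧ Φ 0 = 1 ∧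
      Φ 1 = hw.transport (Path.Homotopic.Quotient.mk γ) ∧ ∀ t ∈ Set.Icc (0 : ℝ) 1, Φ t ≠ 0 := by
  obtain ⟨Φ, h1, h2, h3⟩ := hw.isFlatFrame.exists_isTransport γ
  refine ⟨Φ, fun t ht ↦ ?_, h2, h3, fun t ht ↦
    (h1.div_const hw.isFlatFrame h1 (by rw [h2]; exact one_ne_zero) ht).1⟩
  set b := γ.extend t with hb
  have h4 := (hw.primitive_spec b).self_of_nhds
  have h5 := hasDerivWithinAt_comp_path hγ ht (h4.1.mdifferentiableAt (by simp))
  rw [← hb, h4.2] at h5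
  have h6 := (h5.cexp.const_mul (Φ t)).div_const (hw.frame b b)
  have hne : hw.frame b b ≠ 0 := hw.isFlatFrame.ne_zero b b
  have h7 : Φ =ᶠ[𝓝[Set.Icc 0 1] t] fun t' ↦
      Φ t * Complex.exp (hw.primitive b (γ.extend t')) / hw.frame b b := by
    filter_upwards [h1 t ht] with t' ht'
    rw [eq_div_iff hne, ht']
    rfl
  refine (h6.congr_of_eventuallyEq h7 (h7.self_of_nhdsWithin ht)).congr_deriv ?_
  rw [div_eq_iff hne]
  have : Complex.exp (hw.primitive b (γ.extend t)) = hw.frame b b := rfl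
  rw [this]
  ring

/-- Here `Φ̄` solves the equation of `w̄ = -w`, so `Φ Φ̄ = |Φ|²` is conserved. -/
theorem norm_transport (hw : IsSmoothClosed w)
    (h : ∀ x v, (starRingEnd ℂ) (w x v) = -(w x v)) {x y : M} (κ : Path.Homotopic.Quotient x y) :
    ‖hw.transport κ‖ = 1 := by
  obtain ⟨γ, hγ, rfl⟩ := exists_isFlatEnded κ
  obtain ⟨Φ, h1, h2, h3, -⟩ := hw.exists_solvesTransport hγ.isSmoothPath
  have h4 := h1.mul_const (h1.conj (w' := -w) fun x v ↦ (h x v).symm) (add_neg_cancel w)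
    (t := 1) ⟨zero_le_one, le_rfl⟩
  rw [h2, h3, map_one, mul_one, Complex.mul_conj, Complex.normSq_eq_norm_sq] at h4
  have h5 : ‖hw.transport (Path.Homotopic.Quotient.mk γ)‖ ^ 2 = 1 := by exact_mod_cast h4
  exact (pow_eq_one_iff_of_nonneg (norm_nonneg _) (by norm_num)).1 h5

/-- If `u s̄` is a real structure preserved by `d + w` then the transport around a loop is real. -/
theorem conj_transport (hw : IsSmoothClosed w) {u : M → ℂ}
    (hu : ∀ x, MDifferentiableAt (𝓡 2) 𝓘(ℝ, ℂ) u x)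
    (h : ∀ x v, dfun u x v + u x * w x v = u x * (starRingEnd ℂ) (w x v)) {x y : M}
    (κ : Path.Homotopic.Quotient x y) :
    hw.transport κ * u y = u x * (starRingEnd ℂ) (hw.transport κ) := by
  obtain ⟨γ, hγ, rfl⟩ := exists_isFlatEnded κ
  obtain ⟨Φ, h1, h2, h3, h4⟩ := hw.exists_solvesTransport hγ.isSmoothPath
  -- The derivative of `u / Φ̄` along `γ` is `(du - u w̄) / Φ̄`, which the hypothesis turns into `-w
  -- u / Φ̄`. Hence `Φ u / Φ̄` is conserved.
  have h5 : SolvesTransport (-w) γ (fun t ↦ u (γ.extend t) * ((starRingEnd ℂ) (Φ t))⁻¹) := by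
    intro t ht
    have h6 := ((h1.inv h4).conj (w' := fun x ↦ Complex.conjCLE.toContinuousLinearMap ∘L (-w) x)
      (fun _ _ ↦ rfl)) t ht
    have h7 := (hasDerivWithinAt_comp_path hγ.isSmoothPath ht (hu _)).mul h6
    simp only [map_inv₀] at h7
    refine h7.congr_deriv ?_
    have h8 := h (γ.extend t) (velocity γ t)
    have h9 : ((Complex.conjCLE.toContinuousLinearMap ∘L (-w) (γ.extend t)) : Plane →L[ℝ] ℂ)
        (velocity γ t) = -(starRingEnd ℂ) (w (γ.extend t) (velocity γ t)) :=
      map_neg (starRingEnd ℂ) _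
    have h10 : (-w) (γ.extend t) (velocity γ t) = -(w (γ.extend t) (velocity γ t)) := rfl
    rw [h9, h10]
    linear_combination ((starRingEnd ℂ) (Φ t))⁻¹ * h8
  have h6 := h1.mul_const h5 (add_neg_cancel w) (t := 1) ⟨zero_le_one, le_rfl⟩
  rw [h2, h3] at h6
  simp only [Path.extend_one, Path.extend_zero, map_one, inv_one, mul_one, one_mul] at h6
  have h7 : (starRingEnd ℂ) (hw.transport (Path.Homotopic.Quotient.mk γ)) ≠ 0 := by
    simpa using hw.transport_ne_zero _
  field_simp at h6
  linear_combination h6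

/-- The conserved quantity `Φ / Φ̄ = 1` keeps `Φ` real; being nonzero with start value `1`, it stays
positive by the intermediate value theorem. -/
theorem transport_pos (hw : IsSmoothClosed w)
    (h : ∀ x v, (starRingEnd ℂ) (w x v) = w x v) {x y : M} (κ : Path.Homotopic.Quotient x y) :
    ∃ r : ℝ, 0 < r ∧ hw.transport κ = r := by
  obtain ⟨γ, hγ, rfl⟩ := exists_isFlatEnded κ
  obtain ⟨Φ, h1, h2, h3, h4⟩ := hw.exists_solvesTransport hγ.isSmoothPath
  have h5 := (h1.inv h4).conj (w' := -w) fun x v ↦ by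
    rw [Pi.neg_apply, _root_.neg_apply, map_neg, h]
  have him : ∀ t ∈ Set.Icc (0 : ℝ) 1, ((Φ t).re : ℂ) = Φ t := by
    intro t ht
    have h6 := h1.mul_const h5 (add_neg_cancel w) ht
    have h7 : (starRingEnd ℂ) (Φ t) ≠ 0 := by simpa using h4 t ht
    rw [h2, map_inv₀, inv_one, map_one, one_mul, mul_inv_eq_one₀ h7] at h6
    exact Complex.conj_eq_iff_re.1 h6.symm
  have hc : ContinuousOn (fun t ↦ (Φ t).re) (Set.Icc 0 1) :=
    Complex.continuous_re.comp_continuousOn fun t ht ↦ (h1 t ht).continuousWithinAt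
  refine ⟨(Φ 1).re, ?_, ?_⟩
  · by_contra hneg
    obtain ⟨t, ht, h0⟩ := intermediate_value_Icc' zero_le_one hc (show (0 : ℝ) ∈ _ from
      ⟨not_lt.1 hneg, by rw [h2]; simp⟩)
    apply h4 t ht
    have h0' : (Φ t).re = 0 := h0
    rw [← him t ht, h0', Complex.ofReal_zero]
  · rw [him 1 ⟨zero_le_one, le_rfl⟩, h3]

end IsSmoothClosed
end

/-! ### The holonomy representation -/

section
variable {M : Type*} [TopologicalSpace M] [ChartedSpace Plane M] [IsManifold (𝓡 2) ∞ M]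

namespace IsSmoothClosed
variable {w : M → Plane →L[ℝ] ℂ}

/-- The transport around loops as a homomorphism. -/
def transportHom (hw : IsSmoothClosed w) (x₀ : M) : FundamentalGroup M x₀ →* ℂˣ :=
  MonoidHom.mk' (fun κ ↦ Units.mk0 (hw.transport (FundamentalGroup.toPath κ))
    (hw.transport_ne_zero _)) fun κ μ ↦ by
      apply Units.ext
      -- Multiplication in the fundamental group reverses concatenation; commutativity of `ℂ`
      -- absorbs this.
      change hw.transport ((FundamentalGroup.toPath μ).trans (FundamentalGroup.toPath κ)) = _
      rw [hw.transport_trans, mul_comm]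
      rfl

theorem transportHom_apply (hw : IsSmoothClosed w) {x₀ : M} (κ : Path.Homotopic.Quotient x₀ x₀) :
    ((hw.transportHom x₀ (FundamentalGroup.fromPath κ) : ℂˣ) : ℂ) = hw.transport κ := rfl

end IsSmoothClosed

/-! ### Connection forms for the structure groups; existence and uniqueness of holonomy -/

namespace Connection

theorem IsFlat.isSmoothClosed {D : Connection M} (hD : D.IsFlat) : IsSmoothClosed D.form.field :=
  ⟨D.form.isSmoothFormAt, (isFlat_iff D).1 hD⟩

theorem isFlat_ofForm {η : OneForm M} (h : IsSmoothClosed η.field) : (ofForm η).IsFlat := by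
  rw [isFlat_iff, ofForm_form_field]
  exact h.closed

theorem IsUnitary.conj_form {D : Connection M} (hD : D.IsUnitary) (x : M) (v : Plane) :
    (starRingEnd ℂ) (D.form.field x v) = -D.form.field x v := by
  have h := hD 1 1 x v
  have h1 : (1 : SmoothFun M) * conjFun 1 = 1 := by
    ext y
    change (1 : ℂ) * (starRingEnd ℂ) 1 = 1
    simp
  have h2 : diff (1 : SmoothFun M) x v = 0 := by
    have : dfun (fun _ : M ↦ (1 : ℂ)) x = 0 := dfun_const 1 x
    exact congrArg (fun L : Plane →L[ℝ] ℂ ↦ L v) this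
  have h3 : (1 : SmoothFun M) x = 1 := rfl
  rw [h1, h2, h3, map_one, mul_one, one_mul] at h
  exact (neg_eq_of_add_eq_zero_right h.symm).symm

theorem isUnitary_of_conj_form {D : Connection M}
    (h : ∀ x v, (starRingEnd ℂ) (D.form.field x v) = -D.form.field x v) : D.IsUnitary := by
  intro s t x v
  have hs : MDifferentiableAt (𝓡 2) 𝓘(ℝ, ℂ) s x := (s.contMDiff x).mdifferentiableAt (by simp)
  have ht : MDifferentiableAt (𝓡 2) 𝓘(ℝ, ℂ) t x := (t.contMDiff x).mdifferentiableAt (by simp)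
  have ht' : MDifferentiableAt (𝓡 2) 𝓘(ℝ, ℂ) (conjFun t) x :=
    ((conjFun t).contMDiff x).mdifferentiableAt (by simp)
  have key : ∀ v : Plane, dfun (⇑s * ⇑(conjFun t)) x v =
      (D.toFun s).field x v * (starRingEnd ℂ) (t x) +
        s x * (starRingEnd ℂ) ((D.toFun t).field x v) := by
    intro v
    have h1 : dfun (conjFun t) x v = (starRingEnd ℂ) (dfun t x v) := dfun_conj ht v
    rw [dfun_mul hs ht', D.toFun_apply, D.toFun_apply, _root_.map_add, _root_.map_mul, h]
    simp only [_root_.add_apply, _root_.smul_apply, smul_eq_mul, h1, conjFun_apply]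
    ring
  exact key v

/-- Testing on `s = 1` suffices, since both sides of the commutation condition obey the same Leibniz
rule. -/
theorem preservesRealStructure_iff {D : Connection M} {u : SmoothFun M} :
    D.PreservesRealStructure u ↔ ∀ x v, dfun u x v + u x * D.form.field x v =
      u x * (starRingEnd ℂ) (D.form.field x v) := by
  constructor
  · intro h x v
    have h1 := h 1 x v
    have h2 : u * conjFun 1 = u := by
      ext y
      change u y * (starRingEnd ℂ) 1 = u y
      simp
    rw [h2] at h1
    rw [← D.toFun_apply]
    exact h1
  · intro h s x v
    have hs : MDifferentiableAt (𝓡 2) 𝓘(ℝ, ℂ) s x := (s.contMDiff x).mdifferentiableAt (by simp)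
    have hu : MDifferentiableAt (𝓡 2) 𝓘(ℝ, ℂ) u x := (u.contMDiff x).mdifferentiableAt (by simp)
    have hs' : MDifferentiableAt (𝓡 2) 𝓘(ℝ, ℂ) (conjFun s) x :=
      ((conjFun s).contMDiff x).mdifferentiableAt (by simp)
    have key : ∀ v : Plane, (D.toFun (u * conjFun s)).field x v =
        u x * (starRingEnd ℂ) ((D.toFun s).field x v) := by
      intro v
      have h1 : dfun (conjFun s) x v = (starRingEnd ℂ) (dfun s x v) := dfun_conj hs v
      have h2 : dfun (u * conjFun s) x = _ := dfun_mul hu hs'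
      have h3 : (u * conjFun s) x = u x * (starRingEnd ℂ) (s x) := rfl
      rw [D.toFun_apply, D.toFun_apply, h2, h3, _root_.map_add, _root_.map_mul]
      simp only [_root_.add_apply, _root_.smul_apply, smul_eq_mul, h1, conjFun_apply]
      linear_combination (starRingEnd ℂ) (s x) * h x v
    exact key v

theorem preservesRealStructure_one_iff {D : Connection M} :
    D.PreservesRealStructure 1 ↔ ∀ x v, (starRingEnd ℂ) (D.form.field x v) = D.form.field x v := by
  rw [preservesRealStructure_iff]
  have h1 : ∀ x v, dfun (1 : SmoothFun M) x v = 0 := fun x v ↦ by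
    have : dfun (fun _ : M ↦ (1 : ℂ)) x = 0 := dfun_const 1 x
    exact congrArg (fun L : Plane →L[ℝ] ℂ ↦ L v) this
  have h2 : ∀ x, (1 : SmoothFun M) x = 1 := fun _ ↦ rfl
  refine forall_congr' fun x ↦ forall_congr' fun v ↦ ?_
  rw [h1, h2, zero_add, one_mul, one_mul, eq_comm]

theorem transportHom_mem {D : Connection M} (hD : D.IsFlat) {𝔾 : StructureGroup} {x₀ : M}
    (h : 𝔾.IsCompatible x₀ D) (κ : FundamentalGroup M x₀) :
    hD.isSmoothClosed.transportHom x₀ κ ∈ 𝔾.toSubgroup := by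
  set w := hD.isSmoothClosed
  have hv : ((w.transportHom x₀ κ : ℂˣ) : ℂ) = w.transport (FundamentalGroup.toPath κ) := rfl
  cases 𝔾 with
  | complex => trivial
  | unitary =>
    change ‖((w.transportHom x₀ κ : ℂˣ) : ℂ)‖ = 1
    rw [hv]
    exact w.norm_transport (IsUnitary.conj_form h) _
  | positive =>
    change ∃ r : ℝ, 0 < r ∧ ((w.transportHom x₀ κ : ℂˣ) : ℂ) = r
    rw [hv]
    exact w.transport_pos (preservesRealStructure_one_iff.1 h) _
  | real =>
    obtain ⟨u, -, hu1, hu⟩ := h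
    change ∃ r : ℝ, ((w.transportHom x₀ κ : ℂˣ) : ℂ) = r
    have h1 := w.conj_transport (fun x ↦ (u.contMDiff x).mdifferentiableAt (by simp))
      (preservesRealStructure_iff.1 hu) (FundamentalGroup.toPath κ)
    rw [hu1, mul_one, one_mul] at h1
    rw [hv]
    exact ⟨_, (Complex.conj_eq_iff_re.1 h1.symm).symm⟩

/-- The inverse appears because parallel sections solve `f' = -η(γ') f` while transport solves `Φ' =
η(γ') Φ`, so `Φ f` is conserved. Smooth representatives of every class make the formula determine
`ρ` completely. -/
theorem isHolonomy_iff {D : Connection M} (hD : D.IsFlat) {x₀ : M} {G : Subgroup ℂˣ}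
    (ρ : FundamentalGroup M x₀ →* G) :
    D.IsHolonomy ρ ↔ ∀ κ, (ρ κ : ℂˣ) = (hD.isSmoothClosed.transportHom x₀ κ)⁻¹ := by
  constructor
  · intro h κ
    obtain ⟨γ, hγ, hγκ⟩ := exists_isFlatEnded (FundamentalGroup.toPath κ)
    obtain ⟨Φ, h1, h2, h3, h4⟩ := hD.isSmoothClosed.exists_solvesTransport hγ.isSmoothPath
    have h5 := h γ hγ.isSmoothPath _ fun t ht ↦ by
      have := h1.inv h4 t ht
      refine this.congr_deriv ?_
      exact neg_mul _ _
    rw [hγκ, h2, h3, hγκ, inv_one, mul_one] at h5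
    apply Units.ext
    rw [Units.val_inv_eq_inv_val]
    exact h5.symm
  · intro h γ hγ f hf
    obtain ⟨Φ, h1, h2, h3, h4⟩ := hD.isSmoothClosed.exists_solvesTransport hγ
    have h5 : SolvesTransport (-D.form.field) γ f := fun t ht ↦
      (hf t ht).congr_deriv (neg_mul _ _).symm
    have h6 := h1.mul_const h5 (add_neg_cancel _) (t := 1) ⟨zero_le_one, le_rfl⟩
    have h7 := hD.isSmoothClosed.transport_ne_zero (Path.Homotopic.Quotient.mk γ)
    rw [h2, h3, one_mul] at h6
    rw [h, Units.val_inv_eq_inv_val, IsSmoothClosed.transportHom_apply, ← h6]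
    field_simp

theorem exists_isHolonomy {D : Connection M} (hD : D.IsFlat) {𝔾 : StructureGroup} {x₀ : M}
    (h : 𝔾.IsCompatible x₀ D) : ∃ ρ : FundamentalGroup M x₀ →* 𝔾.toSubgroup, D.IsHolonomy ρ :=
  ⟨((hD.isSmoothClosed.transportHom x₀)⁻¹).codRestrict 𝔾.toSubgroup fun κ ↦
    inv_mem (transportHom_mem hD h κ), (isHolonomy_iff hD _).2 fun _ ↦ rfl⟩

theorem isHolonomy_holonomy {D : Connection M} (hD : D.IsFlat) {𝔾 : StructureGroup} {x₀ : M}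
    (h : 𝔾.IsCompatible x₀ D) : D.IsHolonomy (D.holonomy x₀ 𝔾.toSubgroup) := by
  have h1 := exists_isHolonomy hD h
  rw [holonomy, dif_pos h1]
  exact h1.choose_spec

theorem isHolonomy_iff_eq_holonomy {D : Connection M} (hD : D.IsFlat) {𝔾 : StructureGroup} {x₀ : M}
    (h : 𝔾.IsCompatible x₀ D) (ρ : FundamentalGroup M x₀ →* 𝔾.toSubgroup) :
    D.IsHolonomy ρ ↔ ρ = D.holonomy x₀ 𝔾.toSubgroup := by
  constructor
  · intro hρ
    ext κ
    rw [(isHolonomy_iff hD _).1 hρ, (isHolonomy_iff hD _).1 (isHolonomy_holonomy hD h)]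
  · rintro rfl
    exact isHolonomy_holonomy hD h

end Connection

/-! ### The holonomy functor is fully faithful -/

/-- A nowhere vanishing smooth function as a gauge transformation. -/
def mkGauge (f : M → ℂ) (hf : ContMDiff (𝓡 2) 𝓘(ℝ, ℂ) ∞ f) (h0 : ∀ x, f x ≠ 0) : Gauge M :=
  ⟨fun x ↦ Units.mk0 (f x) (h0 x),
    ContMDiff.of_comp_isOpenEmbedding Units.isOpenEmbedding_val hf⟩

theorem Connection.smul_form_field (g : Gauge M) (D : Connection M) (x : M) :
    (g • D).form.field x = D.form.field x + (g x : ℂ)⁻¹ • dfun g.toSmooth x :=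
  ContinuousLinearMap.ext fun v ↦ Connection.smul_form g D x v

theorem Gauge.eq_of_smul_eq [ConnectedSpace M] {g h : Gauge M} {D : Connection M} {x₀ : M}
    (hD : g • D = h • D) (h0 : g x₀ = h x₀) : g = h := by
  -- The quotient `k` stabilizes `D`, so `k⁻¹ dk = 0`: it is constant, with value `1` at `x₀`.
  have h1 : (h⁻¹ * g) • D = D := by rw [mul_smul, hD, inv_smul_smul]
  set k := h⁻¹ * g with hk
  have h2 : ∀ x, dfun k.toSmooth x = 0 := by
    intro x
    have h3 := Connection.smul_form_field k D x
    rw [h1, left_eq_add] at h3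
    refine ContinuousLinearMap.ext fun v ↦ ?_
    exact (mul_eq_zero.1 (congrArg (fun L : Plane →L[ℝ] ℂ ↦ L v) h3)).resolve_left
      (inv_ne_zero (k x).ne_zero)
  have h4 : ∀ x, k x = 1 := by
    intro x
    have h5 := const_of_dfun_eq_zero
      (fun x ↦ (k.toSmooth.contMDiff x).mdifferentiableAt (by simp)) h2 x x₀
    have h6 : k x₀ = 1 := by
      change (h x₀)⁻¹ * g x₀ = 1
      rw [h0, inv_mul_cancel]
    apply Units.ext
    rw [← h6]
    exact h5
  have h7 : k = 1 := by
    ext x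
    rw [h4]
    rfl
  rwa [hk, inv_mul_eq_one, eq_comm] at h7

end

/-! ### Sections of flat line bundles -/

section
variable {M : Type*} [TopologicalSpace M] [ChartedSpace Plane M] [IsManifold (𝓡 2) ∞ M]
variable {e : M → M → ℂ} {s : M → ℂ}

/-- The section with coefficient function `s` is smooth and does not vanish at `x`. -/
structure IsSectionAt (e : M → M → ℂ) (s : M → ℂ) (x : M) : Prop where
  ne_zero : s x ≠ 0
  smooth : ContMDiffAt (𝓡 2) 𝓘(ℝ, ℂ) ∞ (fun y ↦ e x y * s y) x

/-- The logarithmic derivative of a section. -/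
def sectionForm (e : M → M → ℂ) (s : M → ℂ) (x : M) : Plane →L[ℝ] ℂ :=
  (e x x * s x)⁻¹ • dfun (fun y ↦ e x y * s y) x

theorem dfun_const_mul {f : M → ℂ} {x : M} (hf : MDifferentiableAt (𝓡 2) 𝓘(ℝ, ℂ) f x) (a : ℂ) :
    dfun (fun y ↦ a * f y) x = a • dfun f x := by
  have h := dfun_comp_of_hasDerivAt (F := fun z ↦ a * z) (a := a)
    (by simpa using (hasDerivAt_id (f x)).const_mul a) hf
  exact h

theorem contMDiffAt_const_mul {f : M → ℂ} {x : M} (hf : ContMDiffAt (𝓡 2) 𝓘(ℝ, ℂ) ∞ f x) (a : ℂ) :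
    ContMDiffAt (𝓡 2) 𝓘(ℝ, ℂ) ∞ (fun y ↦ a * f y) x :=
  ContMDiffAt.mul contMDiffAt_const hf

theorem contMDiffAt_mul' {f g : M → ℂ} {x : M} (hf : ContMDiffAt (𝓡 2) 𝓘(ℝ, ℂ) ∞ f x)
    (hg : ContMDiffAt (𝓡 2) 𝓘(ℝ, ℂ) ∞ g x) :
    ContMDiffAt (𝓡 2) 𝓘(ℝ, ℂ) ∞ (fun y ↦ f y * g y) x := ContMDiffAt.mul hf hg

theorem contMDiffAt_comp' {f : M → ℂ} {F : ℂ → ℂ} {x : M} (hF : ContDiffAt ℝ ∞ F (f x))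
    (hf : ContMDiffAt (𝓡 2) 𝓘(ℝ, ℂ) ∞ f x) :
    ContMDiffAt (𝓡 2) 𝓘(ℝ, ℂ) ∞ (fun y ↦ F (f y)) x :=
  ContMDiffAt.comp x (contMDiffAt_iff_contDiffAt.2 hF) hf

theorem IsFlatFrame.eventually_eq_mul (he : IsFlatFrame e) (s : M → ℂ) {b x : M}
    (hx : x ∈ IsFlatFrame.domain e b) :
    (fun y ↦ e b y * s y) =ᶠ[𝓝 x] fun y ↦ (e b x / e x x) * (e x y * s y) := by
  filter_upwards [IsFlatFrame.eventually_of_mem_domain hx] with y hy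
  have := he.ne_zero x x
  field_simp
  linear_combination s y * hy

theorem IsSectionAt.contMDiffAt (h : IsSectionAt e s x) (he : IsFlatFrame e) {b : M}
    (hx : x ∈ IsFlatFrame.domain e b) :
    ContMDiffAt (𝓡 2) 𝓘(ℝ, ℂ) ∞ (fun y ↦ e b y * s y) x :=
  (contMDiffAt_const_mul h.smooth _).congr_of_eventuallyEq (he.eventually_eq_mul s hx)

theorem isSectionAt_of_contMDiffAt (he : IsFlatFrame e) {b x : M}
    (hx : x ∈ IsFlatFrame.domain e b) (h0 : s x ≠ 0)
    (h : ContMDiffAt (𝓡 2) 𝓘(ℝ, ℂ) ∞ (fun y ↦ e b y * s y) x) : IsSectionAt e s x := by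
  refine ⟨h0, (contMDiffAt_const_mul h (e x x / e b x)).congr_of_eventuallyEq ?_⟩
  filter_upwards [IsFlatFrame.eventually_of_mem_domain hx] with y hy
  have := he.ne_zero b x
  field_simp
  linear_combination -s y * hy

/-- Another flat frame changes the coordinate of the section by a local constant, which the
logarithmic derivative does not see. -/
theorem IsSectionAt.sectionForm_eq (h : IsSectionAt e s x) (he : IsFlatFrame e) {b : M}
    (hx : x ∈ IsFlatFrame.domain e b) :
    sectionForm e s x = (e b x * s x)⁻¹ • dfun (fun y ↦ e b y * s y) x := by
  rw [dfun_congr (he.eventually_eq_mul s hx),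
    dfun_const_mul (h.smooth.mdifferentiableAt (by simp)), sectionForm]
  have h1 := he.ne_zero x x
  have h2 := he.ne_zero b x
  have h3 := h.ne_zero
  refine ContinuousLinearMap.ext fun v ↦ ?_
  simp only [_root_.smul_apply, smul_eq_mul]
  field_simp

theorem sectionForm_eventuallyEq (he : IsFlatFrame e) {x : M}
    (h : ∀ᶠ y in 𝓝 x, IsSectionAt e s y) :
    sectionForm e s =ᶠ[𝓝 x] fun y ↦ (e x y * s y)⁻¹ • dfun (fun y ↦ e x y * s y) y := by
  filter_upwards [h, he.domain_mem_nhds x] with y hy hy'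
  exact hy.sectionForm_eq he hy'

/-- The differential of a logarithm. -/
theorem exists_log {f : M → ℂ} {x : M} (hf : ∀ᶠ y in 𝓝 x, ContMDiffAt (𝓡 2) 𝓘(ℝ, ℂ) ∞ f y)
    (h0 : f x ≠ 0) : ∃ g : M → ℂ, ∀ᶠ y in 𝓝 x, f y ≠ 0 ∧ ContMDiffAt (𝓡 2) 𝓘(ℝ, ℂ) ∞ g y ∧
      dfun g y = (f y)⁻¹ • dfun f y ∧ f y = f x * Complex.exp (g y) := by
  refine ⟨fun y ↦ Complex.log ((f x)⁻¹ * f y), ?_⟩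
  have hc : ContinuousAt (fun y ↦ (f x)⁻¹ * f y) x :=
    continuousAt_const.mul hf.self_of_nhds.continuousAt
  have h1 : ∀ᶠ y in 𝓝 x, (f x)⁻¹ * f y ∈ Complex.slitPlane :=
    hc.eventually (Complex.isOpen_slitPlane.mem_nhds (by
      simpa only [inv_mul_cancel₀ h0] using Complex.one_mem_slitPlane))
  filter_upwards [h1, hf] with y hy hfy
  have h2 : f y ≠ 0 := fun h ↦ Complex.slitPlane_ne_zero hy (by rw [h, mul_zero])
  have h3 := contMDiffAt_const_mul hfy (f x)⁻¹
  refine ⟨h2, contMDiffAt_comp' (F := Complex.log)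
    ((Complex.contDiffAt_log hy).restrict_scalars ℝ) h3, ?_, ?_⟩
  · have h4 := dfun_comp_of_hasDerivAt (f := fun y ↦ (f x)⁻¹ * f y) (F := Complex.log)
      (Complex.hasDerivAt_log hy)
      (h3.mdifferentiableAt (by simp))
    refine h4.trans ?_
    rw [dfun_const_mul (hfy.mdifferentiableAt (by simp))]
    refine ContinuousLinearMap.ext fun v ↦ ?_
    simp only [_root_.smul_apply, smul_eq_mul]
    field_simp
  · rw [Complex.exp_log (Complex.slitPlane_ne_zero hy)]
    field_simp

theorem isSmoothFormAt_sectionForm (he : IsFlatFrame e) {x : M}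
    (h : ∀ᶠ y in 𝓝 x, IsSectionAt e s y) : IsSmoothFormAt (sectionForm e s) x := by
  refine IsSmoothFormAt.congr ?_ (sectionForm_eventuallyEq he h)
  have h1 := h.self_of_nhds
  refine IsSmoothFormAt.smul (f := fun y ↦ (e x y * s y)⁻¹) ?_ (isSmoothFormAt_dfun h1.smooth)
  exact contMDiffAt_comp' (F := fun z ↦ z⁻¹)
    ((contDiffAt_inv ℂ (mul_ne_zero (he.ne_zero x x) h1.ne_zero)).restrict_scalars ℝ) h1.smooth

/-- The local logarithm of the section in a fixed flat frame is a primitive; hence the form is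
closed. -/
theorem exists_log_sectionForm (he : IsFlatFrame e) {x : M}
    (h : ∀ᶠ y in 𝓝 x, IsSectionAt e s y) : ∃ g : M → ℂ, ∀ᶠ y in 𝓝 x,
      ContMDiffAt (𝓡 2) 𝓘(ℝ, ℂ) ∞ g y ∧ dfun g y = sectionForm e s y := by
  have h1 := h.self_of_nhds
  have h2 : ∀ᶠ y in 𝓝 x, ContMDiffAt (𝓡 2) 𝓘(ℝ, ℂ) ∞ (fun y ↦ e x y * s y) y := by
    filter_upwards [h, he.domain_mem_nhds x] with y hy hy'
    exact hy.contMDiffAt he hy'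
  obtain ⟨g, hg⟩ := exists_log h2 (mul_ne_zero (he.ne_zero x x) h1.ne_zero)
  refine ⟨g, ?_⟩
  filter_upwards [hg, sectionForm_eventuallyEq he h] with y hy hy'
  exact ⟨hy.2.1, by rw [hy.2.2.1, hy']⟩

end

section
variable {M : Type*} [TopologicalSpace M] [ChartedSpace Plane M] [IsManifold (𝓡 2) ∞ M]

/-! ### Fullness of the holonomy functor -/

theorem pathConnectedSpace_of_connected (M : Type*) [TopologicalSpace M] [ChartedSpace Plane M]
    [ConnectedSpace M] : PathConnectedSpace M := by
  have : LocallyPathConnectedSpace M := ChartedSpace.locallyPathConnectedSpace Plane M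
  exact pathConnectedSpace_iff_connectedSpace.2 inferInstance

namespace IsSmoothClosed
variable {w : M → Plane →L[ℝ] ℂ}

theorem transport_eq_of_loops (hw : IsSmoothClosed w) {x₀ : M}
    (h : ∀ κ : Path.Homotopic.Quotient x₀ x₀, hw.transport κ = 1) {x : M}
    (κ μ : Path.Homotopic.Quotient x₀ x) : hw.transport κ = hw.transport μ := by
  have h1 := h (κ.trans μ.symm)
  have h2 := h (μ.trans μ.symm)
  rw [hw.transport_trans] at h1 h2
  exact mul_right_cancel₀ (hw.transport_ne_zero _) (h1.trans h2.symm)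

/-- The function is transport from `x₀` along any path, that is, `exp ∫ w`. The last clause is kept
because it places the values of `g` in the structure group. -/
theorem exists_potential [ConnectedSpace M] (hw : IsSmoothClosed w) {x₀ : M}
    (h : ∀ κ : Path.Homotopic.Quotient x₀ x₀, hw.transport κ = 1) :
    ∃ g : M → ℂ, ContMDiff (𝓡 2) 𝓘(ℝ, ℂ) ∞ g ∧ (∀ x, dfun g x = g x • w x) ∧ g x₀ = 1 ∧
      ∀ x, ∃ κ : Path.Homotopic.Quotient x₀ x, g x = hw.transport κ := by
  have := pathConnectedSpace_of_connected M
  set κ : ∀ x, Path.Homotopic.Quotient x₀ x := fun x ↦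
    Path.Homotopic.Quotient.mk (PathConnectedSpace.somePath x₀ x)
  set g : M → ℂ := fun x ↦ hw.transport (κ x) with hg
  have key : ∀ b, ∀ᶠ x in 𝓝 b, g x = g b / hw.frame b b * hw.frame b x := by
    intro b
    -- Passing to `b` and then along a short path shows that near `b` the function is a constant
    -- multiple of the local frame.
    obtain ⟨U, hU, hb, hUW, h1, -⟩ := exists_simple_nhds b (hw.isFlatFrame.domain_mem_nhds b)
    filter_upwards [hU.mem_nhds hb] with x hx
    obtain ⟨p, hp, -⟩ := h1 b hb x hx
    have h2 := hw.isFlatFrame.monodromy_eq_of_range_subset p (hp.trans hUW)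
    have h3 := hw.transport_eq_of_loops h (κ x) ((κ b).trans (Path.Homotopic.Quotient.mk p))
    rw [hw.transport_trans, transport, transport, transport, h2] at h3
    rw [hg]
    simp only [transport]
    rw [h3]
    ring
  have hs : ∀ b, ContMDiffAt (𝓡 2) 𝓘(ℝ, ℂ) ∞ (hw.frame b) b := fun b ↦
    contMDiffAt_comp' (F := Complex.exp) Complex.contDiff_exp.contDiffAt
      (hw.primitive_spec b).self_of_nhds.1
  refine ⟨g, fun b ↦ (contMDiffAt_const_mul (hs b) _).congr_of_eventuallyEq (key b), fun b ↦ ?_,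
    h _, fun x ↦ ⟨κ x, rfl⟩⟩
  have h4 := (hw.primitive_spec b).self_of_nhds
  have h5 : dfun (hw.frame b) b = _ := dfun_comp_of_hasDerivAt (Complex.hasDerivAt_exp _)
    (h4.1.mdifferentiableAt (by simp))
  rw [dfun_congr (key b), dfun_const_mul ((hs b).mdifferentiableAt (by simp)), h5, h4.2]
  refine ContinuousLinearMap.ext fun v ↦ ?_
  have h6 : Complex.exp (hw.primitive b b) = hw.frame b b := rfl
  have h7 := hw.isFlatFrame.ne_zero b b
  simp only [_root_.smul_apply, smul_eq_mul, h6]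
  field_simp

end IsSmoothClosed

theorem IsSmoothClosed.sub {α β : OneForm M} (hα : IsSmoothClosed α.field)
    (hβ : IsSmoothClosed β.field) : IsSmoothClosed (β - α).field := by
  refine ⟨(β - α).isSmoothFormAt, fun x ↦ ((β - α).extDer_eq_zero_iff x).1 fun u v ↦ ?_⟩
  have h1 : (β - α + α).extDer x u v = _ := OneForm.extDer_add (β - α) α x u v
  rw [sub_add_cancel, (α.extDer_eq_zero_iff x).2 (hα.closed x),
    (β.extDer_eq_zero_iff x).2 (hβ.closed x), add_zero] at h1
  exact h1.symm

/-- The gauge transformation is `c · exp ∫ (η₂ - η₁)`. For `U(1)` and `ℝ^+` the difference form is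
imaginary or real, so all values lie in the group; for `ℝ^*` only the value `c` at `x₀` matters. -/
theorem Connection.exists_gauge [ConnectedSpace M] {𝔾 : StructureGroup} {x₀ : M}
    {D₁ D₂ : Connection M} (hD₁ : D₁.IsFlat) (hD₂ : D₂.IsFlat) (h₁ : 𝔾.IsCompatible x₀ D₁)
    (h₂ : 𝔾.IsCompatible x₀ D₂)
    (hhol : D₁.holonomy x₀ 𝔾.toSubgroup = D₂.holonomy x₀ 𝔾.toSubgroup) (c : 𝔾.toSubgroup) :
    ∃ g ∈ 𝔾.gauge x₀, g x₀ = c ∧ g • D₁ = D₂ := by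
  have w₁ := hD₁.isSmoothClosed
  have w₂ := hD₂.isSmoothClosed
  have w := w₁.sub w₂
  have htriv : ∀ κ : Path.Homotopic.Quotient x₀ x₀, w.transport κ = 1 := by
    intro κ
    have hκ : w₁.transport κ = w₂.transport κ := by
      have h3 := (isHolonomy_iff hD₁ _).1 (isHolonomy_holonomy hD₁ h₁) (FundamentalGroup.fromPath κ)
      have h4 := (isHolonomy_iff hD₂ _).1 (isHolonomy_holonomy hD₂ h₂) (FundamentalGroup.fromPath κ)
      rw [hhol, h4, inv_inj] at h3
      exact (congrArg Units.val h3).symm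
    obtain ⟨γ, hγ, rfl⟩ := exists_isFlatEnded κ
    obtain ⟨Φ, a1, a2, a3, a4⟩ := w.exists_solvesTransport hγ.isSmoothPath
    obtain ⟨Φ₁, b1, b2, b3, b4⟩ := w₁.exists_solvesTransport hγ.isSmoothPath
    obtain ⟨Φ₂, c1, c2, c3, c4⟩ := w₂.exists_solvesTransport hγ.isSmoothPath
    -- The forms `η₂ - η₁`, `η₁` and `-η₂` add up to zero, so `Φ Φ₁ / Φ₂` is conserved.
    have h5 := (a1.mul b1).mul_const (c1.inv c4) (by
      funext x
      change D₂.form.field x - D₁.form.field x + D₁.form.field x + -D₂.form.field x = 0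
      abel) (t := 1) ⟨zero_le_one, le_rfl⟩
    rw [a2, a3, b2, b3, c2, c3, hκ, mul_inv_cancel_right₀ (w₂.transport_ne_zero _)] at h5
    simpa using h5
  obtain ⟨f, hf, hdf, hf0, hft⟩ := w.exists_potential htriv
  have hne : ∀ x, ((c : ℂˣ) : ℂ) * f x ≠ 0 := fun x ↦ by
    obtain ⟨κ, hκ⟩ := hft x
    rw [hκ]
    exact mul_ne_zero (Units.ne_zero _) (w.transport_ne_zero κ)
  have hd : ∀ x v, (D₂.form - D₁.form).field x v = D₂.form.field x v - D₁.form.field x v :=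
    fun _ _ ↦ rfl
  have hsm : ContMDiff (𝓡 2) 𝓘(ℝ, ℂ) ∞ (fun x ↦ ((c : ℂˣ) : ℂ) * f x) :=
    fun x ↦ contMDiffAt_const_mul (hf x) _
  refine ⟨mkGauge _ hsm hne, ?_, ?_, ?_⟩
  · cases 𝔾 with
    | complex => exact (Subgroup.mem_iInf).2 fun x ↦ trivial
    | unitary =>
      refine (Subgroup.mem_iInf).2 fun x ↦ ?_
      change ‖((c : ℂˣ) : ℂ) * f x‖ = 1
      obtain ⟨κ, hκ⟩ := hft x
      have hc : ‖((c : ℂˣ) : ℂ)‖ = 1 := c.2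
      rw [norm_mul, hc, hκ, w.norm_transport, mul_one]
      intro x v
      rw [hd, map_sub, h₁.conj_form, h₂.conj_form]
      ring
    | positive =>
      refine (Subgroup.mem_iInf).2 fun x ↦ ?_
      change ∃ r : ℝ, 0 < r ∧ ((c : ℂˣ) : ℂ) * f x = r
      obtain ⟨κ, hκ⟩ := hft x
      obtain ⟨a, ha, hca⟩ : ∃ r : ℝ, 0 < r ∧ ((c : ℂˣ) : ℂ) = r := c.2
      obtain ⟨b, hb, hcb⟩ := w.transport_pos (fun x v ↦ by
        rw [hd, map_sub, preservesRealStructure_one_iff.1 h₁, preservesRealStructure_one_iff.1 h₂])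
        κ
      exact ⟨a * b, mul_pos ha hb, by rw [hκ, hca, hcb]; simp⟩
    | real =>
      change ∃ r : ℝ, ((c : ℂˣ) : ℂ) * f x₀ = r
      rw [hf0, mul_one]
      exact c.2
  · apply Units.ext
    change ((c : ℂˣ) : ℂ) * f x₀ = _
    rw [hf0, mul_one]
  · apply Connection.ext_form
    funext x
    have h6 : dfun (mkGauge _ hsm hne).toSmooth x = _ :=
      dfun_const_mul ((hf x).mdifferentiableAt (by simp)) ((c : ℂˣ) : ℂ)
    have h10 : ((mkGauge _ hsm hne x : ℂˣ) : ℂ) = ((c : ℂˣ) : ℂ) * f x := rfl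
    rw [Connection.smul_form_field, h6, h10, hdf]
    refine ContinuousLinearMap.ext fun v ↦ ?_
    have h7 := hne x
    have h8 := left_ne_zero_of_mul h7
    have h9 := right_ne_zero_of_mul h7
    simp only [_root_.smul_apply, _root_.add_apply, smul_eq_mul, hd]
    field_simp
    ring

/-! ### The flat line bundle of a representation -/

/-- Close up each path to a loop at `x₀` by chosen connecting paths `κ x` and apply `ρ`.
Commutativity of `G` makes `S` multiplicative in path order. -/
theorem exists_groupoid_extension {X G : Type*} [TopologicalSpace X] [PathConnectedSpace X]
    [CommGroup G] {x₀ : X} (ρ : FundamentalGroup X x₀ →* G) :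
    ∃ S : ∀ {x y : X}, Path.Homotopic.Quotient x y → G,
      (∀ {x y z : X} (κ : Path.Homotopic.Quotient x y) (μ : Path.Homotopic.Quotient y z),
        S (κ.trans μ) = S κ * S μ) ∧
      ∀ κ : Path.Homotopic.Quotient x₀ x₀, S κ = ρ (FundamentalGroup.fromPath κ) := by
  let κ : ∀ x : X, (FundamentalGroupoid.mk x₀ ⟶ FundamentalGroupoid.mk x) := fun x ↦
    (Path.Homotopic.Quotient.mk (PathConnectedSpace.somePath x₀ x) :
      Path.Homotopic.Quotient x₀ x)
  let R : (FundamentalGroupoid.mk x₀ ⟶ FundamentalGroupoid.mk x₀) → G := fun f ↦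
    ρ (FundamentalGroup.fromArrow f)
  have hR : ∀ f g, R (f ≫ g) = R f * R g := fun f g ↦ by
    have : FundamentalGroup.fromArrow (f ≫ g) =
      FundamentalGroup.fromArrow g * FundamentalGroup.fromArrow f := rfl
    change ρ _ = ρ _ * ρ _
    rw [this, map_mul, mul_comm]
  refine ⟨fun {x y} f ↦ R (κ x ≫ (show FundamentalGroupoid.mk x ⟶ FundamentalGroupoid.mk y from f)
    ≫ inv (κ y)), fun {x y z} f g ↦ ?_, fun f ↦ ?_⟩
  · rw [← hR]
    have : (show FundamentalGroupoid.mk x ⟶ FundamentalGroupoid.mk z from f.trans g) =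
      (show FundamentalGroupoid.mk x ⟶ FundamentalGroupoid.mk y from f) ≫
        (show FundamentalGroupoid.mk y ⟶ FundamentalGroupoid.mk z from g) := rfl
    change R (κ x ≫ (show FundamentalGroupoid.mk x ⟶ FundamentalGroupoid.mk z from f.trans g) ≫
      inv (κ z)) = _
    rw [this]
    simp only [Category.assoc, IsIso.inv_hom_id_assoc]
  · change R (κ x₀ ≫ (show FundamentalGroupoid.mk x₀ ⟶ FundamentalGroupoid.mk x₀ from f) ≫
      inv (κ x₀)) = R f
    -- The chosen loop `κ x₀` need not be trivial, but it cancels against its inverse in the abelian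
    -- group.
    rw [hR, hR, mul_left_comm, ← hR (κ x₀), IsIso.hom_inv_id]
    have h1 : R (𝟙 _) = 1 := by
      have := hR (𝟙 _) (𝟙 _)
      rwa [Category.id_comp, left_eq_mul] at this
    rw [h1, mul_one]

end

/-! ### The flat line bundle of a representation -/

section
variable {M : Type*} [TopologicalSpace M] [ChartedSpace Plane M] [IsManifold (𝓡 2) ∞ M]

/-- Set `e b x = S` of a path from `b` to `x`, chosen inside a simple neighbourhood of `b` when `x`
lies there. Its class is then independent of the choice, which gives the cocycle relation. Having
all values in `G` is what later makes a compatible connection possible. -/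
theorem exists_flatFrame [PathConnectedSpace M] {G : Subgroup ℂˣ}
    (S : ∀ {x y : M}, Path.Homotopic.Quotient x y → G)
    (hS : ∀ {x y z : M} (κ : Path.Homotopic.Quotient x y) (μ : Path.Homotopic.Quotient y z),
        S (κ.trans μ) = S κ * S μ) :
    ∃ e : M → M → ℂ, IsFlatFrame e ∧ (∀ b x, ∃ g : G, e b x = (g : ℂˣ)) ∧
      ∀ b, ∃ U, IsOpen U ∧ b ∈ U ∧ U ⊆ IsFlatFrame.domain e b ∧
        (∀ x ∈ U, ∀ y ∈ U, ∃ p : Path x y, Set.range p ⊆ U ∧ IsFlatEnded p) ∧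
        ∀ (x y : M) (p : Path x y), Set.range p ⊆ U →
          e b y = e b x * (S (Path.Homotopic.Quotient.mk p) : ℂˣ) := by
  classical
  choose U hU hb _ h1 h2 using fun b : M ↦ exists_simple_nhds b Filter.univ_mem
  choose p hp hp' using h1
  let q : ∀ b x, Path b x := fun b x ↦
    if h : x ∈ U b then p b b (hb b) x h else PathConnectedSpace.somePath b x
  set e : M → M → ℂ := fun b x ↦ ((S (Path.Homotopic.Quotient.mk (q b x)) : ℂˣ) : ℂ) with he
  have hq : ∀ b, ∀ x ∈ U b, Set.range (q b x) ⊆ U b := by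
    intro b x hx
    simp only [q, dif_pos hx]
    exact hp b b (hb b) x hx
  have key : ∀ b (x y : M) (p : Path x y), Set.range p ⊆ U b →
      e b y = e b x * (S (Path.Homotopic.Quotient.mk p) : ℂˣ) := by
    intro b x y p hp
    have hx : x ∈ U b := hp ⟨0, p.source⟩
    have hy : y ∈ U b := hp ⟨1, p.target⟩
    have h3 : Path.Homotopic.Quotient.mk (q b y) =
        (Path.Homotopic.Quotient.mk (q b x)).trans (Path.Homotopic.Quotient.mk p) := by
      rw [← Path.Homotopic.Quotient.mk_trans]
      refine Path.Homotopic.Quotient.eq.2 (h2 b _ _ _ _ (hq b y hy) ?_)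
      rw [Path.trans_range]
      exact Set.union_subset (hq b x hx) hp
    simp only [he, h3, hS]
    simp
  have hfr : ∀ b, ∀ x ∈ U b, ∀ᶠ y in 𝓝 x, e b y * e x x = e b x * e x y := by
    intro b x hx
    obtain ⟨V, hV, hxV, hVW, h3, -⟩ :=
      exists_simple_nhds x (((hU b).inter (hU x)).mem_nhds ⟨hx, hb x⟩)
    filter_upwards [hV.mem_nhds hxV] with y hy
    obtain ⟨r, hr, -⟩ := h3 x hxV y hy
    rw [key b x y r (hr.trans (hVW.trans Set.inter_subset_left)),
      key x x y r (hr.trans (hVW.trans Set.inter_subset_right))]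
    ring
  refine ⟨e, ⟨fun b x ↦ Units.ne_zero _, fun b ↦ ?_⟩, fun b x ↦ ⟨_, rfl⟩, fun b ↦
    ⟨U b, hU b, hb b, fun x hx ↦ ?_, fun x hx y hy ↦ ⟨p b x hx y hy, hp b x hx y hy,
      hp' b x hx y hy⟩, key b⟩⟩
  · filter_upwards [(hU b).mem_nhds (hb b)] with x hx using hfr b x hx
  · filter_upwards [(hU b).mem_nhds hx] with y hy using hfr b y hy

variable {e : M → M → ℂ} {s : M → ℂ}

/-- A section without zeros of a flat line bundle gives a connection on the trivial bundle. -/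
theorem exists_connection_of_section (he : IsFlatFrame e) (hs : ∀ x, IsSectionAt e s x) :
    ∃ D : Connection M, D.IsFlat ∧ D.form.field = -sectionForm e s := by
  have h1 : -sectionForm e s = fun x ↦ (-1 : ℂ) • sectionForm e s x := by
    funext x
    refine ContinuousLinearMap.ext fun v ↦ ?_
    exact (neg_one_mul _).symm
  have h2 : IsSmoothClosed (-sectionForm e s) := by
    rw [h1]
    refine ⟨fun x ↦ (isSmoothFormAt_sectionForm he (.of_forall hs)).smul
      (f := fun _ ↦ -1) contMDiffAt_const, fun x ↦ ?_⟩
    obtain ⟨g, hg⟩ := exists_log_sectionForm he (x := x) (.of_forall hs)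
    refine isClosedFormAt_of_dfun (contMDiffAt_const_mul hg.self_of_nhds.1 (-1)) ?_
    filter_upwards [hg] with y hy
    rw [dfun_const_mul (hy.1.mdifferentiableAt (by simp)), hy.2]
  refine ⟨Connection.ofForm (mkForm _ h2.smooth), Connection.isFlat_ofForm ?_, ?_⟩
  · rw [mkForm_field]
    exact h2
  · rw [Connection.ofForm_form_field, mkForm_field]

/-- On a short path `e b · s` solves the transport equation of `-w`, so its product with the
transport of `w` is conserved, and the ratio of end values of `e b` is `S κ`. For loops `s` cancels,
so the holonomy is `S`. -/
theorem transport_mul_section {G : Subgroup ℂˣ} {S : ∀ {x y : M}, Path.Homotopic.Quotient x y → G}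
    (hS : ∀ {x y z : M} (κ : Path.Homotopic.Quotient x y) (μ : Path.Homotopic.Quotient y z),
        S (κ.trans μ) = S κ * S μ) (he : IsFlatFrame e)
    (heS : ∀ b, ∃ U, IsOpen U ∧ b ∈ U ∧ U ⊆ IsFlatFrame.domain e b ∧
        (∀ x ∈ U, ∀ y ∈ U, ∃ p : Path x y, Set.range p ⊆ U ∧ IsFlatEnded p) ∧
        ∀ (x y : M) (p : Path x y), Set.range p ⊆ U →
          e b y = e b x * (S (Path.Homotopic.Quotient.mk p) : ℂˣ))
    (hs : ∀ x, IsSectionAt e s x) {w : M → Plane →L[ℝ] ℂ} (hw : IsSmoothClosed w)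
    (hws : w = -sectionForm e s) {x y : M} (κ : Path.Homotopic.Quotient x y) :
    hw.transport κ * (S κ : ℂˣ) * s y = s x := by
  refine pathClass_induction
    (P := fun {x y} κ ↦ hw.transport κ * (S κ : ℂˣ) * s y = s x) ?_ ?_ κ
  · intro x y z κ μ h1 h2
    rw [hw.transport_trans, hS]
    push_cast
    linear_combination h1 + hw.transport κ * (S κ : ℂˣ) * h2
  · intro b
    obtain ⟨U, hU, hb, hUd, h1, h2⟩ := heS b
    obtain ⟨V, hV, hbV, hVU, h3, h4⟩ := exists_simple_nhds b (hU.mem_nhds hb)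
    refine ⟨V, hV.mem_nhds hbV, fun x y γ hγ ↦ ?_⟩
    obtain ⟨p, hp, hp'⟩ := h3 x (hγ ⟨0, γ.source⟩) y (hγ ⟨1, γ.target⟩)
    rw [← Path.Homotopic.Quotient.eq.2 (h4 x y p γ hp hγ)]
    obtain ⟨Φ, a1, a2, a3, a4⟩ := hw.exists_solvesTransport hp'.isSmoothPath
    have hmem : ∀ t, p.extend t ∈ U := fun t ↦ by
      have : p.extend t ∈ Set.range p.extend := ⟨t, rfl⟩
      rw [p.extend_range] at this
      exact hVU (hp this)
    have h5 : SolvesTransport (-w) p (fun t ↦ e b (p.extend t) * s (p.extend t)) := by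
      intro t ht
      have h6 := (hs (p.extend t)).contMDiffAt he (hUd (hmem t))
      refine (hasDerivWithinAt_comp_path hp'.isSmoothPath ht
        (h6.mdifferentiableAt (by simp))).congr_deriv ?_
      have h7 := (hs (p.extend t)).sectionForm_eq he (hUd (hmem t))
      have h8 : (-w) (p.extend t) = (e b (p.extend t) * s (p.extend t))⁻¹ •
          dfun (fun y ↦ e b y * s y) (p.extend t) := by
        rw [hws, neg_neg, h7]
      have h9 : ∀ v : Plane, dfun (fun y ↦ e b y * s y) (p.extend t) v =
          (-w) (p.extend t) v * (e b (p.extend t) * s (p.extend t)) := by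
        intro v
        have h10 := he.ne_zero b (p.extend t)
        have h11 := (hs (p.extend t)).ne_zero
        rw [h8, _root_.smul_apply, smul_eq_mul]
        field_simp
      exact h9 _
    have h6 := a1.mul_const h5 (add_neg_cancel w) (t := 1) ⟨zero_le_one, le_rfl⟩
    rw [a2, a3, Path.extend_one, Path.extend_zero, h2 x y p (hp.trans hVU)] at h6
    have h7 := he.ne_zero b x
    apply mul_left_cancel₀ h7
    linear_combination h6

/-- The new section is `s / |s|` for `U(1)`, `|s|` for `ℝ^+`, and `s / s(x₀)` for `ℝ^*`. As the
frames take values in `G`, each operation commutes with passing to a local frame and stays smooth.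
-/
theorem exists_compatible_section (𝔾 : StructureGroup) (x₀ : M) (he : IsFlatFrame e)
    (heG : ∀ b x, ∃ g : 𝔾.toSubgroup, e b x = (g : ℂˣ)) (hs : ∀ x, IsSectionAt e s x) :
    ∃ s' : M → ℂ, (∀ x, IsSectionAt e s' x) ∧
      ∀ D : Connection M, D.form.field = -sectionForm e s' → 𝔾.IsCompatible x₀ D := by
  have hη : ∀ (D : Connection M) (t : M → ℂ), D.form.field = -sectionForm e t → ∀ x v,
      D.form.field x v = -((e x x * t x)⁻¹ * dfun (fun y ↦ e x y * t y) x v) := by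
    intro D t h x v
    rw [h]
    rfl
  cases 𝔾 with
  | complex => exact ⟨s, hs, fun _ _ ↦ trivial⟩
  | unitary =>
    have hn : ∀ b x, ‖e b x‖ = 1 := fun b x ↦ by
      obtain ⟨g, hg⟩ := heG b x
      rw [hg]
      exact g.2
    have hs' : ∀ x, IsSectionAt e (fun x ↦ s x * ((‖s x‖⁻¹ : ℝ) : ℂ)) x := by
      intro x
      have h0 := (hs x).ne_zero
      have h1 : e x x * s x ≠ 0 := mul_ne_zero (he.ne_zero x x) h0
      refine ⟨by simpa using h0, ?_⟩
      have h2 : ContDiffAt ℝ ∞ (fun z : ℂ ↦ z * ((‖z‖⁻¹ : ℝ) : ℂ)) (e x x * s x) :=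
        contDiffAt_id.mul (Complex.ofRealCLM.contDiff.contDiffAt.comp _
          ((contDiffAt_norm ℝ h1).inv (norm_ne_zero_iff.2 h1)))
      have h3 := contMDiffAt_comp' (f := fun y ↦ e x y * s y) h2 (hs x).smooth
      refine h3.congr_of_eventuallyEq (.of_forall fun y ↦ ?_)
      change _ = e x y * s y * ((‖e x y * s y‖⁻¹ : ℝ) : ℂ)
      rw [norm_mul, hn, one_mul, mul_assoc]
    refine ⟨_, hs', fun D hD ↦ Connection.isUnitary_of_conj_form fun x v ↦ ?_⟩
    rw [hη D _ hD]
    have h0 := (hs' x).ne_zero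
    have h1 := (hs' x).smooth
    set t : M → ℂ := fun x ↦ s x * ((‖s x‖⁻¹ : ℝ) : ℂ)
    set h : M → ℂ := fun y ↦ e x y * t y
    have hmd : MDifferentiableAt (𝓡 2) 𝓘(ℝ, ℂ) h x := h1.mdifferentiableAt (by simp)
    have hmd' : MDifferentiableAt (𝓡 2) 𝓘(ℝ, ℂ) (fun y ↦ (starRingEnd ℂ) (h y)) x :=
      (contMDiffAt_comp' (F := starRingEnd ℂ) Complex.conjCLE.contDiff.contDiffAt
        h1).mdifferentiableAt (by simp)
    -- Differentiating `h h̄ = 1` shows that `h⁻¹ dh` is imaginary.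
    have h2 : (h * fun y ↦ (starRingEnd ℂ) (h y)) = fun _ ↦ 1 := by
      funext y
      have h3 := (hs y).ne_zero
      change h y * (starRingEnd ℂ) (h y) = 1
      rw [Complex.mul_conj, Complex.normSq_eq_norm_sq]
      have : ‖h y‖ = 1 := by
        change ‖e x y * (s y * ((‖s y‖⁻¹ : ℝ) : ℂ))‖ = 1
        rw [norm_mul, norm_mul, hn, Complex.norm_real, norm_inv, norm_norm,
          mul_inv_cancel₀ (norm_ne_zero_iff.2 h3), one_mul]
      rw [this]
      simp
    have h4 := dfun_mul hmd hmd'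
    rw [h2, dfun_const] at h4
    have h5 := congrArg (fun L : Plane →L[ℝ] ℂ ↦ L v) h4
    simp only [_root_.add_apply, _root_.smul_apply, smul_eq_mul, _root_.zero_apply] at h5
    have h7 : dfun (fun y ↦ (starRingEnd ℂ) (h y)) x v = (starRingEnd ℂ) (dfun h x v) :=
      dfun_conj hmd v
    rw [h7] at h5
    have h8 : e x x * t x = h x := rfl
    have h9 : h x ≠ 0 := mul_ne_zero (he.ne_zero x x) h0
    have h10 : (starRingEnd ℂ) (h x) ≠ 0 := by simpa using h9
    rw [h8, map_neg, map_mul, map_inv₀]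
    field_simp
    linear_combination h5
  | positive =>
    have hn : ∀ b x, e b x = (‖e b x‖ : ℂ) := fun b x ↦ by
      obtain ⟨g, hg⟩ := heG b x
      obtain ⟨r, hr, hgr⟩ : ∃ r : ℝ, 0 < r ∧ ((g : ℂˣ) : ℂ) = r := g.2
      rw [hg, hgr, Complex.norm_real, Real.norm_of_nonneg hr.le]
    have hs' : ∀ x, IsSectionAt e (fun x ↦ (‖s x‖ : ℂ)) x := by
      intro x
      have h0 := (hs x).ne_zero
      have h1 : e x x * s x ≠ 0 := mul_ne_zero (he.ne_zero x x) h0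
      refine ⟨by simpa using h0, ?_⟩
      have h2 : ContDiffAt ℝ ∞ (fun z : ℂ ↦ (‖z‖ : ℂ)) (e x x * s x) :=
        Complex.ofRealCLM.contDiff.contDiffAt.comp _ (contDiffAt_norm ℝ h1)
      have h3 := contMDiffAt_comp' (f := fun y ↦ e x y * s y) h2 (hs x).smooth
      refine h3.congr_of_eventuallyEq (.of_forall fun y ↦ ?_)
      change _ = ((‖e x y * s y‖ : ℝ) : ℂ)
      rw [norm_mul, Complex.ofReal_mul, ← hn]
    refine ⟨_, hs', fun D hD ↦ Connection.preservesRealStructure_one_iff.2 fun x v ↦ ?_⟩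
    rw [hη D _ hD]
    have h1 := (hs' x).smooth
    set t : M → ℂ := fun x ↦ (‖s x‖ : ℂ)
    set h : M → ℂ := fun y ↦ e x y * t y
    have hmd : MDifferentiableAt (𝓡 2) 𝓘(ℝ, ℂ) h x := h1.mdifferentiableAt (by simp)
    have h2 : (fun y ↦ (starRingEnd ℂ) (h y)) = h := by
      funext y
      change (starRingEnd ℂ) (e x y * (‖s y‖ : ℂ)) = e x y * (‖s y‖ : ℂ)
      rw [hn x y, ← Complex.ofReal_mul, Complex.conj_ofReal]
    have h7 : dfun (fun y ↦ (starRingEnd ℂ) (h y)) x v = (starRingEnd ℂ) (dfun h x v) :=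
      dfun_conj hmd v
    rw [h2] at h7
    have h8 : e x x * t x = h x := rfl
    rw [h8, map_neg, map_mul, map_inv₀, ← h7, congrFun h2 x]
  | real =>
    have hn : ∀ b x, (starRingEnd ℂ) (e b x) = e b x := fun b x ↦ by
      obtain ⟨g, hg⟩ := heG b x
      obtain ⟨r, hgr⟩ : ∃ r : ℝ, ((g : ℂˣ) : ℂ) = r := g.2
      rw [hg, hgr, Complex.conj_ofReal]
    have h00 := (hs x₀).ne_zero
    have hs' : ∀ x, IsSectionAt e (fun x ↦ (s x₀)⁻¹ * s x) x := fun x ↦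
      ⟨mul_ne_zero (inv_ne_zero h00) (hs x).ne_zero,
        (contMDiffAt_const_mul (hs x).smooth (s x₀)⁻¹).congr_of_eventuallyEq
          (.of_forall fun y ↦ mul_left_comm _ _ _)⟩
    have ht0 : (s x₀)⁻¹ * s x₀ = 1 := inv_mul_cancel₀ h00
    refine ⟨_, hs', fun D hD ↦ ?_⟩
    set t : M → ℂ := fun x ↦ (s x₀)⁻¹ * s x
    have htx : t x₀ = 1 := ht0
    have hη' := hη D t hD
    clear_value t
    have h0 : ∀ x, t x ≠ 0 := fun x ↦ (hs' x).ne_zero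
    -- The real structure preserved is `u = t / t̄`. Real frames cancel in this quotient, so `u` is
    -- a global smooth function although `t` is only a section.
    have hu : ∀ x, (fun y ↦ t y * ((starRingEnd ℂ) (t y))⁻¹) =
        fun y ↦ (e x y * t y) * ((starRingEnd ℂ) (e x y * t y))⁻¹ := by
      intro x
      funext y
      rw [map_mul, hn]
      have h1 := he.ne_zero x y
      have h2 := h0 y
      have h3 : (starRingEnd ℂ) (t y) ≠ 0 := by simpa using h2
      field_simp
    have hF : ∀ z : ℂ, z ≠ 0 → ContDiffAt ℝ ∞ (fun z : ℂ ↦ ((starRingEnd ℂ) z)⁻¹) z := by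
      intro z hz
      exact ((contDiffAt_inv ℂ (by simpa using hz)).restrict_scalars ℝ).comp z
        Complex.conjCLE.contDiff.contDiffAt
    have hsm : ContMDiff (𝓡 2) 𝓘(ℝ, ℂ) ∞ (fun y ↦ t y * ((starRingEnd ℂ) (t y))⁻¹) := by
      intro x
      rw [hu x]
      exact contMDiffAt_mul' (hs' x).smooth (contMDiffAt_comp'
        (f := fun y ↦ e x y * t y) (hF _ (mul_ne_zero (he.ne_zero x x) (h0 x))) (hs' x).smooth)
    refine ⟨⟨_, hsm⟩, fun x ↦ ?_, ?_, Connection.preservesRealStructure_iff.2 fun x v ↦ ?_⟩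
    · change ‖t x * ((starRingEnd ℂ) (t x))⁻¹‖ = 1
      rw [norm_mul, norm_inv, RCLike.norm_conj, mul_inv_cancel₀ (norm_ne_zero_iff.2 (h0 x))]
    · change t x₀ * ((starRingEnd ℂ) (t x₀))⁻¹ = 1
      rw [htx]
      simp
    · have h1 := (hs' x).smooth
      set h : M → ℂ := fun y ↦ e x y * t y with hh
      have h9 : h x ≠ 0 := mul_ne_zero (he.ne_zero x x) (h0 x)
      have h10 : (starRingEnd ℂ) (h x) ≠ 0 := by simpa using h9
      have hmd : MDifferentiableAt (𝓡 2) 𝓘(ℝ, ℂ) h x := h1.mdifferentiableAt (by simp)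
      have hmc : ContMDiffAt (𝓡 2) 𝓘(ℝ, ℂ) ∞ (fun y ↦ (starRingEnd ℂ) (h y)) x :=
        contMDiffAt_comp' (F := starRingEnd ℂ) Complex.conjCLE.contDiff.contDiffAt h1
      have hmd' : MDifferentiableAt (𝓡 2) 𝓘(ℝ, ℂ) (fun y ↦ ((starRingEnd ℂ) (h y))⁻¹) x :=
        (contMDiffAt_comp' (hF _ h9) h1).mdifferentiableAt (by simp)
      have h2 : dfun (fun y ↦ t y * ((starRingEnd ℂ) (t y))⁻¹) x =
          dfun (h * fun y ↦ ((starRingEnd ℂ) (h y))⁻¹) x := by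
        rw [hu x]
        rfl
      have h3 : t x * ((starRingEnd ℂ) (t x))⁻¹ = h x * ((starRingEnd ℂ) (h x))⁻¹ :=
        congrFun (hu x) x
      have h4 : dfun (fun y ↦ ((starRingEnd ℂ) (h y))⁻¹) x =
          -(((starRingEnd ℂ) (h x)) ^ 2)⁻¹ • dfun (fun y ↦ (starRingEnd ℂ) (h y)) x :=
        dfun_comp_of_hasDerivAt (F := fun z ↦ z⁻¹) (hasDerivAt_inv h10)
          (hmc.mdifferentiableAt (by simp))
      have h7 : dfun (fun y ↦ (starRingEnd ℂ) (h y)) x v = (starRingEnd ℂ) (dfun h x v) :=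
        dfun_conj hmd v
      change dfun (fun y ↦ t y * ((starRingEnd ℂ) (t y))⁻¹) x v +
        t x * ((starRingEnd ℂ) (t x))⁻¹ * _ = t x * ((starRingEnd ℂ) (t x))⁻¹ * _
      have h8 : D.form.field x v = -((h x)⁻¹ * dfun h x v) := hη' x v
      rw [h2, dfun_mul hmd hmd', h3, h4, h8]
      simp only [_root_.add_apply, _root_.smul_apply, smul_eq_mul, h7, _root_.map_neg,
        _root_.map_mul, map_inv₀]
      field_simp
      ring

/-! ### The equivalence, given sections -/

theorem exists_compatible_connection [ConnectedSpace M] (𝔾 : StructureGroup) (x₀ : M)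
    (hsec : ∀ e : M → M → ℂ, IsFlatFrame e → ∃ s, ∀ x, IsSectionAt e s x)
    (ρ : FundamentalGroup M x₀ →* 𝔾.toSubgroup) :
    ∃ D : Connection M, D.IsFlat ∧ 𝔾.IsCompatible x₀ D ∧ D.IsHolonomy ρ := by
  have := pathConnectedSpace_of_connected M
  obtain ⟨S, hS, hSρ⟩ := exists_groupoid_extension ρ
  obtain ⟨e, he, heG, heS⟩ := exists_flatFrame S hS
  obtain ⟨s₁, hs₁⟩ := hsec e he
  obtain ⟨s, hs, hsD⟩ := exists_compatible_section 𝔾 x₀ he heG hs₁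
  obtain ⟨D, hD, hDs⟩ := exists_connection_of_section he hs
  refine ⟨D, hD, hsD D hDs, (Connection.isHolonomy_iff hD ρ).2 fun κ ↦ ?_⟩
  have h1 := transport_mul_section hS he heS hs hD.isSmoothClosed hDs (FundamentalGroup.toPath κ)
  rw [hSρ] at h1
  have h2 := mul_right_cancel₀ (hs x₀).ne_zero (h1.trans (one_mul _).symm)
  refine eq_inv_of_mul_eq_one_right (Units.ext ?_)
  exact h2

/-- The hypothesis `hsec`, that flat line bundles are smoothly trivial, isolates the topological
input; only essential surjectivity uses it. -/
theorem isEquivalence_holonomyFunctor [ConnectedSpace M] (𝔾 : StructureGroup) (x₀ : M)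
    (hsec : ∀ e : M → M → ℂ, IsFlatFrame e → ∃ s, ∀ x, IsSectionAt e s x) :
    (holonomyFunctor M x₀ 𝔾).IsEquivalence where
  faithful := ⟨fun {D₁ D₂} ξ ζ h ↦ by
    apply Subtype.ext
    apply Subtype.ext
    refine Gauge.eq_of_smul_eq (D := D₁.back.1) (x₀ := x₀) ?_ ?_
    · exact (congrArg Subtype.val ξ.2).trans (congrArg Subtype.val ζ.2).symm
    · exact congrArg (fun f ↦ ((Subtype.val f : 𝔾.toSubgroup) : ℂˣ)) h⟩
  full := ⟨fun {D₁ D₂} c ↦ by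
    have h1 : D₁.back.1.holonomy x₀ 𝔾.toSubgroup = D₂.back.1.holonomy x₀ 𝔾.toSubgroup := by
      have h2 := c.2
      change MonoidHom.comp _ _ = D₂.back.1.holonomy x₀ 𝔾.toSubgroup at h2
      rw [← h2]
      -- Conjugation is trivial in an abelian group, so a Betti morphism exists only between equal
      -- representations.
      refine MonoidHom.ext fun κ ↦ ?_
      exact (mul_inv_cancel_comm _ _).symm
    obtain ⟨g, hg, hg0, hgD⟩ := Connection.exists_gauge D₁.back.2.1 D₂.back.2.1 D₁.back.2.2
      D₂.back.2.2 h1 c.1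
    exact ⟨⟨⟨g, hg⟩, Subtype.ext hgD⟩, Subtype.ext (Subtype.ext hg0)⟩⟩
  essSurj := ⟨fun ρ ↦ by
    obtain ⟨D, hD, hDc, hρ⟩ := exists_compatible_connection 𝔾 x₀ hsec ρ.back
    refine ⟨ActionCategory.objEquiv _ _ (⟨D, hD, hDc⟩ : FlatConnection M x₀ 𝔾), ⟨eqToIso ?_⟩⟩
    have h1 := (Connection.isHolonomy_iff_eq_holonomy hD hDc _).1 hρ
    have h2 : (holonomyFunctor M x₀ 𝔾).obj (ActionCategory.objEquiv _ _
      (⟨D, hD, hDc⟩ : FlatConnection M x₀ 𝔾)) =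
        ActionCategory.objEquiv 𝔾.toSubgroup (BettiObj (FundamentalGroup M x₀) 𝔾.toSubgroup)
          (D.holonomy x₀ 𝔾.toSubgroup) := rfl
    rw [h2, ← h1]
    exact (ActionCategory.objEquiv _ _).right_inv ρ⟩

end

/-! ### Orders of zeros -/

/-- The plane as the complex line. -/
abbrev planeIso : Plane ≃ₗᵢ[ℝ] ℂ := Complex.orthonormalBasisOneI.repr.symm

/-- A real-linear map of the complex line in terms of `w` and `w̄`. -/
theorem exists_eq_mul_add_mul_conj (A : ℂ →L[ℝ] ℂ) (hA : Function.Injective A) :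
    ∃ α β : ℂ, (∀ w, A w = α * w + β * (starRingEnd ℂ) w) ∧ ‖α‖ ≠ ‖β‖ := by
  set α := (A 1 - Complex.I * A Complex.I) / 2
  set β := (A 1 + Complex.I * A Complex.I) / 2
  have h1 : ∀ w, A w = α * w + β * (starRingEnd ℂ) w := by
    intro w
    have h2 : w = w.re • (1 : ℂ) + w.im • Complex.I := by
      simp [Complex.re_add_im]
    have h3 : A w = w.re * A 1 + w.im * A Complex.I := by
      conv_lhs => rw [h2]
      rw [_root_.map_add, map_smul, map_smul]
      simp
    have h4 : (starRingEnd ℂ) w = w.re - w.im * Complex.I := by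
      apply Complex.ext <;> simp
    have h5 : w = w.re + w.im * Complex.I := (Complex.re_add_im w).symm
    rw [h3, h4]
    conv_rhs => rw [h5]
    simp only [α, β, Complex.add_re, Complex.ofReal_re, Complex.mul_re, Complex.I_re, mul_zero,
      Complex.ofReal_im, Complex.I_im, mul_one, sub_self, add_zero, Complex.add_im, Complex.mul_im,
      zero_add]
    linear_combination w.im * A Complex.I * Complex.I_mul_I
  refine ⟨α, β, h1, fun h ↦ ?_⟩
  obtain ⟨w, hw, hw'⟩ : ∃ w, w ≠ 0 ∧ A w = 0 := by
    by_cases hβ : α = 0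
    · have h0 : β = 0 := by rwa [hβ, norm_zero, eq_comm, norm_eq_zero] at h
      exact ⟨1, one_ne_zero, by rw [h1, hβ, h0]; simp⟩
    -- If `|α| = |β| ≠ 0`, such a `w` has modulus one, so `w̄ = w⁻¹` and `α w + β w̄ = (α w² + β) /
    -- w = 0`, against injectivity.
    · obtain ⟨w, hw⟩ := IsAlgClosed.exists_pow_nat_eq (-β / α) (n := 2) (by norm_num)
      have hn : ‖w‖ = 1 := by
        have h2 := congrArg norm hw
        rw [norm_pow, norm_div, norm_neg, ← h, div_self (norm_ne_zero_iff.2 hβ)] at h2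
        exact (pow_eq_one_iff_of_nonneg (norm_nonneg _) (by norm_num)).1 h2
      have hw0 : w ≠ 0 := norm_ne_zero_iff.1 (by rw [hn]; exact one_ne_zero)
      refine ⟨w, hw0, ?_⟩
      have h3 : w * (starRingEnd ℂ) w = 1 := by
        rw [Complex.mul_conj, Complex.normSq_eq_norm_sq, hn]
        simp
      rw [h1]
      apply mul_left_cancel₀ hw0
      rw [eq_div_iff hβ] at hw
      linear_combination hw + β * h3
  exact hw (hA (hw'.trans (map_zero A).symm))

/-! ### The order of a function at a point, in a complex coordinate -/

section
variable {M : Type*} [TopologicalSpace M] [ChartedSpace Plane M] [IsManifold (𝓡 2) ∞ M]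

/-- `c` is a smooth chart at `p`. -/
structure IsChartAt (c : OpenPartialHomeomorph M Plane) (p : M) : Prop where
  mem_atlas : c ∈ IsManifold.maximalAtlas (𝓡 2) ∞ M
  mem_source : p ∈ c.source

/-- The complex coordinate vanishing at `p`. -/
def zeta (c : OpenPartialHomeomorph M Plane) (p x : M) : ℂ := planeIso (c x - c p)

variable {c : OpenPartialHomeomorph M Plane} {p : M}

theorem zeta_self (c : OpenPartialHomeomorph M Plane) (p : M) : zeta c p p = 0 := by
  rw [zeta, sub_self, map_zero]

theorem IsChartAt.zeta_ne_zero (hp : IsChartAt c p) {x : M} (hx : x ∈ c.source) (h : x ≠ p) :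
    zeta c p x ≠ 0 := by
  rw [zeta, Ne, LinearIsometryEquiv.map_eq_zero_iff, sub_eq_zero]
  exact fun h' ↦ h (c.injOn hx hp.mem_source h')

theorem contMDiffAt_zeta (hp : c ∈ IsManifold.maximalAtlas (𝓡 2) ∞ M) (p : M) {x : M}
    (hx : x ∈ c.source) : ContMDiffAt (𝓡 2) 𝓘(ℝ, ℂ) ∞ (zeta c p) x := by
  refine contMDiffAt_of_comp_symm hp hx ?_
  have h1 : ContDiff ℝ ∞ (fun y : Plane ↦ planeIso (y - c p)) :=
    planeIso.contDiff.comp (contDiff_id.sub contDiff_const)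
  refine h1.contDiffAt.congr_of_eventuallyEq ?_
  filter_upwards [c.open_target.mem_nhds (c.map_source hx)] with y hy
  rw [Function.comp_apply, zeta, c.right_inv hy]

theorem IsChartAt.eventually (hp : IsChartAt c p) : ∀ᶠ x in 𝓝[≠] p, x ∈ c.source ∧
    zeta c p x ≠ 0 := by
  filter_upwards [nhdsWithin_le_nhds (c.open_source.mem_nhds hp.mem_source),
    self_mem_nhdsWithin] with x hx hx'
  exact ⟨hx, hp.zeta_ne_zero hx hx'⟩

/-- `h` has order `k` at `p`. -/
def HasOrderAt (c : OpenPartialHomeomorph M Plane) (h : M → ℂ) (p : M) (k : ℤ) : Prop :=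
  ∃ l : M → ℂ, ∀ᶠ y in 𝓝[≠] p, ContMDiffAt (𝓡 2) 𝓘(ℝ, ℂ) ∞ l y ∧
    h y = zeta c p y ^ k * Complex.exp (l y)

namespace HasOrderAt
variable {h g : M → ℂ} {k m : ℤ}

theorem congr (hh : HasOrderAt c h p k) (e : ∀ᶠ y in 𝓝[≠] p, g y = h y) : HasOrderAt c g p k := by
  obtain ⟨l, hl⟩ := hh
  refine ⟨l, ?_⟩
  filter_upwards [hl, e] with y hy hy'
  rwa [hy']

theorem mul (hp : IsChartAt c p) (hh : HasOrderAt c h p k) (hg : HasOrderAt c g p m) :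
    HasOrderAt c (fun y ↦ h y * g y) p (k + m) := by
  obtain ⟨l, hl⟩ := hh
  obtain ⟨l', hl'⟩ := hg
  refine ⟨fun y ↦ l y + l' y, ?_⟩
  filter_upwards [hl, hl', hp.eventually] with y hy hy' hz
  refine ⟨hy.1.add hy'.1, ?_⟩
  rw [hy.2, hy'.2, zpow_add₀ hz.2, Complex.exp_add]
  ring

theorem zpow (hh : HasOrderAt c h p k) (m : ℤ) : HasOrderAt c (fun y ↦ h y ^ m) p (m * k) := by
  obtain ⟨l, hl⟩ := hh
  refine ⟨fun y ↦ m * l y, ?_⟩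
  filter_upwards [hl] with y hy
  refine ⟨contMDiffAt_const_mul hy.1 _, ?_⟩
  rw [hy.2, mul_zpow, ← zpow_mul, ← Complex.exp_int_mul, mul_comm k]

/-- A nonvanishing function has a local logarithm. -/
theorem of_smooth (hs : ∀ᶠ y in 𝓝 p, ContMDiffAt (𝓡 2) 𝓘(ℝ, ℂ) ∞ h y) (h0 : h p ≠ 0) :
    HasOrderAt c h p 0 := by
  obtain ⟨g, hg⟩ := exists_log hs h0
  refine ⟨fun y ↦ Complex.log (h p) + g y, ?_⟩
  filter_upwards [nhdsWithin_le_nhds hg] with y hy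
  refine ⟨contMDiffAt_const.add hy.2.1, ?_⟩
  rw [hy.2.2.2, zpow_zero, one_mul, Complex.exp_add, Complex.exp_log h0]

theorem eventually_nhds [T2Space M] (hp : IsChartAt c p) (hh : HasOrderAt c h p k) :
    ∀ᶠ y in 𝓝[≠] p, h y ≠ 0 ∧ ContMDiffAt (𝓡 2) 𝓘(ℝ, ℂ) ∞ h y := by
  obtain ⟨l, hl⟩ := hh
  filter_upwards [eventually_nhdsNE_eventually_nhds_iff.2 hl, hp.eventually] with y hy hz
  have h1 := hy.self_of_nhds
  refine ⟨?_, ?_⟩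
  · rw [h1.2]
    exact mul_ne_zero (zpow_ne_zero _ hz.2) (Complex.exp_ne_zero _)
  · have h3 : ContDiffAt ℝ ∞ (fun z : ℂ ↦ z ^ k) (zeta c p y) :=
      ContDiffAt.restrict_scalars ℝ (𝕜' := ℂ) ((analyticAt_id (𝕜 := ℂ)).zpow hz.2).contDiffAt
    have h2 : ContMDiffAt (𝓡 2) 𝓘(ℝ, ℂ) ∞ (fun y ↦ zeta c p y ^ k * Complex.exp (l y)) y :=
      contMDiffAt_mul' (contMDiffAt_comp' (F := fun z ↦ z ^ k) h3 (contMDiffAt_zeta hp.mem_atlas p hz.1))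
        (contMDiffAt_comp' (F := Complex.exp) Complex.contDiff_exp.contDiffAt h1.1)
    refine h2.congr_of_eventuallyEq ?_
    filter_upwards [hy] with z hz using hz.2

end HasOrderAt

/-- A nondegenerate zero has order `1` or `-1`. -/
theorem exists_hasOrderAt (hp : IsChartAt c p) {h : M → ℂ}
    (hs : ∀ᶠ y in 𝓝 p, ContMDiffAt (𝓡 2) 𝓘(ℝ, ℂ) ∞ h y) (h0 : h p = 0)
    (hd : Function.Injective (dfun h p)) : ∃ k : ℤ, (k = 1 ∨ k = -1) ∧ HasOrderAt c h p k := by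
  have hcp := hp.mem_source
  have h1 := coordForm_dfun hp.mem_atlas (c.map_source hcp) (f := h)
    (by rw [c.left_inv hcp]; exact hs.self_of_nhds.mdifferentiableAt (by simp))
  set L := coordForm (dfun h) c (c p) with hL
  have hLi : Function.Injective L := by
    have : ⇑L = dfun h p ∘ dsymm c (c p) := by
      funext v
      exact coordForm_apply _ hcp v
    rw [this]
    refine hd.comp (Function.LeftInverse.injective (g := dchart c p) fun v ↦ ?_)
    exact congrArg (fun L : Plane →L[ℝ] Plane ↦ L v) (dchart_dsymm hp.mem_atlas hcp)
  obtain ⟨α, β, hA, hαβ⟩ := exists_eq_mul_add_mul_conj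
    (L ∘L (planeIso.symm.toContinuousLinearEquiv : ℂ →L[ℝ] Plane))
    (hLi.comp planeIso.symm.injective)
  -- First-order expansion in the coordinate: `h = α ζ + β ζ̄ + o(ζ)`.
  have hbound : ∀ ε : ℝ, 0 < ε → ∀ᶠ y in 𝓝 p,
      ‖h y - (α * zeta c p y + β * (starRingEnd ℂ) (zeta c p y))‖ ≤ ε * ‖zeta c p y‖ := by
    intro ε hε
    have h2 := (c.continuousAt hcp).eventually ((hasFDerivAt_iff_isLittleO.1 h1).def hε)
    filter_upwards [h2, c.open_source.mem_nhds hcp] with y hy hys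
    rw [Function.comp_apply, Function.comp_apply, c.left_inv hys, c.left_inv hcp, h0, sub_zero] at hy
    have h3 : (L ∘L (planeIso.symm.toContinuousLinearEquiv : ℂ →L[ℝ] Plane)) (zeta c p y) =
        L (c y - c p) := congrArg L (planeIso.symm_apply_apply _)
    rwa [← hA, h3, zeta, LinearIsometryEquiv.norm_map]
  -- When `a z` dominates, `u / (a z)` lies within distance one of `1`, where the principal
  -- logarithm is smooth.
  have hsum : ∀ a b z z' u : ℂ, a ≠ 0 → z ≠ 0 → ‖z'‖ = ‖z‖ → ∀ ε : ℝ, ‖b‖ + ε < ‖a‖ →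
      ‖u - (a * z + b * z')‖ ≤ ε * ‖z‖ → u / (a * z) ∈ Complex.slitPlane := by
    intro a b z z' u ha hz hz' ε hε hu
    refine Complex.mem_slitPlane_of_norm_lt_one (z := u / (a * z) - 1) ?_ |> fun h ↦ by simpa using h
    have h2 : u / (a * z) - 1 = ((u - (a * z + b * z')) + b * z') / (a * z) := by
      field_simp
      ring
    rw [h2, norm_div, norm_mul a z, div_lt_one (mul_pos (norm_pos_iff.2 ha) (norm_pos_iff.2 hz))]
    calc _ ≤ ε * ‖z‖ + ‖b‖ * ‖z‖ := (norm_add_le _ _).trans (add_le_add hu (by rw [norm_mul, hz']))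
      _ < ‖a‖ * ‖z‖ := by
        rw [← add_mul]
        exact mul_lt_mul_of_pos_right (by linarith) (norm_pos_iff.2 hz)
  have hlog : ∀ g : M → ℂ, ∀ y, ContMDiffAt (𝓡 2) 𝓘(ℝ, ℂ) ∞ g y → g y ∈ Complex.slitPlane →
      ContMDiffAt (𝓡 2) 𝓘(ℝ, ℂ) ∞ (fun y ↦ Complex.log (g y)) y := fun g y hg hy ↦
    contMDiffAt_comp' (F := Complex.log) ((Complex.contDiffAt_log hy).restrict_scalars ℝ) hg
  have hinv : ∀ g : M → ℂ, ∀ y, ContMDiffAt (𝓡 2) 𝓘(ℝ, ℂ) ∞ g y → g y ≠ 0 →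
      ContMDiffAt (𝓡 2) 𝓘(ℝ, ℂ) ∞ (fun y ↦ (g y)⁻¹) y := fun g y hg hy ↦
    contMDiffAt_comp' (F := fun z ↦ z⁻¹) ((contDiffAt_inv ℂ hy).restrict_scalars ℝ) hg
  rcases lt_or_gt_of_ne hαβ with hlt | hlt
  -- The `ζ̄` term dominates. As `ζ̄ = ζ⁻¹ · |ζ|²` and `log |ζ|²` is smooth off `p`, the order is
  -- `-1`; the exponent in an order is not required to extend over `p`.
  · have hβ : β ≠ 0 := norm_ne_zero_iff.1 ((norm_nonneg α).trans_lt hlt).ne'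
    refine ⟨-1, .inr rfl, fun y ↦ Complex.log (h y / (β * (starRingEnd ℂ) (zeta c p y))) +
      Complex.log β + Complex.log (zeta c p y * (starRingEnd ℂ) (zeta c p y)), ?_⟩
    filter_upwards [nhdsWithin_le_nhds hs, hp.eventually,
      nhdsWithin_le_nhds (hbound ((‖β‖ - ‖α‖) / 2) (by linarith))] with y hy hz hb
    have hzs := contMDiffAt_zeta hp.mem_atlas p hz.1
    have hz' : (starRingEnd ℂ) (zeta c p y) ≠ 0 := by simpa using hz.2
    have hzs' : ContMDiffAt (𝓡 2) 𝓘(ℝ, ℂ) ∞ (fun y ↦ (starRingEnd ℂ) (zeta c p y)) y :=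
      contMDiffAt_comp' (F := starRingEnd ℂ) Complex.conjCLE.contDiff.contDiffAt hzs
    have h3 := hsum β α _ (zeta c p y) (h y) hβ hz' (by simp) ((‖β‖ - ‖α‖) / 2) (by linarith)
      (by rw [add_comm (β * _)]; simpa using hb)
    have h4 : zeta c p y * (starRingEnd ℂ) (zeta c p y) ∈ Complex.slitPlane := by
      rw [Complex.mul_conj]
      exact Complex.ofReal_mem_slitPlane.2 (Complex.normSq_pos.2 hz.2)
    refine ⟨((hlog _ y (contMDiffAt_mul' hy (hinv _ y (contMDiffAt_const_mul hzs' β)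
      (mul_ne_zero hβ hz'))) h3).add contMDiffAt_const).add
      (hlog _ y (contMDiffAt_mul' hzs hzs') h4), ?_⟩
    have h5 := hz.2
    rw [Complex.exp_add, Complex.exp_add, Complex.exp_log (Complex.slitPlane_ne_zero h3),
      Complex.exp_log hβ, Complex.exp_log (Complex.slitPlane_ne_zero h4), zpow_neg, zpow_one]
    field_simp
  · have hα : α ≠ 0 := norm_ne_zero_iff.1 ((norm_nonneg β).trans_lt hlt).ne'
    refine ⟨1, .inl rfl, fun y ↦ Complex.log (h y / (α * zeta c p y)) + Complex.log α, ?_⟩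
    filter_upwards [nhdsWithin_le_nhds hs, hp.eventually,
      nhdsWithin_le_nhds (hbound ((‖α‖ - ‖β‖) / 2) (by linarith))] with y hy hz hb
    have hzs := contMDiffAt_zeta hp.mem_atlas p hz.1
    have h3 := hsum α β _ ((starRingEnd ℂ) (zeta c p y)) (h y) hα hz.2 (by simp)
      ((‖α‖ - ‖β‖) / 2) (by linarith) hb
    refine ⟨(hlog _ y (contMDiffAt_mul' hy (hinv _ y (contMDiffAt_const_mul hzs α)
      (mul_ne_zero hα hz.2))) h3).add contMDiffAt_const, ?_⟩
    have h5 := hz.2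
    rw [Complex.exp_add, Complex.exp_log (Complex.slitPlane_ne_zero h3),
      Complex.exp_log hα, zpow_one]
    field_simp

end

/-! ### Moving zeros -/

section
variable {M : Type*} [TopologicalSpace M] [ChartedSpace Plane M] [IsManifold (𝓡 2) ∞ M]

theorem exists_bump [T2Space M] (p : M) {U : Set M} (hU : U ∈ 𝓝 p) : ∃ ψ : M → ℂ,
    (∀ x, ContMDiffAt (𝓡 2) 𝓘(ℝ, ℂ) ∞ ψ x) ∧ (∀ᶠ x in 𝓝 p, ψ x = 1) ∧ tsupport ψ ⊆ U := by
  obtain ⟨f, -, hf⟩ := (SmoothBumpFunction.nhds_basis_tsupport (I := 𝓡 2) p).mem_iff.1 hU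
  refine ⟨fun x ↦ (f x : ℂ), fun x ↦ ?_, ?_, ?_⟩
  · exact ContMDiffAt.comp x (contMDiffAt_iff_contDiffAt.2 Complex.ofRealCLM.contDiff.contDiffAt)
      (f.contMDiff x)
  · filter_upwards [f.eventuallyEq_one] with x hx
    rw [hx]
    simp
  · refine (closure_mono fun x hx ↦ ?_).trans hf
    rw [Function.mem_support] at hx ⊢
    exact fun h ↦ hx (by rw [h]; simp)

theorem contMDiffAt_mul_of_tsupport {ψ f : M → ℂ} {U : Set M} {x : M}
    (hψ : ContMDiffAt (𝓡 2) 𝓘(ℝ, ℂ) ∞ ψ x) (hU : tsupport ψ ⊆ U)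
    (hf : x ∈ U → ContMDiffAt (𝓡 2) 𝓘(ℝ, ℂ) ∞ f x) :
    ContMDiffAt (𝓡 2) 𝓘(ℝ, ℂ) ∞ (fun y ↦ ψ y * f y) x := by
  by_cases hx : x ∈ tsupport ψ
  · exact contMDiffAt_mul' hψ (hf (hU hx))
  · refine (contMDiffAt_const (c := (0 : ℂ))).congr_of_eventuallyEq ?_
    filter_upwards [notMem_tsupport_iff_eventuallyEq.1 hx] with y hy
    rw [hy, Pi.zero_apply, zero_mul]

theorem dfun_zeta_injective {c : OpenPartialHomeomorph M Plane} {p : M} {x : M}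
    (hp : IsChartAt c x) (a : ℂ) : Function.Injective (dfun (fun y ↦ zeta c p y - a) x) := by
  have hx := hp.mem_source
  have h1 := coordForm_dfun hp.mem_atlas (c.map_source hx) (f := fun y ↦ zeta c p y - a) (by
    rw [c.left_inv hx]
    exact ((contMDiffAt_zeta hp.mem_atlas p hx).sub contMDiffAt_const).mdifferentiableAt (by simp))
  have h2 : HasFDerivAt ((fun y ↦ zeta c p y - a) ∘ c.symm)
      (planeIso.toContinuousLinearEquiv : Plane →L[ℝ] ℂ) (c x) := by
    have h3 : HasFDerivAt (fun y : Plane ↦ planeIso (y - c p) - a)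
        (planeIso.toContinuousLinearEquiv : Plane →L[ℝ] ℂ) (c x) :=
      (HasFDerivAt.comp (g := planeIso) (c x) (planeIso.toContinuousLinearEquiv.hasFDerivAt)
        ((hasFDerivAt_id (c x)).sub_const (c p))).sub_const a
    refine h3.congr_of_eventuallyEq ?_
    filter_upwards [c.open_target.mem_nhds (c.map_source hx)] with y hy
    rw [Function.comp_apply, zeta, c.right_inv hy]
  have h3 := coordForm_dchart hp.mem_atlas (dfun (fun y ↦ zeta c p y - a)) hx
  rw [h1.unique h2] at h3
  rw [← h3]
  refine planeIso.injective.comp (Function.LeftInverse.injective (g := dsymm c (c x)) fun v ↦ ?_)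
  exact congrArg (fun L : Plane →L[ℝ] Plane ↦ L v) (dsymm_dchart hp.mem_atlas hx)

variable {c : M → OpenPartialHomeomorph M Plane}

/-- `n` is the divisor of a function. -/
def IsPrincipal (c : M → OpenPartialHomeomorph M Plane) (n : M → ℤ) : Prop :=
  ∃ f : M → ℂ, ∀ x, HasOrderAt (c x) f x (n x)

/-- The group of principal divisors. -/
def principal (hc : ∀ p, IsChartAt (c p) p) : AddSubgroup (M → ℤ) where
  carrier := {n | IsPrincipal c n}
  zero_mem' := ⟨fun _ ↦ 1, fun _ ↦
    HasOrderAt.of_smooth (.of_forall fun _ ↦ contMDiffAt_const) one_ne_zero⟩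
  add_mem' := by
    rintro n m ⟨f, hf⟩ ⟨g, hg⟩
    exact ⟨_, fun x ↦ (hf x).mul (hc x) (hg x)⟩
  neg_mem' := by
    rintro n ⟨f, hf⟩
    refine ⟨fun y ↦ f y ^ (-1 : ℤ), fun x ↦ ?_⟩
    have := (hf x).zpow (-1)
    rwa [neg_one_mul] at this

-- Near `p` take `ζ / (ζ - a)`, with `a` the coordinate of `q`. Away from both points it has a
-- logarithm, which a cutoff brings down to `0`. The sign of `m` depends on whether the charts
-- chosen at `p` and `q` have the same orientation.
open Classical in
theorem eventually_exists_mem_principal [T2Space M] (hc : ∀ p, IsChartAt (c p) p) (p : M) :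
    ∀ᶠ q in 𝓝 p, ∃ m : ℤ, (m = 1 ∨ m = -1) ∧
      (Pi.single p 1 + Pi.single q m : M → ℤ) ∈ principal hc := by
  have hp := hc p
  set C := c p with hC
  obtain ⟨ψ, hψ, hψ1, hψs⟩ := exists_bump p (C.open_source.mem_nhds hp.mem_source)
  obtain ⟨V, hV1, hV, hpV⟩ := eventually_nhds_iff.1 hψ1
  have h1 := (C.continuousAt_symm (C.map_source hp.mem_source))
  rw [ContinuousAt, C.left_inv hp.mem_source] at h1
  obtain ⟨r, hr, hB⟩ := Metric.mem_nhds_iff.1 (h1.eventually (hV.mem_nhds hpV))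
  have hzV : ∀ x ∈ C.source, ‖zeta C p x‖ < r → x ∈ V := by
    intro x hx hxr
    have h2 : C x ∈ Metric.ball (C p) r := by
      rwa [zeta, LinearIsometryEquiv.norm_map, ← dist_eq_norm] at hxr
    have h3 : C.symm (C x) ∈ V := hB h2
    rwa [C.left_inv hx] at h3
  have hzc : ContinuousAt (zeta C p) p := (contMDiffAt_zeta hp.mem_atlas p hp.mem_source).continuousAt
  filter_upwards [C.open_source.mem_nhds hp.mem_source, hzc.norm.eventually_lt_const
    (show ‖zeta C p p‖ < r by rwa [zeta_self, norm_zero])] with q hq hqr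
  by_cases hqp : q = p
  · refine ⟨-1, .inr rfl, ?_⟩
    rw [hqp, ← Pi.single_add]
    simp
  have hCq : IsChartAt C q := ⟨hp.mem_atlas, hq⟩
  set a := zeta C p q with ha
  have ha0 : a ≠ 0 := hp.zeta_ne_zero hq hqp
  have hzs : ∀ x ∈ C.source, ContMDiffAt (𝓡 2) 𝓘(ℝ, ℂ) ∞ (zeta C p) x := fun x hx ↦
    contMDiffAt_zeta hp.mem_atlas p hx
  have hzs' : ∀ x ∈ C.source, ContMDiffAt (𝓡 2) 𝓘(ℝ, ℂ) ∞ (fun y ↦ zeta C p y - a) x :=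
    fun x hx ↦ (hzs x hx).sub contMDiffAt_const
  have hza : ∀ x ∈ C.source, x ≠ q → zeta C p x - a ≠ 0 := by
    intro x hx hxq h
    refine hxq (C.injOn hx hq ?_)
    exact sub_left_injective (planeIso.injective (sub_eq_zero.1 h))
  have hinv : ∀ g : M → ℂ, ∀ y, ContMDiffAt (𝓡 2) 𝓘(ℝ, ℂ) ∞ g y → g y ≠ 0 →
      ContMDiffAt (𝓡 2) 𝓘(ℝ, ℂ) ∞ (fun y ↦ (g y)⁻¹) y := fun g y hg hy ↦
    contMDiffAt_comp' (F := fun z ↦ z⁻¹) ((contDiffAt_inv ℂ hy).restrict_scalars ℝ) hg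
  obtain ⟨k, hk, hord⟩ := exists_hasOrderAt (hc q) (h := fun y ↦ zeta C p y - a)
    (by filter_upwards [C.open_source.mem_nhds hq] with y hy using hzs' y hy) (sub_self a)
    (dfun_zeta_injective hCq a)
  -- Where `ψ = 1` this is `ζ / (ζ - a)`, whatever the branch of the logarithm; where `ψ = 0` it is
  -- `1`.
  set f : M → ℂ := fun x ↦ Complex.exp (-(ψ x * Complex.log ((zeta C p x - a) / zeta C p x)))
    with hf
  have hfV : ∀ x ∈ V ∩ C.source, x ≠ p → x ≠ q → f x = zeta C p x * (zeta C p x - a) ^ (-1 : ℤ) := by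
    intro x hx hxp hxq
    have h2 := hp.zeta_ne_zero hx.2 hxp
    have h3 := hza x hx.2 hxq
    simp only [hf]
    rw [hV1 x hx.1, one_mul, Complex.exp_neg, Complex.exp_log (div_ne_zero h3 h2), inv_div,
      zpow_neg_one, div_eq_mul_inv]
  have hVo : IsOpen (V ∩ C.source) := hV.inter C.open_source
  have hqV : q ∈ V := hzV q hq hqr
  refine ⟨-k, by rcases hk with rfl | rfl <;> simp, f, fun x ↦ ?_⟩
  by_cases hxp : x = p
  · rw [hxp, Pi.add_apply, Pi.single_eq_same, Pi.single_eq_of_ne (Ne.symm hqp)]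
    have h2 : HasOrderAt (c p) (zeta C p) p 1 := ⟨fun _ ↦ 0, .of_forall fun y ↦
      ⟨contMDiffAt_const, by rw [zpow_one, Complex.exp_zero, mul_one]⟩⟩
    have h3 : HasOrderAt (c p) (fun y ↦ zeta C p y - a) p 0 := HasOrderAt.of_smooth
      (by filter_upwards [C.open_source.mem_nhds hp.mem_source] with y hy using hzs' y hy)
      (hza p hp.mem_source (Ne.symm hqp))
    have h4 := h2.mul (hc p) (h3.zpow (-1))
    rw [mul_zero] at h4
    refine h4.congr ?_
    filter_upwards [nhdsWithin_le_nhds (hVo.mem_nhds ⟨hpV, hp.mem_source⟩), self_mem_nhdsWithin,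
      nhdsWithin_le_nhds (isOpen_ne.mem_nhds (Ne.symm hqp))] with y h5 h6 h7 using hfV y h5 h6 h7
  by_cases hxq : x = q
  · rw [hxq, Pi.add_apply, Pi.single_eq_same, Pi.single_eq_of_ne hqp]
    have h3 : HasOrderAt (c q) (zeta C p) q 0 := HasOrderAt.of_smooth
      (by filter_upwards [C.open_source.mem_nhds hq] with y hy using hzs y hy) ha0
    have h4 := h3.mul (hc q) (hord.zpow (-1))
    rw [neg_one_mul] at h4
    refine h4.congr ?_
    filter_upwards [nhdsWithin_le_nhds (hVo.mem_nhds ⟨hqV, hq⟩), self_mem_nhdsWithin,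
      nhdsWithin_le_nhds (isOpen_ne.mem_nhds hqp)] with y h5 h6 h7 using hfV y h5 h7 h6
  rw [Pi.add_apply, Pi.single_eq_of_ne hxp, Pi.single_eq_of_ne hxq, add_zero]
  refine HasOrderAt.of_smooth ?_ (Complex.exp_ne_zero _)
  have hev : ∀ᶠ y in 𝓝 x, y ≠ p ∧ y ≠ q :=
    Filter.Eventually.and (isOpen_ne.mem_nhds hxp) (isOpen_ne.mem_nhds hxq)
  filter_upwards [hev] with x hx
  obtain ⟨hxp, hxq⟩ := hx
  -- For `|ζ| ≤ |a| < r` the point is in `V`, where `f` is the explicit quotient. For `|ζ| > |a|`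
  -- the ratio `1 - a / ζ` lies within distance one of `1`, so the logarithm is smooth.
  by_cases hcase : x ∈ C.source ∧ ‖zeta C p x‖ ≤ ‖a‖
  · have hxV : x ∈ V ∩ C.source := ⟨hzV x hcase.1 (hcase.2.trans_lt hqr), hcase.1⟩
    have h2 : ContMDiffAt (𝓡 2) 𝓘(ℝ, ℂ) ∞ (fun y ↦ zeta C p y * (zeta C p y - a)⁻¹) x :=
      contMDiffAt_mul' (hzs x hcase.1) (hinv _ x (hzs' x hcase.1) (hza x hcase.1 hxq))
    refine h2.congr_of_eventuallyEq ?_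
    filter_upwards [hVo.mem_nhds hxV, isOpen_ne.mem_nhds hxp, isOpen_ne.mem_nhds hxq] with y h5 h6 h7
    rw [hfV y h5 h6 h7, zpow_neg_one]
  · refine contMDiffAt_comp' (F := fun z ↦ Complex.exp (-z))
      (Complex.contDiff_exp.comp contDiff_neg).contDiffAt
      (contMDiffAt_mul_of_tsupport (hψ x) hψs fun hxs ↦ ?_)
    have h2 : ‖a‖ < ‖zeta C p x‖ := not_le.1 fun h ↦ hcase ⟨hxs, h⟩
    have h3 := hp.zeta_ne_zero hxs hxp
    refine contMDiffAt_comp' (F := Complex.log) ((Complex.contDiffAt_log ?_).restrict_scalars ℝ)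
      (contMDiffAt_mul' (hzs' x hxs) (hinv _ x (hzs x hxs) h3))
    have h4 : (zeta C p x - a) / zeta C p x = 1 + -a / zeta C p x := by
      field_simp
      ring
    rw [h4]
    refine Complex.mem_slitPlane_of_norm_lt_one ?_
    rwa [norm_div, norm_neg, div_lt_one (norm_pos_iff.2 h3)]

-- Connectedness propagates the local statement. For neighbours `m = ±1`, so multiplying by `m`
-- exchanges `p` and `q`; transitivity eliminates the middle point.
open Classical in
theorem exists_mem_principal [T2Space M] [ConnectedSpace M] (hc : ∀ p, IsChartAt (c p) p)
    (p q : M) : ∃ m : ℤ, (Pi.single p 1 + Pi.single q m : M → ℤ) ∈ principal hc := by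
  have hsm : ∀ (p : M) (m k : ℤ), m • (Pi.single p k : M → ℤ) = Pi.single p (m * k) := by
    intro p m k
    rw [← Pi.single_smul, smul_eq_mul]
  refine PreconnectedSpace.induction₂'
    (fun p q : M ↦ ∃ m : ℤ, (Pi.single p 1 + Pi.single q m : M → ℤ) ∈ principal hc) (fun p ↦ ?_)
    ⟨fun p q r ↦ ?_⟩ p q
  · filter_upwards [eventually_exists_mem_principal hc p] with q hq
    obtain ⟨m, hm, h⟩ := hq
    refine ⟨⟨m, h⟩, m, ?_⟩
    have h1 := (principal hc).zsmul_mem h m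
    rw [smul_add, hsm, hsm, mul_one, add_comm] at h1
    have h2 : m * m = 1 := by rcases hm with rfl | rfl <;> rfl
    rwa [h2] at h1
  · rintro ⟨m, h⟩ ⟨k, h'⟩
    refine ⟨-(m * k), ?_⟩
    have h1 := (principal hc).sub_mem h ((principal hc).zsmul_mem h' m)
    rw [smul_add, hsm, hsm, mul_one] at h1
    convert h1 using 1
    rw [Pi.single_neg]
    abel

end

/-! ### Sections with a single zero -/

/-- Each member of a finite cover contains at most its centre as an exceptional point. -/
theorem finite_of_eventually_nhdsNE {X : Type*} [TopologicalSpace X] [CompactSpace X]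
    {P : X → Prop} (h : ∀ x, ∀ᶠ y in 𝓝[≠] x, P y) : {x | ¬P x}.Finite := by
  choose U hU hUP using fun x ↦ mem_nhdsWithin_iff_exists_mem_nhds_inter.1 (h x)
  obtain ⟨t, ht⟩ := CompactSpace.elim_nhds_subcover U hU
  refine t.finite_toSet.subset fun x hx ↦ ?_
  obtain ⟨y, hy, hxy⟩ := Set.mem_iUnion₂.1 (ht.symm ▸ Set.mem_univ x : x ∈ ⋃ y ∈ t, U y)
  by_cases hne : x = y
  · rwa [hne]
  · exact absurd (hUP y ⟨hxy, hne⟩) hx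

section
variable {M : Type*} [TopologicalSpace M] [ChartedSpace Plane M] [IsManifold (𝓡 2) ∞ M] [T2Space M]

/-- Take `g = -ψ l` with `l` the exponent and `ψ` a bump function at `p`; the factor `exp g` creates
no zero elsewhere. -/
theorem HasOrderAt.exists_normal_form {c : OpenPartialHomeomorph M Plane} {p : M} {h : M → ℂ}
    {k : ℤ} (hh : HasOrderAt c h p k) : ∃ g : M → ℂ,
      (∀ x, x ≠ p → ContMDiffAt (𝓡 2) 𝓘(ℝ, ℂ) ∞ g x) ∧
      ∀ᶠ y in 𝓝[≠] p, h y * Complex.exp (g y) = zeta c p y ^ k := by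
  obtain ⟨l, hl⟩ := hh
  obtain ⟨U, hU, hUl⟩ := mem_nhdsWithin_iff_exists_mem_nhds_inter.1 hl
  obtain ⟨ψ, hψ, hψ1, hψU⟩ := exists_bump p hU
  refine ⟨fun x ↦ ψ x * (-1 * l x), fun x hx ↦ contMDiffAt_mul_of_tsupport (hψ x) hψU fun hxU ↦
    contMDiffAt_const_mul (hUl ⟨hxU, hx⟩).1 (-1), ?_⟩
  filter_upwards [hl, nhdsWithin_le_nhds hψ1] with y hy hy'
  rw [hy', hy.2, one_mul, mul_assoc, ← Complex.exp_add, neg_one_mul, add_neg_cancel,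
    Complex.exp_zero, mul_one]

variable {e : M → M → ℂ} {c : M → OpenPartialHomeomorph M Plane}

theorem HasOrderAt.eventually_isSectionAt (he : IsFlatFrame e) {C : OpenPartialHomeomorph M Plane}
    {s : M → ℂ} {x : M} {k : ℤ} (hc : IsChartAt C x)
    (h : HasOrderAt C (fun y ↦ e x y * s y) x k) : ∀ᶠ y in 𝓝[≠] x, IsSectionAt e s y := by
  filter_upwards [h.eventually_nhds hc, nhdsWithin_le_nhds (he.domain_mem_nhds x)] with y hy hy'
  exact isSectionAt_of_contMDiffAt he hy' (right_ne_zero_of_mul hy.1) hy.2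

theorem IsSectionAt.mul_exp {s g : M → ℂ} {x : M} (h : IsSectionAt e s x)
    (hg : ContMDiffAt (𝓡 2) 𝓘(ℝ, ℂ) ∞ g x) :
    IsSectionAt e (fun y ↦ s y * Complex.exp (g y)) x := by
  refine ⟨mul_ne_zero h.ne_zero (Complex.exp_ne_zero _), ?_⟩
  refine (contMDiffAt_mul' h.smooth (contMDiffAt_comp' (F := Complex.exp)
    Complex.contDiff_exp.contDiffAt hg)).congr_of_eventuallyEq (.of_forall fun y ↦ ?_)
  exact (mul_assoc _ _ _).symm

theorem HasOrderAt.mul_exp {C : OpenPartialHomeomorph M Plane} {s g : M → ℂ} {x b : M} {k : ℤ}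
    (h : HasOrderAt C (fun y ↦ e b y * s y) x k)
    (hg : ∀ᶠ y in 𝓝[≠] x, ContMDiffAt (𝓡 2) 𝓘(ℝ, ℂ) ∞ g y) :
    HasOrderAt C (fun y ↦ e b y * (s y * Complex.exp (g y))) x k := by
  obtain ⟨l, hl⟩ := h
  refine ⟨fun y ↦ l y + g y, ?_⟩
  filter_upwards [hl, hg] with y hy hy'
  refine ⟨hy.1.add hy', ?_⟩
  rw [← mul_assoc, hy.2, Complex.exp_add]
  ring

theorem hasOrderAt_of_isSectionAt (he : IsFlatFrame e) {C : OpenPartialHomeomorph M Plane}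
    {s : M → ℂ} {x : M} (h : ∀ᶠ y in 𝓝 x, IsSectionAt e s y) :
    HasOrderAt C (fun y ↦ e x y * s y) x 0 := by
  refine HasOrderAt.of_smooth ?_ (mul_ne_zero (he.ne_zero x x) h.self_of_nhds.ne_zero)
  filter_upwards [h, he.domain_mem_nhds x] with y hy hy' using hy.contMDiffAt he hy'

/-- Points of order zero are removable: the normal form makes the section equal to `1` in the flat
frame on a punctured neighbourhood, and its value at the point is then redefined. The set `F` lists
the points still to be treated. -/
theorem exists_section_of_ne_zero (he : IsFlatFrame e) {n : M → ℤ}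
    (F : Finset M) : ∀ s : M → ℂ, (∀ x, HasOrderAt (c x) (fun y ↦ e x y * s y) x (n x)) →
      (∀ x, x ∉ F → n x = 0 → IsSectionAt e s x) →
      ∃ s' : M → ℂ, (∀ x, HasOrderAt (c x) (fun y ↦ e x y * s' y) x (n x)) ∧
        ∀ x, n x = 0 → IsSectionAt e s' x := by
  classical
  induction F using Finset.induction_on with
  | empty => exact fun s h1 h2 ↦ ⟨s, h1, fun x ↦ h2 x (Finset.notMem_empty x)⟩
  | insert p F hpF ih =>
    intro s h1 h2
    by_cases hn : n p = 0
    swap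
    · refine ih s h1 fun x hx hnx ↦ h2 x (fun h ↦ ?_) hnx
      rcases Finset.mem_insert.1 h with rfl | h
      exacts [hn hnx, hx h]
    obtain ⟨g, hg, hgp⟩ := (h1 p).exists_normal_form
    have hne : ∀ x, ∀ᶠ y in 𝓝[≠] x, y ≠ p := by
      intro x
      by_cases hx : x = p
      · rw [hx]
        exact self_mem_nhdsWithin
      · exact nhdsWithin_le_nhds (isOpen_ne.mem_nhds hx)
    have h3 : ∀ x, HasOrderAt (c x) (fun y ↦ e x y * (s y * Complex.exp (g y))) x (n x) :=
      fun x ↦ (h1 x).mul_exp (by filter_upwards [hne x] with y hy using hg y hy)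
    set s' : M → ℂ := Function.update (fun y ↦ s y * Complex.exp (g y)) p (e p p)⁻¹ with hs'
    have hs'p : s' p = (e p p)⁻¹ := Function.update_self _ _ _
    have hs'x : ∀ x, x ≠ p → s' x = s x * Complex.exp (g x) := fun x hx ↦
      Function.update_of_ne hx _ _
    refine ih s' (fun x ↦ (h3 x).congr ?_) fun x hx hnx ↦ ?_
    · filter_upwards [hne x] with y hy
      rw [hs'x y hy]
    · by_cases hxp : x = p
      · rw [hxp]
        refine ⟨by rw [hs'p]; exact inv_ne_zero (he.ne_zero p p), ?_⟩
        refine (contMDiffAt_const (c := (1 : ℂ))).congr_of_eventuallyEq ?_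
        filter_upwards [eventually_nhdsWithin_iff.1 hgp] with y hy
        by_cases hyp : y = p
        · rw [hyp, hs'p, mul_inv_cancel₀ (he.ne_zero p p)]
        · have := hy hyp
          rw [hn, zpow_zero, mul_assoc] at this
          rw [hs'x y hyp, this]
      · have h4 := (h2 x (fun h ↦ (Finset.mem_insert.1 h).elim hxp hx) hnx).mul_exp (hg x hxp)
        have h5 : ∀ᶠ y in 𝓝 x, s' y = s y * Complex.exp (g y) := by
          filter_upwards [isOpen_ne.mem_nhds hxp] with y hy using hs'x y hy
        refine ⟨by rw [h5.self_of_nhds]; exact h4.ne_zero, h4.smooth.congr_of_eventuallyEq ?_⟩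
        filter_upwards [h5] with y hy
        rw [hy]

-- Divide by a function whose divisor carries all zeros to `q`, repair the removable points, and
-- normalize at `q`.
open Classical in
theorem exists_isSectionAt_off_point [CompactSpace M] [ConnectedSpace M] (he : IsFlatFrame e)
    (hc : ∀ p, IsChartAt (c p) p) {s : M → ℂ} {n : M → ℤ}
    (hs : ∀ x, HasOrderAt (c x) (fun y ↦ e x y * s y) x (n x)) (q : M) :
    ∃ (N : ℤ) (s' : M → ℂ), (∀ x, x ≠ q → IsSectionAt e s' x) ∧
      ∀ᶠ y in 𝓝[≠] q, e q y * s' y = zeta (c q) q y ^ N := by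
  have hF : {x | ¬IsSectionAt e s x}.Finite :=
    finite_of_eventually_nhdsNE fun x ↦ (hs x).eventually_isSectionAt he (hc x)
  have hev : ∀ {s : M → ℂ} {n : M → ℤ},
      (∀ x, HasOrderAt (c x) (fun y ↦ e x y * s y) x (n x)) → ∀ x, IsSectionAt e s x →
      ∀ᶠ y in 𝓝 x, IsSectionAt e s y := by
    intro s n hs x hx
    filter_upwards [eventually_nhdsWithin_iff.1 ((hs x).eventually_isSectionAt he (hc x))] with y hy
    by_cases h : y = x
    · rwa [h]
    · exact hy h
  -- Orders are not known to be unique, so the order is reset to `0` where `s` is already a smooth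
  -- nonzero section; this makes the divisor finitely supported.
  set n' : M → ℤ := fun x ↦ if IsSectionAt e s x then 0 else n x
  have hs' : ∀ x, HasOrderAt (c x) (fun y ↦ e x y * s y) x (n' x) := by
    intro x
    by_cases hx : IsSectionAt e s x
    · rw [show n' x = 0 from if_pos hx]
      exact hasOrderAt_of_isSectionAt he (hev hs x hx)
    · rw [show n' x = n x from if_neg hx]
      exact hs x
  choose m hm using fun p ↦ exists_mem_principal hc p q
  set F := hF.toFinset
  have h1 : ∑ p ∈ F, n' p • (Pi.single p 1 + Pi.single q (m p) : M → ℤ) ∈ principal hc :=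
    (principal hc).sum_mem fun p _ ↦ (principal hc).zsmul_mem (hm p) _
  -- Trading each `[p]` for `-m p [q]` leaves this multiplicity at `q`.
  set N : ℤ := -∑ p ∈ F, n' p * m p with hN
  have h2 : ∑ p ∈ F, n' p • (Pi.single p 1 + Pi.single q (m p) : M → ℤ) = n' - Pi.single q N := by
    funext x
    have h3 : ∑ p ∈ F, n' p * (Pi.single p 1 : M → ℤ) x = n' x := by
      simp only [Pi.single_apply, mul_ite, mul_one, mul_zero, Finset.sum_ite_eq]
      split_ifs with hx
      · rfl
      · rw [Set.Finite.mem_toFinset, Set.mem_ofPred_eq, not_not] at hx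
        exact (if_pos hx).symm
    have h4 : ∑ p ∈ F, n' p * (Pi.single q (m p) : M → ℤ) x = -(Pi.single q N : M → ℤ) x := by
      by_cases hx : x = q
      · rw [hx]
        simp [hN]
      · simp [Pi.single_eq_of_ne hx]
    simp only [Finset.sum_apply, Pi.smul_apply, Pi.add_apply, smul_eq_mul, mul_add,
      Finset.sum_add_distrib, Pi.sub_apply]
    rw [h3, h4, sub_eq_add_neg]
  rw [h2] at h1
  obtain ⟨f, hf⟩ := h1
  have h5 : ∀ x, HasOrderAt (c x) (fun y ↦ e x y * (s y * f y ^ (-1 : ℤ))) x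
      ((Pi.single q N : M → ℤ) x) := by
    intro x
    have h6 := (hs' x).mul (hc x) ((hf x).zpow (-1))
    have h7 : n' x + -1 * (n' - Pi.single q N : M → ℤ) x = (Pi.single q N : M → ℤ) x := by
      rw [Pi.sub_apply]
      ring
    rw [h7] at h6
    exact h6.congr (.of_forall fun y ↦ (mul_assoc _ _ _).symm)
  have hF2 : {x | ¬IsSectionAt e (fun y ↦ s y * f y ^ (-1 : ℤ)) x}.Finite :=
    finite_of_eventually_nhdsNE fun x ↦ (h5 x).eventually_isSectionAt he (hc x)
  obtain ⟨s₁, h8, h9⟩ := exists_section_of_ne_zero he hF2.toFinset _ h5 fun x hx _ ↦ by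
    rwa [Set.Finite.mem_toFinset, Set.mem_ofPred_eq, not_not] at hx
  have h10 := h8 q
  rw [Pi.single_eq_same] at h10
  obtain ⟨g, hg, hgq⟩ := h10.exists_normal_form
  refine ⟨N, fun y ↦ s₁ y * Complex.exp (g y), fun x hx ↦ (h9 x ?_).mul_exp (hg x hx), ?_⟩
  · exact Pi.single_eq_of_ne (M := fun _ ↦ ℤ) hx N
  · filter_upwards [hgq] with y hy
    rw [← hy, mul_assoc]

end

/-! ### Generic sections -/

/-- A real-linear map from the plane to `ℂ` as an endomorphism of the plane. -/
def toEnd (L : Plane →L[ℝ] ℂ) : Plane →L[ℝ] Plane :=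
  (planeIso.symm.toContinuousLinearEquiv : ℂ →L[ℝ] Plane) ∘L L

theorem continuous_toEnd : Continuous toEnd :=
  (ContinuousLinearMap.compL ℝ Plane ℂ Plane
    (planeIso.symm.toContinuousLinearEquiv : ℂ →L[ℝ] Plane)).continuous

theorem injective_of_det_toEnd {L : Plane →L[ℝ] ℂ} (h : (toEnd L).det ≠ 0) :
    Function.Injective L := by
  have h1 : Function.Injective (toEnd L) := by
    have h2 : (toEnd L : Plane →ₗ[ℝ] Plane).det ≠ 0 := h
    have := (LinearMap.equivOfDetNeZero _ h2).injective
    exact this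
  exact fun v w hvw ↦ h1 (congrArg planeIso.symm hvw)

section
variable {ι : Type*} [Fintype ι]

/-- The coefficients for which a linear combination has only nondegenerate zeros on `K`. -/
def genericCoeff (G : ι → Plane → ℂ) (K : Set Plane) : Set (ι → ℂ) :=
  {a | ∀ y ∈ K, ∑ i, a i * G i y = 0 → (toEnd (∑ i, a i • fderiv ℝ (G i) y)).det ≠ 0}

/-- The condition is open in the pair `(a, y)`, and compactness of `K` makes it uniform in `y`. -/
theorem isOpen_genericCoeff {G : ι → Plane → ℂ} {K : Set Plane} (hK : IsCompact K)
    (hG : ∀ y ∈ K, ∀ i, ContDiffAt ℝ ∞ (G i) y) : IsOpen (genericCoeff G K) := by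
  rw [isOpen_iff_eventually]
  intro a ha
  refine hK.eventually_forall_of_forall_eventually
    (P := fun (a : ι → ℂ) (y : Plane) ↦ ∑ i, a i * G i y = 0 →
      (toEnd (∑ i, a i • fderiv ℝ (G i) y)).det ≠ 0) fun y hy ↦ ?_
  have hai : ∀ i, ContinuousAt (fun z : (ι → ℂ) × Plane ↦ z.1 i) (a, y) := fun i ↦
    ((continuous_apply i).comp continuous_fst).continuousAt
  have h1 : ContinuousAt (fun z : (ι → ℂ) × Plane ↦ ∑ i, z.1 i * G i z.2) (a, y) :=
    tendsto_finsetSum _ fun i _ ↦ (hai i).mul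
      (ContinuousAt.comp (g := G i) (f := Prod.snd) (hG y hy i).continuousAt continuousAt_snd)
  have h2 : ContinuousAt (fun z : (ι → ℂ) × Plane ↦ ∑ i, z.1 i • fderiv ℝ (G i) z.2) (a, y) :=
    tendsto_finsetSum _ fun i _ ↦ (hai i).smul
      (ContinuousAt.comp (g := fderiv ℝ (G i)) (f := Prod.snd)
        ((hG y hy i).fderiv_right (m := ∞) (by simp)).continuousAt continuousAt_snd)
  have h3 : ContinuousAt (fun z : (ι → ℂ) × Plane ↦
      (toEnd (∑ i, z.1 i • fderiv ℝ (G i) z.2)).det) (a, y) :=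
    (ContinuousLinearMap.continuous_det.comp continuous_toEnd).continuousAt.comp h2
  by_cases h0 : ∑ i, a i * G i y = 0
  · filter_upwards [h3.eventually_ne (ha y hy h0)] with z hz _ using hz
  · filter_upwards [h1.eventually_ne h0] with z hz h using absurd h hz

/-- A case of Sard's theorem. Near `K` the function `G i₀` is `1`, so changing its coefficient
translates the combination without changing its derivative; a small shift moves `0` off the critical
values. -/
theorem dense_genericCoeff {G : ι → Plane → ℂ} {K : Set Plane}
    (hG : ∀ y ∈ K, ∀ i, ContDiffAt ℝ ∞ (G i) y) (i₀ : ι)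
    (h₀ : ∀ y ∈ K, G i₀ =ᶠ[𝓝 y] fun _ ↦ 1) : Dense (genericCoeff G K) := by
  classical
  rw [Metric.dense_iff]
  intro a r hr
  set f : Plane → Plane := fun y ↦ planeIso.symm (∑ i, a i * G i y)
  set Z : Set Plane := {y ∈ K | (toEnd (∑ i, a i • fderiv ℝ (G i) y)).det = 0}
  have hf : ∀ y ∈ Z, HasFDerivWithinAt f (toEnd (∑ i, a i • fderiv ℝ (G i) y)) Z y := by
    intro y hy
    have h1 : HasFDerivAt (fun y ↦ ∑ i, a i * G i y) (∑ i, a i • fderiv ℝ (G i) y) y :=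
      HasFDerivAt.fun_sum fun i _ ↦
        ((hG y hy.1 i).differentiableAt (by simp)).hasFDerivAt.const_mul (a i)
    exact (HasFDerivAt.comp (g := planeIso.symm) y
      planeIso.symm.toContinuousLinearEquiv.hasFDerivAt h1).hasFDerivWithinAt
  have hnull := MeasureTheory.addHaar_image_eq_zero_of_det_fderivWithin_eq_zero
    MeasureTheory.volume hf fun y hy ↦ hy.2
  have hd : Dense (f '' Z)ᶜ := MeasureTheory.Measure.dense_of_ae (μ := MeasureTheory.volume)
    (MeasureTheory.compl_mem_ae_iff.2 hnull)
  obtain ⟨w, hw, hwr⟩ := Metric.dense_iff.1 hd 0 r hr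
  rw [Metric.mem_ball, dist_zero_right] at hw
  set t := -planeIso w
  have ht : ‖t‖ = ‖w‖ := by rw [norm_neg, LinearIsometryEquiv.norm_map]
  -- A degenerate zero of the perturbed combination would be a critical point of `f` with value `w`.
  refine ⟨a + Pi.single i₀ t, ?_, fun y hy h hdet ↦ ?_⟩
  · rw [Metric.mem_ball, dist_eq_norm, add_sub_cancel_left, Pi.norm_single, ht]
    exact hw
  have h1 : ∑ i, (a + Pi.single i₀ t : ι → ℂ) i * G i y = ∑ i, a i * G i y + t := by
    simp only [Pi.add_apply, add_mul, Finset.sum_add_distrib, Pi.single_apply, ite_mul, zero_mul,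
      Finset.sum_ite_eq', Finset.mem_univ, if_true]
    rw [(h₀ y hy).self_of_nhds, mul_one]
  have h2 : ∑ i, (a + Pi.single i₀ t : ι → ℂ) i • fderiv ℝ (G i) y =
      ∑ i, a i • fderiv ℝ (G i) y := by
    have h3 : fderiv ℝ (G i₀) y = 0 := by
      rw [(h₀ y hy).fderiv_eq, fderiv_fun_const]
      rfl
    refine Finset.sum_congr rfl fun i _ ↦ ?_
    by_cases hi : i = i₀
    · rw [hi, h3]
      exact ContinuousLinearMap.ext fun v ↦ (mul_zero _).trans (mul_zero _).symm
    · rw [Pi.add_apply, Pi.single_eq_of_ne hi, add_zero]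
  rw [h2] at hdet
  rw [h1] at h
  refine hwr ⟨y, ⟨hy, hdet⟩, ?_⟩
  change planeIso.symm (∑ i, a i * G i y) = w
  rw [eq_neg_of_add_eq_zero_left h, neg_neg, LinearIsometryEquiv.symm_apply_apply]

end

section
variable {M : Type*} [TopologicalSpace M] [ChartedSpace Plane M] [IsManifold (𝓡 2) ∞ M] [T2Space M]
variable {e : M → M → ℂ} {c : M → OpenPartialHomeomorph M Plane}

/-- The candidates are combinations of the cut-off flat sections `ψ i / e i`. On each `K b` one of
them is `1` in the frame `e b`, so generic coefficients exist there, and Baire makes them work on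
all `K b` at once. -/
theorem exists_hasOrderAt_section [CompactSpace M] (he : IsFlatFrame e)
    (hc : ∀ p, IsChartAt (c p) p) : ∃ (s : M → ℂ) (n : M → ℤ), ∀ x,
      HasOrderAt (c x) (fun y ↦ e x y * s y) x (n x) := by
  classical
  have hU : ∀ b, IsFlatFrame.domain e b ∩ (c b).source ∈ 𝓝 b := fun b ↦
    Filter.inter_mem (he.domain_mem_nhds b) ((c b).open_source.mem_nhds (hc b).mem_source)
  choose ψ hψ hψ1 hψU using fun b ↦ exists_bump b (hU b)
  choose K hKb hK hKψ using fun b ↦ exists_mem_nhds_isClosed_subset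
    (isOpen_interior.mem_nhds (mem_interior_iff_mem_nhds.2 (hψ1 b)))
  obtain ⟨t, ht⟩ := CompactSpace.elim_nhds_subcover K hKb
  have hKψ' : ∀ b, ∀ x ∈ K b, ∀ᶠ y in 𝓝 x, ψ b y = 1 := fun b x hx ↦
    mem_interior_iff_mem_nhds.1 (hKψ b hx)
  have hKU : ∀ b, ∀ x ∈ K b, x ∈ IsFlatFrame.domain e b ∩ (c b).source := by
    intro b x hx
    refine hψU b (subset_tsupport _ ?_)
    rw [Function.mem_support, (hKψ' b x hx).self_of_nhds]
    exact one_ne_zero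
  set F : t → M → M → ℂ := fun i b x ↦ e b x * (ψ i x / e i x) with hF
  have hFs : ∀ i b, ∀ x ∈ IsFlatFrame.domain e b, ContMDiffAt (𝓡 2) 𝓘(ℝ, ℂ) ∞ (F i b) x := by
    intro i b x hx
    have h1 : F i b = fun y ↦ ψ i y * (e b y / e i y) := by
      funext y
      simp only [hF]
      ring
    rw [h1]
    refine contMDiffAt_mul_of_tsupport (hψ i x) (hψU i) fun hxi ↦ ?_
    exact contMDiffAt_const.congr_of_eventuallyEq (he.div_eventually_const hx hxi.1)
  set G : M → t → Plane → ℂ := fun b i ↦ F i b ∘ (c b).symm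
  have hGs : ∀ b, ∀ y ∈ c b '' K b, ∀ i, ContDiffAt ℝ ∞ (G b i) y := by
    rintro b _ ⟨x, hx, rfl⟩ i
    have h1 := (hKU b x hx).2
    refine contDiffAt_comp_symm (hc b).mem_atlas ((c b).map_source h1) ?_
    rw [(c b).left_inv h1]
    exact hFs i b x (hKU b x hx).1
  have hG1 : ∀ b : t, ∀ y ∈ c b '' K b, G b b =ᶠ[𝓝 y] fun _ ↦ 1 := by
    rintro b _ ⟨x, hx, rfl⟩
    have h1 := (hKU b x hx).2
    have h2 := (c b).continuousAt_symm ((c b).map_source h1)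
    rw [ContinuousAt, (c b).left_inv h1] at h2
    filter_upwards [h2.eventually (hKψ' b x hx)] with y hy
    have h3 := he.ne_zero b ((c b).symm y)
    change e b ((c b).symm y) * (ψ b ((c b).symm y) / e b ((c b).symm y)) = 1
    rw [hy]
    field_simp
  have hKc : ∀ b, IsCompact (c b '' K b) := fun b ↦ (hK b).isCompact.image_of_continuousOn
    ((c b).continuousOn.mono fun x hx ↦ (hKU b x hx).2)
  obtain ⟨a, ha⟩ := (dense_iInter_of_isOpen
    (fun b : t ↦ isOpen_genericCoeff (hKc b) (hGs b))
    (fun b : t ↦ dense_genericCoeff (hGs b) b (hG1 b))).nonempty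
  rw [Set.mem_iInter] at ha
  set s : M → ℂ := fun x ↦ ∑ i : t, a i * (ψ i x / e i x) with hs
  have hes : ∀ b, (fun x ↦ e b x * s x) = fun x ↦ ∑ i, a i * F i b x := by
    intro b
    funext x
    simp only [hs, hF, Finset.mul_sum]
    exact Finset.sum_congr rfl fun i _ ↦ mul_left_comm _ _ _
  have hsm : ∀ b, ∀ x ∈ IsFlatFrame.domain e b,
      ContMDiffAt (𝓡 2) 𝓘(ℝ, ℂ) ∞ (fun x ↦ e b x * s x) x := by
    intro b x hx
    rw [hes]
    exact contMDiffAt_finsetSum fun i _ ↦ contMDiffAt_const_mul (hFs i b x hx) _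
  have hord : ∀ x, ∃ n, HasOrderAt (c x) (fun y ↦ e x y * s y) x n := by
    intro x
    have hev : ∀ᶠ y in 𝓝 x, ContMDiffAt (𝓡 2) 𝓘(ℝ, ℂ) ∞ (fun y ↦ e x y * s y) y := by
      filter_upwards [he.domain_mem_nhds x] with y hy using hsm x y hy
    by_cases h0 : s x = 0
    swap
    · exact ⟨0, HasOrderAt.of_smooth hev (mul_ne_zero (he.ne_zero x x) h0)⟩
    obtain ⟨b, hb, hxb⟩ := Set.mem_iUnion₂.1 (ht.symm ▸ Set.mem_univ x : x ∈ ⋃ b ∈ t, K b)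
    obtain ⟨hxd, hxc⟩ := hKU b x hxb
    have h1 := ha ⟨b, hb⟩ (c b x) ⟨x, hxb, rfl⟩ (by
      have h2 := congrFun (hes b) x
      simp only [h0, mul_zero] at h2
      rw [h2]
      refine Finset.sum_congr rfl fun i _ ↦ ?_
      change _ * F i b ((c b).symm (c b x)) = _
      rw [(c b).left_inv hxc])
    have hbs := hsm b x hxd
    have h2 := coordForm_dfun (hc b).mem_atlas ((c b).map_source hxc) (f := fun x ↦ e b x * s x)
      (by rw [(c b).left_inv hxc]; exact hbs.mdifferentiableAt (by simp))
    have h3 : HasFDerivAt ((fun x ↦ e b x * s x) ∘ (c b).symm)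
        (∑ i, a i • fderiv ℝ (G b i) (c b x)) (c b x) := by
      rw [hes]
      exact HasFDerivAt.fun_sum fun i _ ↦
        ((hGs b _ ⟨x, hxb, rfl⟩ i).differentiableAt (by simp)).hasFDerivAt.const_mul (a i)
    have h4 := injective_of_det_toEnd h1
    rw [← h2.unique h3] at h4
    have h5 : Function.Injective (dfun (fun x ↦ e b x * s x) x) := by
      rw [← coordForm_dchart (hc b).mem_atlas (dfun fun x ↦ e b x * s x) hxc]
      exact h4.comp (Function.LeftInverse.injective (g := dsymm (c b) (c b x)) fun v ↦
        congrArg (fun L : Plane →L[ℝ] Plane ↦ L v) (dsymm_dchart (hc b).mem_atlas hxc))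
    have hev' : ∀ᶠ y in 𝓝 x, ContMDiffAt (𝓡 2) 𝓘(ℝ, ℂ) ∞ (fun y ↦ e b y * s y) y := by
      filter_upwards [(IsFlatFrame.isOpen_domain e b).mem_nhds hxd] with y hy using hsm b y hy
    obtain ⟨k, -, hk⟩ := exists_hasOrderAt (hc x) hev' (by simp only [h0, mul_zero]) h5
    have h6 : HasOrderAt (c x) (fun _ ↦ e x x / e b x) x 0 :=
      HasOrderAt.of_smooth (.of_forall fun _ ↦ contMDiffAt_const)
        (div_ne_zero (he.ne_zero x x) (he.ne_zero b x))
    -- The order was found in the frame `e b`; passing to `e x` multiplies by a nonzero constant, of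
    -- order `0`.
    refine ⟨0 + k, (h6.mul (hc x) hk).congr ?_⟩
    filter_upwards [nhdsWithin_le_nhds (IsFlatFrame.eventually_of_mem_domain hxd)] with y hy
    have := he.ne_zero b x
    field_simp
    linear_combination -s y * hy
  choose n hn using hord
  exact ⟨s, n, hn⟩

end

/-! ### Stokes' theorem -/

/-- The basis of the plane corresponding to `1` and `i`. -/
def planeBasis : Module.Basis (Fin 2) ℝ Plane :=
  Complex.basisOneI.map planeIso.symm.toLinearEquiv

theorem planeBasis_zero : planeBasis 0 = planeIso.symm 1 := by
  rw [planeBasis, Module.Basis.map_apply, Complex.coe_basisOneI]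
  rfl

theorem planeBasis_one : planeBasis 1 = planeIso.symm Complex.I := by
  rw [planeBasis, Module.Basis.map_apply, Complex.coe_basisOneI]
  rfl

/-- A two-form on the plane scales by the determinant; this matches the Jacobian in the change of
variables. -/
theorem planeDer_map (A : Plane → Plane →L[ℝ] ℂ) (y : Plane) (D : Plane →L[ℝ] Plane) :
    planeDer A y (D (planeBasis 0)) (D (planeBasis 1)) =
      D.det * planeDer A y (planeBasis 0) (planeBasis 1) := by
  have h : ∀ j, D (planeBasis j) = planeBasis.repr (D (planeBasis j)) 0 • planeBasis 0 +
      planeBasis.repr (D (planeBasis j)) 1 • planeBasis 1 := by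
    intro j
    conv_lhs => rw [← planeBasis.sum_repr (D (planeBasis j)), Fin.sum_univ_two]
  have hdet : D.det = planeBasis.repr (D (planeBasis 0)) 0 * planeBasis.repr (D (planeBasis 1)) 1 -
      planeBasis.repr (D (planeBasis 1)) 0 * planeBasis.repr (D (planeBasis 0)) 1 := by
    have : D.det = LinearMap.det (D : Plane →ₗ[ℝ] Plane) := rfl
    rw [this, ← LinearMap.det_toMatrix planeBasis, Matrix.det_fin_two]
    simp only [LinearMap.toMatrix_apply, ContinuousLinearMap.coe_coe]
  have h0 := h 0
  have h1 := h 1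
  clear h
  generalize planeBasis.repr (D (planeBasis 0)) 0 = p at h0 hdet
  generalize planeBasis.repr (D (planeBasis 0)) 1 = q at h0 hdet
  generalize planeBasis.repr (D (planeBasis 1)) 0 = r at h1 hdet
  generalize planeBasis.repr (D (planeBasis 1)) 1 = s at h1 hdet
  rw [hdet, h0, h1]
  simp only [planeDer, _root_.map_add, map_smul, _root_.add_apply, _root_.smul_apply,
    Complex.real_smul]
  push_cast
  ring

theorem integral_planeDer {A : Plane → Plane →L[ℝ] ℂ} (hA : ContDiff ℝ ∞ A)
    (hc : HasCompactSupport A) (u v : Plane) : ∫ y, planeDer A y u v = 0 := by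
  have h1 : ∀ v : Plane, ContDiff ℝ ∞ fun y ↦ A y v := fun v ↦ hA.clm_apply contDiff_const
  have h2 : ∀ v : Plane, HasCompactSupport fun y ↦ A y v := fun v ↦
    hc.comp_left (g := fun L : Plane →L[ℝ] ℂ ↦ L v) rfl
  have h3 : ∀ u v y : Plane, fderiv ℝ (fun y ↦ A y v) y u = fderiv ℝ A y u v := by
    intro u v y
    have := (hA.differentiable (by simp) y).hasFDerivAt.clm_apply (hasFDerivAt_const v y)
    rw [this.fderiv]
    simp
  have h4 : ∀ u v : Plane, MeasureTheory.Integrable fun y ↦ fderiv ℝ (fun y ↦ A y v) y u := by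
    intro u v
    refine Continuous.integrable_of_hasCompactSupport ?_ ?_
    · exact ((h1 v).continuous_fderiv (by simp)).clm_apply continuous_const
    · exact ((h2 v).fderiv ℝ).comp_left (g := fun L : Plane →L[ℝ] ℂ ↦ L u) rfl
  have h5 : ∀ u v : Plane, ∫ y, fderiv ℝ (fun y ↦ A y v) y u = 0 := by
    intro u v
    -- Integration by parts against the constant function `1`.
    have := integral_mul_fderiv_eq_neg_fderiv_mul_of_integrable (μ := MeasureTheory.volume)
      (f := fun _ : Plane ↦ (1 : ℂ)) (g := fun y ↦ A y v) (v := u) (by simp)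
      (by simpa only [one_mul] using h4 u v)
      (by simpa only [one_mul] using (h1 v).continuous.integrable_of_hasCompactSupport (h2 v))
      (fun _ _ ↦ differentiableAt_const _) fun y _ ↦ (h1 v).differentiable (by simp) y
    simpa using this
  have h6 : (fun y ↦ planeDer A y u v) = fun y ↦ fderiv ℝ (fun y ↦ A y v) y u -
      fderiv ℝ (fun y ↦ A y u) y v := by
    funext y
    rw [planeDer, h3, h3]
  rw [h6, MeasureTheory.integral_sub (h4 u v) (h4 v u), h5, h5, sub_self]

section
variable {M : Type*} [TopologicalSpace M] [ChartedSpace Plane M] [IsManifold (𝓡 2) ∞ M]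
variable {c c' : OpenPartialHomeomorph M Plane} {w : M → Plane →L[ℝ] ℂ}

/-- The density of the exterior derivative of a one-form in a chart. -/
def extDensity (w : M → Plane →L[ℝ] ℂ) (c : OpenPartialHomeomorph M Plane) (y : Plane) : ℂ :=
  planeDer (coordForm w c) y (planeBasis 0) (planeBasis 1)

/-- The integral of `φ dw` over the domain of a chart. -/
def chartIntegral (c : OpenPartialHomeomorph M Plane) (φ : M → ℂ) (w : M → Plane →L[ℝ] ℂ) : ℂ :=
  ∫ y in c.target, φ (c.symm y) * extDensity w c y

theorem extDensity_congr {w w' : M → Plane →L[ℝ] ℂ} {x : M} (hx : x ∈ c.source)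
    (h : w =ᶠ[𝓝 x] w') : extDensity w c (c x) = extDensity w' c (c x) :=
  planeDer_congr (coordForm_congr hx h) _ _

theorem extDensity_eq_zero {x : M} (hx : x ∈ c.source) (h : w =ᶠ[𝓝 x] fun _ ↦ 0) :
    extDensity w c (c x) = 0 := by
  rw [extDensity_congr hx h, extDensity, planeDer]
  have : coordForm (fun _ : M ↦ (0 : Plane →L[ℝ] ℂ)) c = fun _ ↦ 0 := by
    funext y
    exact ContinuousLinearMap.zero_comp _
  rw [this, fderiv_fun_const]
  simp

theorem extDensity_eq_zero_of_isClosedFormAt (hc : c ∈ IsManifold.maximalAtlas (𝓡 2) ∞ M) {x : M}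
    (hx : x ∈ c.source) (hw : IsSmoothFormAt w x) (h : IsClosedFormAt w x) :
    extDensity w c (c x) = 0 := isClosedFormAt_iff_of hc hx hw h _ _

theorem continuousAt_extDensity (hc : c ∈ IsManifold.maximalAtlas (𝓡 2) ∞ M)
    (hw : ∀ x, IsSmoothFormAt w x) {y : Plane} (hy : y ∈ c.target) :
    ContinuousAt (extDensity w c) y := by
  have h1 := (isSmoothFormAt_iff hc (c.map_target hy)).1 (hw (c.symm y))
  rw [c.right_inv hy] at h1
  have h2 := (h1.fderiv_right (m := ∞) (by simp)).continuousAt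
  exact ((h2.clm_apply continuousAt_const).clm_apply continuousAt_const).sub
    ((h2.clm_apply continuousAt_const).clm_apply continuousAt_const)

theorem integrableOn_extDensity (hc : c ∈ IsManifold.maximalAtlas (𝓡 2) ∞ M)
    (hw : ∀ x, IsSmoothFormAt w x) {φ : M → ℂ} (hφ : Continuous φ) {K : Set M} (hK : IsCompact K)
    (hKc : K ⊆ c.source) (h : ∀ x ∈ c.source, x ∉ K → φ x * extDensity w c (c x) = 0) :
    MeasureTheory.IntegrableOn (fun y ↦ φ (c.symm y) * extDensity w c y) c.target := by
  have h1 : IsCompact (c '' K) := hK.image_of_continuousOn (c.continuousOn.mono hKc)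
  have h2 : c '' K ⊆ c.target := by
    rintro _ ⟨x, hx, rfl⟩
    exact c.map_source (hKc hx)
  refine MeasureTheory.IntegrableOn.of_forall_sdiff_eq_zero (ContinuousOn.integrableOn_compact h1 ?_)
    c.open_target.measurableSet ?_
  · intro y hy
    exact ((hφ.continuousAt.comp (c.continuousAt_symm (h2 hy))).mul
      (continuousAt_extDensity hc hw (h2 hy))).continuousWithinAt
  · rintro y ⟨hy, hyK⟩
    have := h (c.symm y) (c.map_target hy) fun h' ↦ hyK ⟨_, h', c.right_inv hy⟩
    rwa [c.right_inv hy] at this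

theorem chartIntegral_one_eq_zero [T2Space M] (hc : c ∈ IsManifold.maximalAtlas (𝓡 2) ∞ M)
    (hw : ∀ x, IsSmoothFormAt w x) {K : Set M} (hK : IsCompact K)
    (hKc : K ⊆ c.source) (h : ∀ x, x ∉ K → w x = 0) : chartIntegral c (fun _ ↦ 1) w = 0 := by
  classical
  have h1 : IsCompact (c '' K) := hK.image_of_continuousOn (c.continuousOn.mono hKc)
  -- Compact support inside the chart lets the coordinate expression be extended by zero to the
  -- whole plane.
  set A : Plane → Plane →L[ℝ] ℂ := fun y ↦ if y ∈ c.target then coordForm w c y else 0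
  have hAK : ∀ y, y ∉ c '' K → A y = 0 := by
    intro y hy
    by_cases hyt : y ∈ c.target
    · have h2 : w (c.symm y) = 0 := h _ fun h' ↦ hy ⟨_, h', c.right_inv hyt⟩
      simp only [A, if_pos hyt, coordForm, h2]
      exact ContinuousLinearMap.zero_comp _
    · exact if_neg hyt
  have hAt : ∀ y ∈ c.target, A =ᶠ[𝓝 y] coordForm w c := by
    intro y hy
    filter_upwards [c.open_target.mem_nhds hy] with z hz using if_pos hz
  have hAo : ∀ y ∉ c.target, A =ᶠ[𝓝 y] fun _ ↦ 0 := by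
    intro y hy
    have hyK : y ∈ (c '' K)ᶜ := by
      rintro ⟨x, hx, rfl⟩
      exact hy (c.map_source (hKc hx))
    filter_upwards [h1.isClosed.isOpen_compl.mem_nhds hyK] with z hz using hAK z hz
  have hA : ContDiff ℝ ∞ A := by
    rw [contDiff_iff_contDiffAt]
    intro y
    by_cases hy : y ∈ c.target
    · have h2 := (isSmoothFormAt_iff hc (c.map_target hy)).1 (hw (c.symm y))
      rw [c.right_inv hy] at h2
      exact h2.congr_of_eventuallyEq (hAt y hy)
    · exact contDiffAt_const.congr_of_eventuallyEq (hAo y hy)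
  rw [← integral_planeDer hA (HasCompactSupport.intro h1 hAK) (planeBasis 0) (planeBasis 1),
    ← MeasureTheory.setIntegral_eq_integral_of_forall_compl_eq_zero (s := c.target)]
  · refine MeasureTheory.setIntegral_congr_fun c.open_target.measurableSet fun y hy ↦ ?_
    change 1 * extDensity w c y = planeDer A y _ _
    rw [planeDer_congr (hAt y hy), one_mul, extDensity]
  · intro y hy
    rw [planeDer_congr (hAo y hy), planeDer, fderiv_fun_const]
    simp

/-- Each integrand vanishes off the overlap, where the transition map is a change of variables.
Orientability enters here: the positive Jacobian equals its absolute value. -/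
theorem chartIntegral_eq_chartIntegral (hc : c ∈ IsManifold.maximalAtlas (𝓡 2) ∞ M)
    (hc' : c' ∈ IsManifold.maximalAtlas (𝓡 2) ∞ M)
    (hpos : ∀ y ∈ (c.symm.trans c').source, 0 < (fderiv ℝ (c.symm.trans c') y).det)
    (hw : ∀ x, IsSmoothFormAt w x) {φ : M → ℂ}
    (h : ∀ x ∈ c.source, x ∉ c'.source → φ x * extDensity w c (c x) = 0)
    (h' : ∀ x ∈ c'.source, x ∉ c.source → φ x * extDensity w c' (c' x) = 0) :
    chartIntegral c φ w = chartIntegral c' φ w := by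
  set τ := c.symm.trans c' with hτ
  have hsrc : ∀ y ∈ τ.source, y ∈ c.target ∧ c.symm y ∈ c'.source := fun y hy ↦ by
    rwa [hτ, OpenPartialHomeomorph.trans_source, OpenPartialHomeomorph.symm_source] at hy
  have htgt : ∀ y ∈ τ.target, y ∈ c'.target ∧ c'.symm y ∈ c.source := fun y hy ↦ by
    rwa [hτ, OpenPartialHomeomorph.trans_target, OpenPartialHomeomorph.symm_target] at hy
  have hder : ∀ y ∈ τ.source, HasFDerivWithinAt τ (fderiv ℝ τ y) τ.source y := fun y hy ↦
    ((contDiffAt_transition hc hc' (hsrc y hy).1 (hsrc y hy).2).differentiableAt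
      (by simp)).hasFDerivAt.hasFDerivWithinAt
  have h1 : chartIntegral c φ w = ∫ y in τ.source, φ (c.symm y) * extDensity w c y := by
    refine MeasureTheory.setIntegral_eq_of_subset_of_forall_sdiff_eq_zero c.open_target.measurableSet
      (fun y hy ↦ (hsrc y hy).1) ?_
    rintro y ⟨hy, hy'⟩
    have := h (c.symm y) (c.map_target hy) fun h2 ↦ hy' (by
      rw [hτ, OpenPartialHomeomorph.trans_source, OpenPartialHomeomorph.symm_source]
      exact ⟨hy, h2⟩)
    rwa [c.right_inv hy] at this
  have h2 : chartIntegral c' φ w = ∫ y in τ.target, φ (c'.symm y) * extDensity w c' y := by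
    refine MeasureTheory.setIntegral_eq_of_subset_of_forall_sdiff_eq_zero
      c'.open_target.measurableSet (fun y hy ↦ (htgt y hy).1) ?_
    rintro y ⟨hy, hy'⟩
    have := h' (c'.symm y) (c'.map_target hy) fun h2 ↦ hy' (by
      rw [hτ, OpenPartialHomeomorph.trans_target, OpenPartialHomeomorph.symm_target]
      exact ⟨hy, h2⟩)
    rwa [c'.right_inv hy] at this
  rw [h1, h2, ← τ.image_source_eq_target,
    MeasureTheory.integral_image_eq_integral_abs_det_fderiv_smul MeasureTheory.volume
      τ.open_source.measurableSet hder τ.injOn]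
  refine MeasureTheory.setIntegral_congr_fun τ.open_source.measurableSet fun y hy ↦ ?_
  obtain ⟨hy1, hy2⟩ := hsrc y hy
  have h3 : c'.symm (τ y) = c.symm y := c'.left_inv hy2
  have h4 : extDensity w c y = (fderiv ℝ τ y).det * extDensity w c' (τ y) := by
    rw [extDensity, planeDer_transition hc hc' hy1 hy2 (hw _)]
    exact planeDer_map _ _ _
  change _ = |(fderiv ℝ τ y).det| • (φ (c'.symm (τ y)) * extDensity w c' (τ y))
  rw [h3, h4, abs_of_pos (hpos y hy), Complex.real_smul]
  ring

theorem extDensity_sum {ι : Type*} [Fintype ι] {β : ι → M → Plane →L[ℝ] ℂ}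
    (hc : c ∈ IsManifold.maximalAtlas (𝓡 2) ∞ M) (hβ : ∀ i x, IsSmoothFormAt (β i) x)
    (h : ∀ x, ∑ i, β i x = w x) {y : Plane} (hy : y ∈ c.target) :
    ∑ i, extDensity (β i) c y = extDensity w c y := by
  have h1 : coordForm w c = fun y ↦ ∑ i, coordForm (β i) c y := by
    funext y
    rw [coordForm, ← h]
    refine ContinuousLinearMap.ext fun v ↦ ?_
    simp [coordForm]
  have h2 : ∀ i, DifferentiableAt ℝ (coordForm (β i) c) y := fun i ↦ by
    have h1 := (isSmoothFormAt_iff hc (c.map_target hy)).1 (hβ i (c.symm y))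
    rw [c.right_inv hy] at h1
    exact h1.differentiableAt (by simp)
  have h3 : fderiv ℝ (coordForm w c) y = ∑ i, fderiv ℝ (coordForm (β i) c) y := by
    rw [h1]
    exact fderiv_fun_sum fun i _ ↦ h2 i
  simp only [extDensity, planeDer, h3]
  rw [Finset.sum_sub_distrib]
  simp

theorem exists_partition [T2Space M] [CompactSpace M] {A : Set (OpenPartialHomeomorph M Plane)}
    (hA : ∀ x, ∃ c ∈ A, x ∈ c.source) : ∃ (t : Finset (OpenPartialHomeomorph M Plane))
      (ψ : t → M → ℂ), (∀ i ∈ t, i ∈ A) ∧ (∀ i x, ContMDiffAt (𝓡 2) 𝓘(ℝ, ℂ) ∞ (ψ i) x) ∧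
      (∀ i, tsupport (ψ i) ⊆ i.1.source) ∧ ∀ x, ∑ i, ψ i x = 1 := by
  classical
  choose c hcA hc using hA
  obtain ⟨t, ht⟩ := CompactSpace.elim_nhds_subcover (fun x ↦ (c x).source)
    fun x ↦ (c x).open_source.mem_nhds (hc x)
  set T := t.image c
  obtain ⟨f, hf⟩ := SmoothPartitionOfUnity.exists_isSubordinate (𝓡 2) (s := (Set.univ : Set M))
    isClosed_univ (fun i : T ↦ i.1.source) (fun i ↦ i.1.open_source) fun x _ ↦ by
      obtain ⟨y, hy, hxy⟩ := Set.mem_iUnion₂.1 (ht.symm ▸ Set.mem_univ x : x ∈ ⋃ y ∈ t, (c y).source)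
      exact Set.mem_iUnion.2 ⟨⟨c y, Finset.mem_image_of_mem c hy⟩, hxy⟩
  refine ⟨T, fun i x ↦ (f i x : ℂ), fun i hi ↦ ?_, fun i x ↦ ?_, fun i ↦ ?_, fun x ↦ ?_⟩
  · obtain ⟨y, -, rfl⟩ := Finset.mem_image.1 hi
    exact hcA y
  · exact ContMDiffAt.comp x (contMDiffAt_iff_contDiffAt.2 Complex.ofRealCLM.contDiff.contDiffAt)
      ((f i).contMDiff x)
  · refine (closure_mono fun x hx ↦ ?_).trans (hf i)
    rw [Function.mem_support] at hx ⊢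
    exact fun h ↦ hx (by simp [h])
  · have := f.sum_eq_one (Set.mem_univ x)
    rw [finsum_eq_sum_of_fintype] at this
    rw [← Complex.ofReal_sum, this, Complex.ofReal_one]

/-- Stokes' theorem for a one-form that is closed outside the domain of a chart. -/
theorem chartIntegral_eq_zero [T2Space M] [CompactSpace M]
    {A : Set (OpenPartialHomeomorph M Plane)} (hA : A ⊆ IsManifold.maximalAtlas (𝓡 2) ∞ M)
    (hcov : ∀ x, ∃ c ∈ A, x ∈ c.source)
    (hpos : ∀ c ∈ A, ∀ c' ∈ A, ∀ y ∈ (c.symm.trans c').source,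
      0 < (fderiv ℝ (c.symm.trans c') y).det) (hc : c ∈ A) (hw : ∀ x, IsSmoothFormAt w x)
    {K : Set M} (hK : IsCompact K) (hKc : K ⊆ c.source) (h : ∀ x, x ∉ K → IsClosedFormAt w x) :
    chartIntegral c (fun _ ↦ 1) w = 0 := by
  obtain ⟨t, ψ, htA, hψ, hψs, hψ1⟩ := exists_partition hcov
  have hψc : ∀ i, Continuous (ψ i) := fun i ↦ continuous_iff_continuousAt.2 fun x ↦
    (hψ i x).continuousAt
  have htc : ∀ i : t, i.1 ∈ IsManifold.maximalAtlas (𝓡 2) ∞ M := fun i ↦ hA (htA _ i.2)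
  have hKt : ∀ i, IsCompact (tsupport (ψ i)) := fun i ↦ (isClosed_tsupport _).isCompact
  have hψ0 : ∀ i x, x ∉ tsupport (ψ i) → ψ i x = 0 := fun i x ↦ image_eq_zero_of_notMem_tsupport
  -- Two partitions act at once: `β j` splits the form, so that each `∫ dβ_j` vanishes in its own
  -- chart, while `ψ k` splits the domain of integration. No integral over all of `M` is needed,
  -- only chart integrals of `ψ k dβ_j`, which may be moved between charts.
  set β : t → M → Plane →L[ℝ] ℂ := fun j x ↦ ψ j x • w x
  have hβ : ∀ j x, IsSmoothFormAt (β j) x := fun j x ↦ (hw x).smul (hψ j x)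
  have hβ0 : ∀ j x, x ∉ tsupport (ψ j) → β j =ᶠ[𝓝 x] fun _ ↦ 0 := by
    intro j x hx
    filter_upwards [notMem_tsupport_iff_eventuallyEq.1 hx] with y hy
    refine ContinuousLinearMap.ext fun v ↦ ?_
    change ψ j y * w y v = 0
    rw [hy, Pi.zero_apply, zero_mul]
  have hβs : ∀ x, ∑ j, β j x = w x := by
    intro x
    refine ContinuousLinearMap.ext fun v ↦ ?_
    simp only [_root_.sum_apply]
    change ∑ j, ψ j x * w x v = w x v
    rw [← Finset.sum_mul, hψ1, one_mul]
  have h1 : ∀ j, chartIntegral j.1 (fun _ ↦ 1) (β j) = 0 := fun j ↦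
    chartIntegral_one_eq_zero (htc j) (hβ j) (hKt j) (hψs j) fun x hx ↦ (hβ0 j x hx).self_of_nhds
  have hsum : ∀ (c : OpenPartialHomeomorph M Plane) (v : M → Plane →L[ℝ] ℂ),
      c ∈ IsManifold.maximalAtlas (𝓡 2) ∞ M → (∀ x, IsSmoothFormAt v x) → ∀ K, IsCompact K →
      K ⊆ c.source → (∀ x ∈ c.source, x ∉ K → extDensity v c (c x) = 0) →
      ∑ k, chartIntegral c (ψ k) v = chartIntegral c (fun _ ↦ 1) v := by
    intro c v hc hv K hK hKc hz
    simp only [chartIntegral]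
    rw [← MeasureTheory.integral_finsetSum]
    · refine MeasureTheory.setIntegral_congr_fun c.open_target.measurableSet fun y _ ↦ ?_
      change ∑ k, ψ k (c.symm y) * extDensity v c y = _
      rw [← Finset.sum_mul, hψ1]
    · intro k _
      exact integrableOn_extDensity hc hv (hψc k) hK hKc fun x hx hxK ↦ by
        rw [hz x hx hxK, mul_zero]
  have h2 : ∀ j, ∑ k, chartIntegral j.1 (ψ k) (β j) = 0 := fun j ↦
    (hsum _ _ (htc j) (hβ j) _ (hKt j) (hψs j) fun x hx hxK ↦
      extDensity_eq_zero hx (hβ0 j x hxK)).trans (h1 j)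
  have h3 : ∀ j k, chartIntegral j.1 (ψ k) (β j) = chartIntegral k.1 (ψ k) (β j) := fun j k ↦
    chartIntegral_eq_chartIntegral (htc j) (htc k) (hpos _ (htA _ j.2) _ (htA _ k.2)) (hβ j)
      (fun x _ hx ↦ by rw [hψ0 k x fun h ↦ hx (hψs k h), zero_mul])
      fun x hx hxj ↦ by rw [extDensity_eq_zero hx (hβ0 j x fun h ↦ hxj (hψs j h)), mul_zero]
  have h4 : ∀ k, ∑ j, chartIntegral k.1 (ψ k) (β j) = chartIntegral k.1 (ψ k) w := by
    intro k
    simp only [chartIntegral]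
    rw [← MeasureTheory.integral_finsetSum]
    · refine MeasureTheory.setIntegral_congr_fun k.1.open_target.measurableSet fun y hy ↦ ?_
      change ∑ j, ψ k (k.1.symm y) * extDensity (β j) k.1 y = _
      rw [← Finset.mul_sum, extDensity_sum (htc k) hβ hβs hy]
    · intro j _
      exact integrableOn_extDensity (htc k) (hβ j) (hψc k) (hKt k) (hψs k) fun x hx hxK ↦ by
        rw [hψ0 k x hxK, zero_mul]
  have h5 : ∀ k, chartIntegral k.1 (ψ k) w = chartIntegral c (ψ k) w := fun k ↦
    chartIntegral_eq_chartIntegral (htc k) (hA hc) (hpos _ (htA _ k.2) _ hc) hw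
      (fun x hx hxc ↦ by
        rw [extDensity_eq_zero_of_isClosedFormAt (htc k) hx (hw x) (h x fun h ↦ hxc (hKc h)),
          mul_zero])
      fun x _ hx ↦ by rw [hψ0 k x fun h ↦ hx (hψs k h), zero_mul]
  rw [← hsum c w (hA hc) hw K hK hKc fun x hx hxK ↦
    extDensity_eq_zero_of_isClosedFormAt (hA hc) hx (hw x) (h x hxK)]
  -- Move `ψ k dw` to chart `k`, split `w`, move each piece to chart `j`, and sum over `k` first.
  calc ∑ k, chartIntegral c (ψ k) w = ∑ k, ∑ j, chartIntegral k.1 (ψ k) (β j) :=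
        Finset.sum_congr rfl fun k _ ↦ by rw [h4, h5]
    _ = ∑ j, ∑ k, chartIntegral j.1 (ψ k) (β j) := by
        rw [Finset.sum_comm]
        exact Finset.sum_congr rfl fun j _ ↦ Finset.sum_congr rfl fun k _ ↦ (h3 j k).symm
    _ = 0 := Finset.sum_eq_zero fun j _ ↦ h2 j

end

/-! ### Flat line bundles have degree zero -/

/-- A smooth monotone function vanishing up to `r` and equal to `1` from `2 r` on. -/
def cutoff (r t : ℝ) : ℝ := Real.smoothTransition (t / r - 1)

section
variable {r : ℝ}

theorem contDiff_cutoff (r : ℝ) : ContDiff ℝ ∞ (cutoff r) :=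
  Real.smoothTransition.contDiff.comp ((contDiff_id.div_const r).sub contDiff_const)

theorem cutoff_of_le (hr : 0 < r) {t : ℝ} (ht : t ≤ r) : cutoff r t = 0 := by
  apply Real.smoothTransition.zero_of_nonpos
  rw [sub_nonpos, div_le_one hr]
  exact ht

theorem cutoff_of_ge (hr : 0 < r) {t : ℝ} (ht : 2 * r ≤ t) : cutoff r t = 1 := by
  apply Real.smoothTransition.one_of_one_le
  have : 2 ≤ t / r := by rwa [le_div_iff₀ hr]
  linarith

theorem deriv_cutoff_nonneg (hr : 0 < r) (t : ℝ) : 0 ≤ deriv (cutoff r) t := by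
  refine Monotone.deriv_nonneg fun a b hab ↦ Real.smoothTransition.monotone ?_
  gcongr

theorem deriv_cutoff_of_lt (hr : 0 < r) {t : ℝ} (ht : t < r) : deriv (cutoff r) t = 0 := by
  have : cutoff r =ᶠ[𝓝 t] fun _ ↦ 0 := by
    filter_upwards [Iio_mem_nhds ht] with x hx using cutoff_of_le hr (le_of_lt hx)
  rw [this.deriv_eq, deriv_const]

theorem deriv_cutoff_of_gt (hr : 0 < r) {t : ℝ} (ht : 2 * r < t) : deriv (cutoff r) t = 0 := by
  have : cutoff r =ᶠ[𝓝 t] fun _ ↦ 1 := by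
    filter_upwards [Ioi_mem_nhds ht] with x hx using cutoff_of_ge hr (le_of_lt hx)
  rw [this.deriv_eq, deriv_const]

theorem exists_deriv_cutoff_ne_zero (hr : 0 < r) : ∃ t, 0 < t ∧ deriv (cutoff r) t ≠ 0 := by
  obtain ⟨t, ht, h⟩ := exists_deriv_eq_slope (cutoff r) (show r < 2 * r by linarith)
    (contDiff_cutoff r).continuous.continuousOn
    ((contDiff_cutoff r).differentiable (by simp)).differentiableOn
  refine ⟨t, hr.trans ht.1, ?_⟩
  rw [h, cutoff_of_ge hr le_rfl, cutoff_of_le hr le_rfl]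
  have : 2 * r - r ≠ 0 := by linarith
  rw [sub_zero]
  positivity

end

/-- `planeIso` as a continuous linear map. -/
def planeCLM : Plane →L[ℝ] ℂ := (planeIso.toContinuousLinearEquiv : Plane →L[ℝ] ℂ)

theorem planeDer_smul_const {g : Plane → ℂ} {g' : Plane →L[ℝ] ℂ} {y : Plane}
    (hg : HasFDerivAt g g' y) (L : Plane →L[ℝ] ℂ) (u v : Plane) :
    planeDer (fun z ↦ g z • L) y u v = g' u * L v - g' v * L u := by
  have h := hg.smul_const L
  rw [planeDer, h.fderiv]
  rfl

theorem hasFDerivAt_comp_normSq {T : ℝ → ℝ} {y : Plane} {Z : Plane → ℂ} {L : Plane →L[ℝ] ℂ}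
    (hT : Differentiable ℝ T) (hZ : HasFDerivAt Z L y) :
    HasFDerivAt (fun z ↦ (T (Complex.normSq (Z z)) : ℂ)) (Complex.ofRealCLM ∘L
      (deriv T (Complex.normSq (Z y)) • ((2 * (Z y).re) • (Complex.reCLM ∘L L) +
        (2 * (Z y).im) • (Complex.imCLM ∘L L)))) y := by
  have hre : HasFDerivAt (fun z ↦ (Z z).re) (Complex.reCLM ∘L L) y :=
    Complex.reCLM.hasFDerivAt.comp y hZ
  have him : HasFDerivAt (fun z ↦ (Z z).im) (Complex.imCLM ∘L L) y :=
    Complex.imCLM.hasFDerivAt.comp y hZ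
  have hm : HasFDerivAt (fun z ↦ Complex.normSq (Z z)) ((2 * (Z y).re) • (Complex.reCLM ∘L L) +
      (2 * (Z y).im) • (Complex.imCLM ∘L L)) y := by
    have h := (hre.mul hre).add (him.mul him)
    refine h.congr_fderiv (ContinuousLinearMap.ext fun v ↦ ?_)
    simp only [_root_.add_apply, _root_.smul_apply, smul_eq_mul]
    ring
  have hTm : HasFDerivAt (fun z ↦ T (Complex.normSq (Z z))) _ y :=
    (hT (Complex.normSq (Z y))).hasDerivAt.comp_hasFDerivAt y hm
  exact Complex.ofRealCLM.hasFDerivAt.comp y hTm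

theorem hasFDerivAt_inv_comp {y : Plane} {Z : Plane → ℂ} {L : Plane →L[ℝ] ℂ}
    (hZ : HasFDerivAt Z L y) (h0 : Z y ≠ 0) :
    HasFDerivAt (fun z ↦ (Z z)⁻¹) (-(Z y ^ 2)⁻¹ • L) y :=
  (hasDerivAt_inv h0).comp_hasFDerivAt y hZ

/-- Since `d T(|Z|²) = T' (Z̄ dZ + Z dZ̄)`, only the second term survives the product with `N dZ /
Z`, and `dZ̄ ∧ dZ` takes the value `2i` on the basis `1`, `i`. -/
theorem planeDer_normSq_smul {T : ℝ → ℝ} {y u v : Plane} {Z : Plane → ℂ} {L : Plane →L[ℝ] ℂ}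
    (hT : Differentiable ℝ T) (hZ : HasFDerivAt Z L y) (h0 : Z y ≠ 0) (hu : L u = 1)
    (hv : L v = Complex.I) (N : ℂ) :
    planeDer (fun z ↦ ((T (Complex.normSq (Z z)) : ℂ) * (N * (Z z)⁻¹)) • L) y u v =
      2 * Complex.I * N * deriv T (Complex.normSq (Z y)) := by
  have hg := (hasFDerivAt_comp_normSq hT hZ).mul ((hasFDerivAt_inv_comp hZ h0).const_mul N)
  refine (planeDer_smul_const hg L u v).trans ?_
  simp only [_root_.add_apply, _root_.smul_apply, ContinuousLinearMap.comp_apply, hu, hv,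
    smul_eq_mul, Complex.ofRealCLM_apply, Complex.reCLM_apply,
    Complex.imCLM_apply, Complex.one_re, Complex.one_im, Complex.I_re, Complex.I_im]
  have h : ((Z y).re : ℂ) + (Z y).im * Complex.I = Z y := Complex.re_add_im (Z y)
  generalize (T (Complex.normSq (Z y)) : ℂ) = t
  generalize deriv T (Complex.normSq (Z y)) = t'
  generalize Z y = z at h h0 ⊢
  push_cast
  have h2 : (z.re : ℂ) * Complex.I - z.im = Complex.I * z := by
    linear_combination Complex.I * h - z.im * Complex.I_mul_I
  field_simp
  linear_combination 2 * t' * z * N * h2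

theorem planeCLM_apply (v : Plane) : planeCLM v = planeIso v := rfl

theorem hasFDerivAt_planeIso_sub (p y : Plane) :
    HasFDerivAt (fun z : Plane ↦ planeIso (z - p)) planeCLM y := by
  simp only [← planeCLM_apply]
  have h := planeCLM.hasFDerivAt (x := y - p)
  have h2 : HasFDerivAt (fun z : Plane ↦ z - p) (ContinuousLinearMap.id ℝ Plane) y :=
    (hasFDerivAt_id y).sub_const p
  exact (h.comp y h2).congr_fderiv (ContinuousLinearMap.comp_id _)

theorem planeDer_cutoff_smul {T : ℝ → ℝ} (hT : Differentiable ℝ T) (N : ℂ) {p y : Plane}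
    (hy : y ≠ p) :
    planeDer (fun z ↦ ((T (Complex.normSq (planeIso (z - p))) : ℂ) *
      (N * (planeIso (z - p))⁻¹)) • planeCLM) y (planeBasis 0) (planeBasis 1) =
      2 * Complex.I * N * deriv T (Complex.normSq (planeIso (y - p))) := by
  refine planeDer_normSq_smul hT (hasFDerivAt_planeIso_sub p y) ?_ ?_ ?_ N
  · rwa [Ne, LinearIsometryEquiv.map_eq_zero_iff, sub_eq_zero]
  · rw [planeBasis_zero]
    exact planeIso.apply_symm_apply 1
  · rw [planeBasis_one]
    exact planeIso.apply_symm_apply Complex.I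

/-! ### The logarithmic derivative of a section near its only zero -/

section
variable {M : Type*} [TopologicalSpace M] [ChartedSpace Plane M] [IsManifold (𝓡 2) ∞ M]
variable {c : OpenPartialHomeomorph M Plane}

theorem coordForm_dfun_zeta (hc : c ∈ IsManifold.maximalAtlas (𝓡 2) ∞ M) (p : M) {y : Plane}
    (hy : y ∈ c.target) : coordForm (dfun (zeta c p)) c y = planeCLM := by
  have h1 := coordForm_dfun hc hy (f := zeta c p)
    ((contMDiffAt_zeta hc p (c.map_target hy)).mdifferentiableAt (by simp))
  refine h1.unique ?_
  refine (hasFDerivAt_planeIso_sub (c p) y).congr_of_eventuallyEq ?_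
  filter_upwards [c.open_target.mem_nhds hy] with z hz
  rw [Function.comp_apply, zeta, c.right_inv hz]

theorem coordForm_smul (f : M → ℂ) (w : M → Plane →L[ℝ] ℂ) (y : Plane) :
    coordForm (fun x ↦ f x • w x) c y = f (c.symm y) • coordForm w c y := rfl

theorem sectionForm_of_zpow {e : M → M → ℂ} (he : IsFlatFrame e) {s : M → ℂ} {q x : M} {N : ℤ}
    (hc : IsChartAt c q) (hxc : x ∈ c.source) (hxq : x ≠ q) (hx : x ∈ IsFlatFrame.domain e q)
    (hs : IsSectionAt e s x) (h : ∀ᶠ y in 𝓝 x, e q y * s y = zeta c q y ^ N) :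
    sectionForm e s x = ((N : ℂ) * (zeta c q x)⁻¹) • dfun (zeta c q) x := by
  have h0 := hc.zeta_ne_zero hxc hxq
  have h1 : dfun (fun y ↦ zeta c q y ^ N) x = _ := dfun_comp_of_hasDerivAt
    (F := fun z ↦ z ^ N) (hasDerivAt_zpow N (zeta c q x) (.inl h0))
    ((contMDiffAt_zeta hc.mem_atlas q hxc).mdifferentiableAt (by simp))
  rw [hs.sectionForm_eq he hx, dfun_congr h, h1, h.self_of_nhds]
  refine ContinuousLinearMap.ext fun v ↦ ?_
  simp only [_root_.smul_apply, smul_eq_mul]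
  rw [zpow_sub_one₀ h0]
  have := zpow_ne_zero N h0
  field_simp

end

theorem normSq_planeIso_sub (y p : Plane) : Complex.normSq (planeIso (y - p)) = dist y p ^ 2 := by
  rw [Complex.normSq_eq_norm_sq, planeIso.norm_map, dist_eq_norm]

theorem contDiff_cutoff_normSq (r : ℝ) :
    ContDiff ℝ ∞ fun z : ℂ ↦ (cutoff r (Complex.normSq z) : ℂ) := by
  have h : ContDiff ℝ ∞ fun z : ℂ ↦ Complex.normSq z :=
    (Complex.reCLM.contDiff.mul Complex.reCLM.contDiff).add
      (Complex.imCLM.contDiff.mul Complex.imCLM.contDiff)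
  exact Complex.ofRealCLM.contDiff.comp ((contDiff_cutoff r).comp h)

theorem integral_deriv_cutoff_pos {r : ℝ} (hr : 0 < r) (p : Plane) :
    0 < ∫ y : Plane, deriv (cutoff r) (Complex.normSq (planeIso (y - p))) := by
  have h1 : Continuous fun y : Plane ↦ deriv (cutoff r) (Complex.normSq (planeIso (y - p))) :=
    ((contDiff_cutoff r).continuous_deriv (by simp)).comp (Complex.continuous_normSq.comp
      (planeIso.continuous.comp (continuous_id.sub continuous_const)))
  have h2 : HasCompactSupport fun y : Plane ↦
      deriv (cutoff r) (Complex.normSq (planeIso (y - p))) := by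
    refine HasCompactSupport.intro (isCompact_closedBall p (2 * r + 1)) fun y hy ↦ ?_
    rw [Metric.mem_closedBall, not_le] at hy
    refine deriv_cutoff_of_gt hr ?_
    rw [normSq_planeIso_sub]
    nlinarith
  obtain ⟨t, ht, h3⟩ := exists_deriv_cutoff_ne_zero hr
  -- A point at distance `√t` from `p`, where the squared norm is exactly the `t` with nonzero
  -- derivative.
  refine h1.integral_pos_of_hasCompactSupport_nonneg_nonzero h2
    (fun y ↦ deriv_cutoff_nonneg hr _) (x := planeIso.symm (Real.sqrt t : ℂ) + p) ?_
  rw [add_sub_cancel_right, LinearIsometryEquiv.apply_symm_apply, Complex.normSq_ofReal,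
    Real.mul_self_sqrt ht.le]
  exact h3

section
variable {M : Type*} [TopologicalSpace M] [ChartedSpace Plane M] [IsManifold (𝓡 2) ∞ M]

theorem isSmoothFormAt_of_eventuallyEq_zero {w : M → Plane →L[ℝ] ℂ} {x : M}
    (h : w =ᶠ[𝓝 x] fun _ ↦ 0) : IsSmoothFormAt w x := by
  refine (IsSmoothFormAt.smul (f := fun _ ↦ 0) contMDiffAt_const
    (isSmoothFormAt_dfun (f := fun _ ↦ 0) contMDiffAt_const)).congr ?_
  filter_upwards [h] with y hy
  rw [hy]
  exact ContinuousLinearMap.ext fun v ↦ (zero_mul _).symm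

variable [T2Space M] {e : M → M → ℂ} {s : M → ℂ} {C : OpenPartialHomeomorph M Plane} {q : M}

open Classical in
/-- A cut-off function vanishing near `q`. -/
def chartCutoff (C : OpenPartialHomeomorph M Plane) (q : M) (r : ℝ) (x : M) : ℂ :=
  if x ∈ C.source then (cutoff r (Complex.normSq (zeta C q x)) : ℂ) else 1

theorem chartCutoff_of_mem {r : ℝ} {x : M} (hx : x ∈ C.source) :
    chartCutoff C q r x = (cutoff r (Complex.normSq (zeta C q x)) : ℂ) := if_pos hx

theorem chartCutoff_of_notMem {R r : ℝ} (hr : 0 < r) (hR : 2 * r = R ^ 2) (hR0 : 0 < R) {x : M}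
    (hx : x ∉ C.symm '' Metric.closedBall (C q) R) : chartCutoff C q r x = 1 := by
  by_cases h : x ∈ C.source
  · rw [chartCutoff_of_mem h, cutoff_of_ge hr, Complex.ofReal_one]
    rw [zeta, normSq_planeIso_sub, hR]
    have h1 : ¬ dist (C x) (C q) ≤ R := fun h' ↦ hx ⟨C x, h', C.left_inv h⟩
    gcongr
    exact (not_le.1 h1).le
  · exact if_neg h

theorem contMDiffAt_chartCutoff (hC : IsChartAt C q) {R r : ℝ} (hr : 0 < r) (hR : 2 * r = R ^ 2)
    (hR0 : 0 < R) (hK : IsCompact (C.symm '' Metric.closedBall (C q) R))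
    (hKC : C.symm '' Metric.closedBall (C q) R ⊆ C.source) (x : M) :
    ContMDiffAt (𝓡 2) 𝓘(ℝ, ℂ) ∞ (chartCutoff C q r) x := by
  by_cases hx : x ∈ C.source
  · refine (contMDiffAt_comp' (contDiff_cutoff_normSq r).contDiffAt
      (contMDiffAt_zeta hC.mem_atlas q hx)).congr_of_eventuallyEq ?_
    filter_upwards [C.open_source.mem_nhds hx] with y hy using chartCutoff_of_mem hy
  · refine (contMDiffAt_const (c := (1 : ℂ))).congr_of_eventuallyEq ?_
    filter_upwards [hK.isClosed.isOpen_compl.mem_nhds fun h ↦ hx (hKC h)] with y hy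
      using chartCutoff_of_notMem hr hR hR0 hy

theorem chartCutoff_eventually (hC : IsChartAt C q) {r : ℝ} (hr : 0 < r) :
    ∀ᶠ x in 𝓝 q, chartCutoff C q r x = 0 := by
  have h1 : ContinuousAt (fun x ↦ Complex.normSq (zeta C q x)) q :=
    Complex.continuous_normSq.continuousAt.comp
      (contMDiffAt_zeta hC.mem_atlas q hC.mem_source).continuousAt
  have h2 : ∀ᶠ x in 𝓝 q, Complex.normSq (zeta C q x) < r := h1.eventually_lt_const (by
    change Complex.normSq (zeta C q q) < r
    rwa [zeta_self, map_zero])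
  filter_upwards [h2, C.open_source.mem_nhds hC.mem_source] with x hx hx'
  rw [chartCutoff_of_mem hx', cutoff_of_le hr hx.le, Complex.ofReal_zero]

theorem extDensity_chartCutoff (he : IsFlatFrame e) {N : ℤ} {r : ℝ}
    (hC : IsChartAt C q) (hs : ∀ x, x ≠ q → IsSectionAt e s x) {V : Set M} (hV : IsOpen V)
    (hVq : ∀ y ∈ V, y ∈ IsFlatFrame.domain e q ∧ (y ≠ q → e q y * s y = zeta C q y ^ N))
    {y : Plane} (hy : y ∈ C.target) (hyV : C.symm y ∈ V) (hyq : y ≠ C q) :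
    extDensity (fun x ↦ chartCutoff C q r x • sectionForm e s x) C y =
      2 * Complex.I * N * deriv (cutoff r) (Complex.normSq (planeIso (y - C q))) := by
  rw [← planeDer_cutoff_smul ((contDiff_cutoff r).differentiable (by simp)) N hyq]
  refine planeDer_congr ?_ _ _
  filter_upwards [(C.isOpen_inter_preimage_symm hV).mem_nhds ⟨hy, hyV⟩, isOpen_ne.mem_nhds hyq]
    with z hz hzq
  have hzs := C.map_target hz.1
  have hzeta : zeta C q (C.symm z) = planeIso (z - C q) := by rw [zeta, C.right_inv hz.1]
  have hzq' : C.symm z ≠ q := fun h ↦ hzq (by rw [← h, C.right_inv hz.1])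
  have hform := sectionForm_of_zpow he hC hzs hzq' (hVq _ hz.2).1 (hs _ hzq') (by
    filter_upwards [hV.mem_nhds hz.2, isOpen_ne.mem_nhds hzq'] with x hx hxq
      using (hVq x hx).2 hxq)
  rw [coordForm_smul, coordForm, hform, chartCutoff_of_mem hzs, hzeta,
    ← coordForm_dfun_zeta hC.mem_atlas q hz.1]
  refine ContinuousLinearMap.ext fun v ↦ ?_
  simp only [_root_.smul_apply, smul_eq_mul, ContinuousLinearMap.comp_apply, coordForm, mul_assoc]

/-- Cutting off the logarithmic derivative near `q` gives a global smooth form `α`, closed outside a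
coordinate disc, with `dα = 2iN T'(|ζ|²) dx ∧ dy`. Stokes gives integral zero, while `T' ≥ 0` has
positive integral, so `N = 0`. -/
theorem eq_zero_of_section_off_point [CompactSpace M]
    {A : Set (OpenPartialHomeomorph M Plane)} (hA : A ⊆ IsManifold.maximalAtlas (𝓡 2) ∞ M)
    (hcov : ∀ x, ∃ c ∈ A, x ∈ c.source)
    (hpos : ∀ c ∈ A, ∀ c' ∈ A, ∀ y ∈ (c.symm.trans c').source,
      0 < (fderiv ℝ (c.symm.trans c') y).det) (hCA : C ∈ A) (hqC : q ∈ C.source)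
    (he : IsFlatFrame e) {N : ℤ} (hs : ∀ x, x ≠ q → IsSectionAt e s x)
    (h : ∀ᶠ y in 𝓝[≠] q, e q y * s y = zeta C q y ^ N) : N = 0 := by
  have hC : IsChartAt C q := ⟨hA hCA, hqC⟩
  obtain ⟨V, hVq, hV, hqV⟩ := mem_nhds_iff.1
    (Filter.Eventually.and (he.domain_mem_nhds q) (eventually_nhdsWithin_iff.1 h) : ∀ᶠ y in 𝓝 q, _)
  obtain ⟨R', hR', hball⟩ := Metric.isOpen_iff.1 (C.isOpen_inter_preimage_symm hV) (C q)
    ⟨C.map_source hqC, by rwa [Set.mem_preimage, C.left_inv hqC]⟩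
  obtain ⟨R, hR0, hRR⟩ : ∃ R, 0 < R ∧ R < R' := exists_between hR'
  -- The cutoff is applied to the squared distance and becomes `1` at `2 r`, that is, at radius `R`.
  obtain ⟨r, hr, hR⟩ : ∃ r, 0 < r ∧ 2 * r = R ^ 2 := ⟨R ^ 2 / 2, by positivity, by ring⟩
  have hbt : Metric.closedBall (C q) R ⊆ C.target := fun y hy ↦
    (hball (Metric.closedBall_subset_ball hRR hy)).1
  set K := C.symm '' Metric.closedBall (C q) R
  have hK : IsCompact K := (isCompact_closedBall _ _).image_of_continuousOn
    (C.continuousOn_symm.mono hbt)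
  have hKC : K ⊆ C.source := by
    rintro _ ⟨y, hy, rfl⟩
    exact C.map_target (hbt hy)
  have hqK : q ∈ K := ⟨C q, Metric.mem_closedBall_self hR0.le, C.left_inv hqC⟩
  have hsev : ∀ x, x ≠ q → ∀ᶠ y in 𝓝 x, IsSectionAt e s y := fun x hx ↦ by
    filter_upwards [isOpen_ne.mem_nhds hx] with y hy using hs y hy
  set α : M → Plane →L[ℝ] ℂ := fun x ↦ chartCutoff C q r x • sectionForm e s x with hα
  have hα0 : α =ᶠ[𝓝 q] fun _ ↦ 0 := by
    filter_upwards [chartCutoff_eventually hC hr] with x hx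
    exact ContinuousLinearMap.ext fun v ↦ by
      simp only [hα, hx, _root_.smul_apply, smul_eq_mul, zero_mul, _root_.zero_apply]
  have hsm : ∀ x, IsSmoothFormAt α x := by
    intro x
    by_cases hx : x = q
    · rw [hx]
      exact isSmoothFormAt_of_eventuallyEq_zero hα0
    · exact (isSmoothFormAt_sectionForm he (hsev x hx)).smul
        (contMDiffAt_chartCutoff hC hr hR hR0 hK hKC x)
  have hcl : ∀ x, x ∉ K → IsClosedFormAt α x := by
    intro x hx
    obtain ⟨g, hg⟩ := exists_log_sectionForm he (hsev x fun h ↦ hx (h ▸ hqK))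
    refine isClosedFormAt_of_dfun hg.self_of_nhds.1 ?_
    filter_upwards [hg, hK.isClosed.isOpen_compl.mem_nhds hx] with y hy hyK
    rw [hy.2, hα]
    exact ContinuousLinearMap.ext fun v ↦ by
      simp only [chartCutoff_of_notMem hr hR hR0 hyK, _root_.smul_apply, smul_eq_mul, one_mul]
  -- One formula covers the whole chart: at the centre and beyond radius `R'` both sides vanish, and
  -- in between it is the explicit computation.
  have hden : ∀ y ∈ C.target, extDensity α C y =
      2 * Complex.I * N * deriv (cutoff r) (Complex.normSq (planeIso (y - C q))) := by
    intro y hy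
    by_cases hyq : y = C q
    · rw [hyq, extDensity_eq_zero hqC hα0, sub_self, map_zero, map_zero,
        deriv_cutoff_of_lt hr hr, Complex.ofReal_zero, mul_zero]
    by_cases hyR : dist y (C q) < R'
    · exact extDensity_chartCutoff he hC hs hV hVq hy (hball hyR).2 hyq
    · have hyK : C.symm y ∉ K := by
        rintro ⟨z, hz, hzy⟩
        rw [C.symm.injOn (hbt hz) hy hzy] at hz
        exact hyR (lt_of_le_of_lt hz hRR)
      have h1 := extDensity_eq_zero_of_isClosedFormAt (hA hCA) (C.map_target hy) (hsm _) (hcl _ hyK)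
      rw [C.right_inv hy] at h1
      rw [h1, deriv_cutoff_of_gt hr, Complex.ofReal_zero, mul_zero]
      rw [normSq_planeIso_sub, hR]
      gcongr
      exact lt_of_lt_of_le hRR (not_lt.1 hyR)
  have hint := chartIntegral_eq_zero hA hcov hpos hCA hsm hK hKC hcl
  have h2 : chartIntegral C (fun _ ↦ 1) α = ∫ y in C.target,
      2 * Complex.I * N * deriv (cutoff r) (Complex.normSq (planeIso (y - C q))) :=
    MeasureTheory.setIntegral_congr_fun C.open_target.measurableSet fun y hy ↦ by
      change 1 * extDensity α C y = _
      rw [one_mul, hden y hy]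
  rw [h2, MeasureTheory.setIntegral_eq_integral_of_forall_compl_eq_zero,
    MeasureTheory.integral_const_mul, integral_complex_ofReal] at hint
  · have h3 := integral_deriv_cutoff_pos hr (C q)
    have h4 := (mul_eq_zero.1 hint).resolve_right (Complex.ofReal_ne_zero.2 h3.ne')
    simpa [Complex.I_ne_zero] using h4
  · intro y hy
    rw [deriv_cutoff_of_gt hr, Complex.ofReal_zero, mul_zero]
    rw [normSq_planeIso_sub, hR]
    gcongr
    exact not_le.1 fun h ↦ hy (hbt h)

/-- A flat line bundle on a closed orientable surface has a nowhere vanishing smooth section. -/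
theorem exists_isSectionAt [CompactSpace M] [ConnectedSpace M] (hM : IsOrientable M)
    (he : IsFlatFrame e) : ∃ s, ∀ x, IsSectionAt e s x := by
  classical
  obtain ⟨A, hA, hcov, hpos⟩ := hM
  choose c hcA hc using hcov
  have hchart : ∀ p, IsChartAt (c p) p := fun p ↦ ⟨hA (hcA p), hc p⟩
  obtain ⟨s, n, hs⟩ := exists_hasOrderAt_section he hchart
  obtain ⟨q⟩ := (inferInstance : Nonempty M)
  obtain ⟨N, s', hs', hN⟩ := exists_isSectionAt_off_point he hchart hs q
  have h0 : N = 0 := eq_zero_of_section_off_point hA (fun x ↦ ⟨c x, hcA x, hc x⟩) hpos (hcA q)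
    (hc q) he hs' hN
  -- With `N = 0` the section is `1` in the frame `e q` off `q`, and this value at `q` extends it.
  refine ⟨Function.update s' q (e q q)⁻¹, fun x ↦ ?_⟩
  by_cases hx : x = q
  · rw [hx]
    refine ⟨by rw [Function.update_self]; exact inv_ne_zero (he.ne_zero q q), ?_⟩
    refine (contMDiffAt_const (c := (1 : ℂ))).congr_of_eventuallyEq ?_
    filter_upwards [eventually_nhdsWithin_iff.1 hN] with y hy
    by_cases hyq : y = q
    · rw [hyq, Function.update_self, mul_inv_cancel₀ (he.ne_zero q q)]
    · rw [Function.update_of_ne hyq, hy hyq, h0, zpow_zero]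
  · refine ⟨by rw [Function.update_of_ne hx]; exact (hs' x hx).ne_zero,
      (hs' x hx).smooth.congr_of_eventuallyEq ?_⟩
    filter_upwards [isOpen_ne.mem_nhds hx] with y hy
    rw [Function.update_of_ne hy]

end

end FlatLine
end

theorem mainTheorem2 {M : Type*} [TopologicalSpace M] [T2Space M] [CompactSpace M]
    [ConnectedSpace M] [ChartedSpace FlatLine.Plane M] [IsManifold (𝓡 2) ∞ M]
    (hM : FlatLine.IsOrientable M) (x₀ : M) (𝔾 : FlatLine.StructureGroup) :
    (∀ (D : FlatLine.FlatConnection M x₀ 𝔾) (ρ : FundamentalGroup M x₀ →* 𝔾.toSubgroup),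
      D.1.IsHolonomy ρ ↔ ρ = D.1.holonomy x₀ 𝔾.toSubgroup) ∧
    (FlatLine.holonomyFunctor M x₀ 𝔾).IsEquivalence := by
  refine ⟨fun D ρ ↦ FlatLine.Connection.isHolonomy_iff_eq_holonomy D.2.1 D.2.2 ρ, ?_⟩
  exact FlatLine.isEquivalence_holonomyFunctor 𝔾 x₀ fun e he ↦ FlatLine.exists_isSectionAt hM he
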